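/- \textbf{Theorem.} Let $\mathfrak g$ be a finite-dimensional Lie algebra with trivial center over a field $\mathbb K$ of characteristic $0$, with radical $\mathfrak r$. \emph{Notation.} Let $e(\mathrm{ad}\,\mathfrak g)$ be the smallest algebraic Lie subalgebra of $\mathfrak{gl}(\mathfrak g)$ containing $\mathrm{ad}\,\mathfrak g$ (a Lie subalgebra is algebraic if it is the Lie algebra of an algebraic subgroup of $GL(\mathfrak g)$). Let $\Gamma$ be maximal among the Lie subalgebras of $e(\mathrm{ad}\,\mathfrak g)$ whose natural action on $\mathfrak g$ is semisimple. Let $\mathfrak g=\mathfrak s\oplus\mathfrak k\oplus\mathfrak m$ be a corresponding $\Gamma$-decomposition, that is: $\mathfrak s$ is a Levi subalgebra of $\mathfrak g$ with $\mathrm{ad}\,\mathfrak s\subset\Gamma$; $\mathfrak k=\mathfrak g^\Gamma=\{x:\gamma x=0\ \forall\gamma\in\Gamma\}$ is a nilpotent subalgebra with $[\mathfrak s,\mathfrak k]=0$; $\mathfrak m=\Gamma\cdot\mathfrak r$ (the span of all $\gamma x$ with $\gamma\in\Gamma$, $x\in\mathfrak r$); $\mathfrak r=\mathfrak k\oplus\mathfrak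 m$ as vector spaces; and $[\mathfrak s\oplus\mathfrak k,\mathfrak m]=\mathfrak m$. Let $\mu:\mathfrak k\to\mathfrak{gl}(\mathfrak m)$, $\mu(x)=\mathrm{ad}\,x|_{\mathfrak m}$. Let $\hat{\mathfrak n}$ be the Lie subalgebra of $\mathfrak g$ generated by $\mathfrak m$, and let $\mathfrak B=(\mathrm{Der}\,\hat{\mathfrak n})^\Gamma|_{\mathfrak m}\subset\mathfrak{gl}(\mathfrak m)$ be the Lie algebra of restrictions to $\mathfrak m$ of those derivations of $\hat{\mathfrak n}$ which commute with the action of $\Gamma$ and map $\mathfrak m$ into itself. Put $N^0=\mu(\mathfrak k)$ and let $N^{n+1}$ be the normalizer of $N^n$ in $\mathfrak B$. On $\mathfrak s\oplus\mathfrak B\oplus\mathfrak m$ let $\Phi$ be the alternating bilinear law given, for $x_i\in\mathfrak s$, $y_i\in\mathfrak B$, $z_i\in\mathfrak m$, by \[\Phi(x_1,x_2)=[x_1,x_2],\quad \Phi(x_1,y_2)=0,\quad \Phi(x_1,z_2)=[x_1,z_2],\] \[\Phi(y_1,y_2)=y_1y_2-y_2y_1,\quad \Phi(y_1,z_2)=y_1(z_2),\quad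 \Phi(z_1,z_2)=\mu(c)+w,\] where $c$ and $w$ are the components of $[z_1,z_2]$ in $\mathfrak k$ and $\mathfrak m$. Let $\mathfrak g_0=\mathfrak g$, $\mathfrak g_{n+1}=\mathrm{Der}\,\mathfrak g_n$ be the derivation tower. \emph{Claim.} \begin{enumerate} \item All $N^n$ are contained in $\mathfrak B$, each $N^n$ is an ideal of $N^{n+1}$, and $N^{q+1}=N^q$ for some integer $q$. \item $\Phi$ is a Lie bracket on $\mathfrak s\oplus\mathfrak B\oplus\mathfrak m$, and every $\mathfrak s\oplus N^n\oplus\mathfrak m$ is a Lie subalgebra. \item There are Lie algebra isomorphisms $\varphi_n:\mathfrak g_n\to\mathfrak s\oplus N^n\oplus\mathfrak m$ with $\varphi_0(x+y+z)=x+\mu(y)+z$ for $x\in\mathfrak s,y\in\mathfrak k,z\in\mathfrak m$, and $\varphi_{n+1}(\mathrm{ad}\,a)=\varphi_n(a)$ for all $n$ and $a\in\mathfrak g_n$. \item Whenever $N^{q+1}=N^q$, one has $N^n=N^q$ and $\mathrm{ad}:\mathfrak g_n\to\mathfrak g_{n+1}$ is bijective for all $n\ge q$, and the limit $\widehat{\mathfrak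 g}=\mathfrak s\oplus N^q\oplus\mathfrak m$ of the tower is a complete Lie algebra (its center is trivial and all its derivations are inner). \end{enumerate} -/

import Mathlib

universe u v

attribute [local instance 100] LieRing.ofAssociativeRing

/-! ### Algebraic Lie algebras -/

/-- Evaluation of a polynomial function in the entries of two matrices. -/
noncomputable def matrixEval {K : Type u} [Field K] {d : ℕ} {A : Type u} [CommRing A] [Algebra K A]
    (g h : Matrix (Fin d) (Fin d) A) :
    MvPolynomial ((Fin d × Fin d) ⊕ (Fin d × Fin d)) K →ₐ[K] A :=
  MvPolynomial.aeval (Sum.elim (fun ij => g ij.1 ij.2) (fun ij => h ij.1 ij.2))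

/-- `g ∈ GL_d(A)` solves the system `E` of polynomial equations in the entries of `g` and `g⁻¹`. -/
def SolvesEqns {K : Type u} [Field K] {d : ℕ}
    (E : Set (MvPolynomial ((Fin d × Fin d) ⊕ (Fin d × Fin d)) K))
    {A : Type u} [CommRing A] [Algebra K A] (g : GL (Fin d) A) : Prop :=
  ∀ p ∈ E, matrixEval (g : Matrix (Fin d) (Fin d) A)
    ((g⁻¹ : GL (Fin d) A) : Matrix (Fin d) (Fin d) A) p = 0

/-- An algebraic subgroup of `GL_d` over `K`: a system of polynomial equations over `K` whose
solutions in `GL_d(A)` form a subgroup for every commutative `K`-algebra `A`. -/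
structure LinearAlgebraicGroup (K : Type u) [Field K] (d : ℕ) where
  eqns : Set (MvPolynomial ((Fin d × Fin d) ⊕ (Fin d × Fin d)) K)
  one_mem : ∀ (A : Type u) [CommRing A] [Algebra K A],
    SolvesEqns eqns (1 : GL (Fin d) A)
  mul_mem : ∀ (A : Type u) [CommRing A] [Algebra K A] (g h : GL (Fin d) A),
    SolvesEqns eqns g → SolvesEqns eqns h → SolvesEqns eqns (g * h)
  inv_mem : ∀ (A : Type u) [CommRing A] [Algebra K A] (g : GL (Fin d) A),
    SolvesEqns eqns g → SolvesEqns eqns g⁻¹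

/-- `X` lies in the Lie algebra of `G`: the point `1 + εX` of `GL_d(K[ε])`, whose inverse is
`1 - εX`, belongs to `G`. -/
def LinearAlgebraicGroup.IsTangent {K : Type u} [Field K] {d : ℕ} (G : LinearAlgebraicGroup K d)
    (X : Matrix (Fin d) (Fin d) K) : Prop :=
  ∀ p ∈ G.eqns, matrixEval (A := DualNumber K)
    (1 + X.map (TrivSqZeroExt.inr : K → DualNumber K))
    (1 - X.map (TrivSqZeroExt.inr : K → DualNumber K)) p = 0

/-- A Lie subalgebra of `gl(V)` is algebraic if it is the Lie algebra of an algebraic subgroup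
of `GL(V)`. -/
def IsAlgebraicLie {K : Type u} [Field K] {V : Type v} [AddCommGroup V] [Module K V]
    [FiniteDimensional K V] (h : LieSubalgebra K (Module.End K V)) : Prop :=
  ∃ G : LinearAlgebraicGroup K (Module.finrank K V), ∀ f : Module.End K V,
    f ∈ h ↔ G.IsTangent
      (LinearMap.toMatrix (Module.finBasis K V) (Module.finBasis K V) f)

/-- `e(ad g)`: the smallest algebraic Lie subalgebra of `gl(g)` containing `ad g`. -/
noncomputable def algHullAd (K : Type u) [Field K] (g : Type v) [LieRing g] [LieAlgebra K g]
    [FiniteDimensional K g] : LieSubalgebra K (Module.End K g) :=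
  sInf {h | IsAlgebraicLie h ∧ (LieAlgebra.ad K g).range ≤ h}

/-! ### Completely reducible subalgebras and Γ-triples -/

/-- A Lie subalgebra of `gl(V)` is completely reducible if its natural action on `V` is
semisimple. -/
def IsCompletelyReducible {K : Type u} [Field K] {V : Type v} [AddCommGroup V] [Module K V]
    (Γ : LieSubalgebra K (Module.End K V)) : Prop :=
  ∀ W : Submodule K V, (∀ γ ∈ Γ, ∀ w ∈ W, γ w ∈ W) →
    ∃ W' : Submodule K V, (∀ γ ∈ Γ, ∀ w ∈ W', γ w ∈ W') ∧ IsCompl W W'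

/-- `Γ` is maximal among the completely reducible Lie subalgebras of `e`. -/
def IsMaxCompletelyReducible {K : Type u} [Field K] {V : Type v} [AddCommGroup V] [Module K V]
    (e Γ : LieSubalgebra K (Module.End K V)) : Prop :=
  Maximal (fun Δ : LieSubalgebra K (Module.End K V) => Δ ≤ e ∧ IsCompletelyReducible Δ) Γ

/-- `(s, k, m)` is the `Γ`-triple of `g`, where `Γ` is a maximal completely reducible subalgebra
of `e(ad g)`. In particular `g = s ⊕ k ⊕ m` as a vector space, by `levi`, `disjoint` and `sup_eq`.
The last three fields express that `Γ` and `(s, k, m)` correspond to each other. -/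
structure IsGammaTriple {K : Type u} [Field K] {g : Type v} [LieRing g] [LieAlgebra K g]
    [FiniteDimensional K g] (Γ : LieSubalgebra K (Module.End K g))
    (s k : LieSubalgebra K g) (m : Submodule K g) : Prop where
  mcr : IsMaxCompletelyReducible (algHullAd K g) Γ
  /-- `s` is a Levi subalgebra -/
  levi : IsCompl s.toSubmodule (LieAlgebra.radical K g).toSubmodule
  nilpotent : LieRing.IsNilpotent k
  lie_s_k : ∀ x ∈ s, ∀ y ∈ k, ⁅x, y⁆ = 0
  /-- the radical is the direct sum of `k` and `m` -/
  disjoint : Disjoint k.toSubmodule m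
  sup_eq : k.toSubmodule ⊔ m = (LieAlgebra.radical K g).toSubmodule
  /-- `[s ⊕ k, m] = m` -/
  lie_m : Submodule.span K {w | ∃ x ∈ s.toSubmodule ⊔ k.toSubmodule, ∃ z ∈ m, ⁅x, z⁆ = w} = m
  ad_s_le : ∀ x ∈ s, LieAlgebra.ad K g x ∈ Γ
  /-- `k = g^Γ` -/
  mem_k : ∀ x : g, x ∈ k ↔ ∀ γ ∈ Γ, γ x = 0
  /-- `m = Γ · r` -/
  m_eq : m = Submodule.span K {w | ∃ γ ∈ Γ, ∃ x ∈ LieAlgebra.radical K g, γ x = w}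

namespace IsGammaTriple

variable {K : Type u} [Field K] {g : Type v} [LieRing g] [LieAlgebra K g]
    [FiniteDimensional K g] {Γ : LieSubalgebra K (Module.End K g)}
    {s k : LieSubalgebra K g} {m : Submodule K g}

theorem s_lie_mem (h : IsGammaTriple Γ s k m) {x z : g} (hx : x ∈ s) (hz : z ∈ m) :
    ⁅x, z⁆ ∈ m := by
  rw [← h.lie_m]
  exact Submodule.subset_span ⟨x, Submodule.mem_sup_left hx, z, hz, rfl⟩

theorem k_lie_mem (h : IsGammaTriple Γ s k m) {x z : g} (hx : x ∈ k) (hz : z ∈ m) :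
    ⁅x, z⁆ ∈ m := by
  rw [← h.lie_m]
  exact Submodule.subset_span ⟨x, Submodule.mem_sup_right hx, z, hz, rfl⟩

theorem isCompl_k (h : IsGammaTriple Γ s k m) :
    IsCompl k.toSubmodule (s.toSubmodule ⊔ m) := by
  have hl := h.levi
  rw [← h.sup_eq] at hl
  constructor
  · rw [sup_comm]
    exact h.disjoint.disjoint_sup_right_of_disjoint_sup_left hl.disjoint.symm
  · rw [codisjoint_iff, sup_left_comm]
    exact hl.sup_eq_top

theorem isCompl_m (h : IsGammaTriple Γ s k m) :
    IsCompl m (s.toSubmodule ⊔ k.toSubmodule) := by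
  have hl := h.levi
  rw [← h.sup_eq, sup_comm k.toSubmodule] at hl
  constructor
  · rw [sup_comm]
    exact h.disjoint.symm.disjoint_sup_right_of_disjoint_sup_left hl.disjoint.symm
  · rw [codisjoint_iff, sup_left_comm]
    exact hl.sup_eq_top

/-- The projection of `g = s ⊕ k ⊕ m` onto `k`. -/
noncomputable def projK (h : IsGammaTriple Γ s k m) : g →ₗ[K] k :=
  Submodule.projectionOnto k.toSubmodule (s.toSubmodule ⊔ m) h.isCompl_k

/-- The projection of `g = s ⊕ k ⊕ m` onto `m`. -/
noncomputable def projM (h : IsGammaTriple Γ s k m) : g →ₗ[K] m :=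
  Submodule.projectionOnto m (s.toSubmodule ⊔ k.toSubmodule) h.isCompl_m

/-- The representation `x ↦ ad x|_m` of `s` in `m`. -/
def sigma (h : IsGammaTriple Γ s k m) : s →ₗ⁅K⁆ Module.End K m where
  toFun x :=
    { toFun z := ⟨⁅(x : g), (z : g)⁆, h.s_lie_mem x.2 z.2⟩
      map_add' z w := by ext; simp
      map_smul' c z := by ext; simp }
  map_add' x y := by ext z; simp
  map_smul' c x := by ext z; simp
  map_lie' := by intro x y; ext z; simp [Ring.lie_def]

/-- The representation `μ : x ↦ ad x|_m` of `k` in `m`. -/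
def mu (h : IsGammaTriple Γ s k m) : k →ₗ⁅K⁆ Module.End K m where
  toFun x :=
    { toFun z := ⟨⁅(x : g), (z : g)⁆, h.k_lie_mem x.2 z.2⟩
      map_add' z w := by ext; simp
      map_smul' c z := by ext; simp }
  map_add' x y := by ext z; simp
  map_smul' c x := by ext z; simp
  map_lie' := by intro x y; ext z; simp [Ring.lie_def]

/-- The bilinear law `Φ`, written on `s ⊕ gl(m) ⊕ m`:
`Φ(x₁, x₂) = [x₁, x₂]`, `Φ(x₁, y₂) = 0`, `Φ(x₁, z₂) = [x₁, z₂]`, `Φ(y₁, y₂) = y₁y₂ - y₂y₁`,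
`Φ(y₁, z₂) = y₁ z₂` and `Φ(z₁, z₂) = μ(c) + w`, where `c` and `w` are the components in `k` and `m`
of the bracket `[z₁, z₂]` of `g`. -/
noncomputable def law (h : IsGammaTriple Γ s k m) :
    (s × Module.End K m × m) →ₗ[K] (s × Module.End K m × m) →ₗ[K] (s × Module.End K m × m) :=
  LinearMap.mk₂ K
    (fun a b =>
      (⁅a.1, b.1⁆,
       ⁅a.2.1, b.2.1⁆ + h.mu (h.projK ⁅(a.2.2 : g), (b.2.2 : g)⁆),
       h.sigma a.1 b.2.2 - h.sigma b.1 a.2.2 + a.2.1 b.2.2 - b.2.1 a.2.2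
         + h.projM ⁅(a.2.2 : g), (b.2.2 : g)⁆))
    (by
      intro a a' b
      refine Prod.ext ?_ (Prod.ext ?_ ?_)
      · simp
      · simp; abel
      · simp; abel)
    (by
      intro c a b
      refine Prod.ext ?_ (Prod.ext ?_ ?_)
      · simp
      · simp
      · simp [smul_sub])
    (by
      intro a b b'
      refine Prod.ext ?_ (Prod.ext ?_ ?_)
      · simp
      · simp; abel
      · simp; abel)
    (by
      intro c a b
      refine Prod.ext ?_ (Prod.ext ?_ ?_)
      · simp
      · simp
      · simp [smul_sub])

end IsGammaTriple

/-! ### The algebra `B` and the iterated normalizers -/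

/-- `B = (Der n̂)^Γ|_m`, where `n̂` is the Lie subalgebra of `g` generated by `m`: the restrictions
to `m` of the derivations `δ` of `n̂` that map `m` to itself and commute with the action of `Γ`. -/
def algB {K : Type u} [Field K] {g : Type v} [LieRing g] [LieAlgebra K g]
    (Γ : LieSubalgebra K (Module.End K g)) (m : Submodule K g) :
    LieSubalgebra K (Module.End K m) where
  carrier := {f | ∃ δ : LieDerivation K (LieSubalgebra.lieSpan K g (m : Set g))
      (LieSubalgebra.lieSpan K g (m : Set g)),
    (∀ γ ∈ Γ, ∀ x y : LieSubalgebra.lieSpan K g (m : Set g),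
      (y : g) = γ (x : g) → (δ y : g) = γ (δ x : g)) ∧
    ∀ z : m, (δ ⟨(z : g), LieSubalgebra.subset_lieSpan z.2⟩ : g) = (f z : g)}
  add_mem' := by
    rintro f f' ⟨δ, h1, h2⟩ ⟨δ', h1', h2'⟩
    refine ⟨δ + δ', fun γ hγ x y hxy => ?_, fun z => ?_⟩
    · simp [h1 γ hγ x y hxy, h1' γ hγ x y hxy]
    · simp [h2, h2']
  zero_mem' := ⟨0, by simp, by simp⟩
  smul_mem' := by
    rintro c f ⟨δ, h1, h2⟩
    refine ⟨c • δ, fun γ hγ x y hxy => ?_, fun z => ?_⟩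
    · simp [h1 γ hγ x y hxy]
    · simp [h2]
  lie_mem' := by
    rintro f f' ⟨δ, h1, h2⟩ ⟨δ', h1', h2'⟩
    refine ⟨⁅δ, δ'⁆, fun γ hγ x y hxy => ?_, fun z => ?_⟩
    · have e1 := h1 γ hγ _ _ (h1' γ hγ x y hxy)
      have e2 := h1' γ hγ _ _ (h1 γ hγ x y hxy)
      simp [e1, e2]
    · have e1 : δ' ⟨(z : g), LieSubalgebra.subset_lieSpan z.2⟩
          = ⟨(f' z : g), LieSubalgebra.subset_lieSpan (f' z).2⟩ := Subtype.ext (h2' z)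
      have e2 : δ ⟨(z : g), LieSubalgebra.subset_lieSpan z.2⟩
          = ⟨(f z : g), LieSubalgebra.subset_lieSpan (f z).2⟩ := Subtype.ext (h2 z)
      simp [e1, e2, h2, h2', Ring.lie_def]

/-- The iterated normalizers in `B`: `N⁰ = A` and `Nⁿ⁺¹` is the normalizer of `Nⁿ` in `B`. -/
def iterNormalizer {K : Type u} [Field K] {L : Type v} [LieRing L] [LieAlgebra K L]
    (B A : LieSubalgebra K L) : ℕ → LieSubalgebra K L
  | 0 => A
  | n + 1 => B ⊓ (iterNormalizer B A n).normalizer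

/-! ### The Lie algebras `s ⊕ N ⊕ m` -/

/-- The bilinear map `Φ` restricts to a Lie bracket on the subspace `W`. -/
structure IsLieOn {K : Type u} [Field K] {V : Type v} [AddCommGroup V] [Module K V]
    (Φ : V →ₗ[K] V →ₗ[K] V) (W : Submodule K V) : Prop where
  mem : ∀ a ∈ W, ∀ b ∈ W, Φ a b ∈ W
  self : ∀ a ∈ W, Φ a a = 0
  leibniz : ∀ a ∈ W, ∀ b ∈ W, ∀ c ∈ W, Φ a (Φ b c) = Φ (Φ a b) c + Φ b (Φ a c)

namespace IsLieOn

variable {K : Type u} [Field K] {V : Type v} [AddCommGroup V] [Module K V]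
    {Φ : V →ₗ[K] V →ₗ[K] V} {W : Submodule K V}

/-- The subspace `W` as a Lie algebra with bracket `Φ`. -/
def Carrier (_ : IsLieOn Φ W) : Type v := W

instance (h : IsLieOn Φ W) : AddCommGroup h.Carrier := inferInstanceAs (AddCommGroup W)

instance (h : IsLieOn Φ W) : Module K h.Carrier := inferInstanceAs (Module K W)

/-- The inclusion of `W` in `V`. -/
def incl (h : IsLieOn Φ W) : h.Carrier →ₗ[K] V := W.subtype

theorem incl_injective (h : IsLieOn Φ W) : Function.Injective h.incl := W.injective_subtype

theorem incl_mem (h : IsLieOn Φ W) (a : h.Carrier) : h.incl a ∈ W := Subtype.property (p := (· ∈ W)) a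

instance (h : IsLieOn Φ W) : Bracket h.Carrier h.Carrier where
  bracket a b := (⟨Φ (h.incl a) (h.incl b), h.mem _ (h.incl_mem a) _ (h.incl_mem b)⟩ : W)

theorem incl_lie (h : IsLieOn Φ W) (a b : h.Carrier) : h.incl ⁅a, b⁆ = Φ (h.incl a) (h.incl b) := rfl

instance (h : IsLieOn Φ W) : LieRing h.Carrier where
  add_lie a b c := h.incl_injective (by simp [incl_lie])
  lie_add a b c := h.incl_injective (by simp [incl_lie])
  lie_self a := h.incl_injective (by simp [incl_lie, h.self _ (h.incl_mem a)])
  leibniz_lie a b c := h.incl_injective (by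
    simp [incl_lie, h.leibniz _ (h.incl_mem a) _ (h.incl_mem b) _ (h.incl_mem c)])

instance (h : IsLieOn Φ W) : LieAlgebra K h.Carrier where
  lie_smul c a b := h.incl_injective (by simp [incl_lie])

end IsLieOn

/-- The subspace `s ⊕ N ⊕ m` of `s ⊕ gl(m) ⊕ m`. -/
def gammaSum {K : Type u} [Field K] {g : Type v} [LieRing g] [LieAlgebra K g]
    (s : LieSubalgebra K g) {m : Submodule K g} (N : LieSubalgebra K (Module.End K m)) :
    Submodule K (s × Module.End K m × m) :=
  Submodule.prod ⊤ (Submodule.prod N.toSubmodule ⊤)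

/-! ### Complete Lie algebras and the derivation tower -/

/-- A Lie algebra is complete if its center is trivial and all its derivations are inner. -/
def IsCompleteLie (K : Type u) [Field K] (L : Type v) [LieRing L] [LieAlgebra K L] : Prop :=
  LieAlgebra.center K L = ⊥ ∧ ∀ D : LieDerivation K L L, ∃ x : L, LieDerivation.ad K L x = D

/-- A Lie algebra over `K` with its underlying type. -/
structure BundledLie (K : Type u) [Field K] where
  carrier : Type v
  [lieRing : LieRing carrier]
  [lieAlgebra : LieAlgebra K carrier]

attribute [instance] BundledLie.lieRing BundledLie.lieAlgebra

/-- The derivation tower `g₀ = g`, `gₙ₊₁ = Der gₙ`. -/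
def derTower (K : Type u) [Field K] (g : Type v) [LieRing g] [LieAlgebra K g] :
    ℕ → BundledLie.{u, v} K
  | 0 => ⟨g⟩
  | n + 1 => ⟨LieDerivation K (derTower K g n).carrier (derTower K g n).carrier⟩

/-- The canonical map `ad : gₙ → gₙ₊₁ = Der gₙ`. -/
def derTowerAd (K : Type u) [Field K] (g : Type v) [LieRing g] [LieAlgebra K g] (n : ℕ) :
    (derTower K g n).carrier →ₗ⁅K⁆ (derTower K g (n + 1)).carrier :=
  LieDerivation.ad K (derTower K g n).carrier

/-!
Let `L = s ⊕ N ⊕ m` with the law `Φ`, where `μ(k) ⊆ N ⊆ B` and `k` acts nilpotently on `N`. All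
rests on the statement that `Der L` is `s ⊕ N' ⊕ m`, acting on `L` by `Φ`, where
`N'` is the normalizer of `N` in `B` (`IsGammaTriple.exists_law_eq_derivation`). Since `[μ(k),
N'] ⊆ N`, the hypotheses pass from `N` to `N'`, so the tower is obtained by induction, starting
from `g = s ⊕ μ(k) ⊕ m` (`μ` is injective as `g` has no center). The sequence `Nⁿ` becomes
stationary for reasons of dimension. That `Φ` is a Lie bracket on `s ⊕ B ⊕ m` is a computation
(`IsGammaTriple.isLieOn_gammaSum`), using that the elements of `B` respect both components, in
`k` and in `m`, of the brackets of elements of `m`.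

To determine a derivation `D` of `L`, it is first changed by inner derivations
(`LieDerivation.exists_add_ad_of_decomp`): complete reducibility for `s` and the Fitting
decomposition for `k`, both applied to `Der L`, make `D` commute with `s` and nilpotent under
`k`. Such a `D` kills `s`, preserves `N` (the null component of `k` in the invariants of `s`) and
preserves `m`: the component of `D m` in `s` vanishes because derivations map solvable ideals
into the radical, and the component in `N` because `m = [s, m] + [k, m]`. Here and below the
essential tool is `eq_zero_of_invariant_of_le_sup_actSpan`: in a space `W = s W + k W`, nothing
but zero is invariant under both `s` and `k`. Then `d = D|_m` normalizes `N`, and `D` induces on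
the ideal `n̂` of `g` generated by `m` a derivation `δ` extending `d`. It remains to see that `δ`
commutes with `Γ`.

One has `Γ = ad s + T`, where `T` consists of semisimple elements killing `s`
(`IsGammaTriple.exists_ad_add`); `δ` commutes with `ad s`. For `t ∈ T`, the fact that `t` lies in
the algebraic hull of `ad g` is used through `lie_mem_of_mem_algHullAd`: for subspaces `W ⊆ U` of
`gl(g)`, the Lie algebra of all `X` with `[X, U] ⊆ W` is algebraic, so it contains the hull as
soon as it contains `ad g`. Hence `[t, δ]` is, like `[ad x, δ]`, the restriction to `n̂` of an
inner derivation of `L`. Therefore `[t, [t, δ]]` is the restriction of `ad z` for some `z ∈ m`.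
This operator commutes with the actions of `s` and `k`, so it vanishes by the tool above, and
`[t, δ] = 0` because `t` is semisimple (`IsGammaTriple.lie_restrictSpan_eq_zero`).

Complete reducibility is needed only in the form that a module over a semisimple Lie algebra is
the direct sum of its invariants and of the span of the image of the action, and this is derived
from the Casimir operator of the trace form (`isCompl_maxTriv_lie_top`).
-/

/-! ### Invariants and coinvariants of semisimple Lie algebras -/

/-- A perfect Lie algebra acts trivially on every nilpotent module. -/
theorem lie_eq_zero_of_isNilpotent_of_perfect {K L M : Type*} [Field K] [LieRing L] [LieAlgebra K L]
    [AddCommGroup M] [Module K M] [LieRingModule L M] [LieModule K L M]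
    [LieModule.IsNilpotent L M]
    (hperf : ⁅(⊤ : LieIdeal K L), (⊤ : LieIdeal K L)⁆ = ⊤) (x : L) (m : M) : ⁅x, m⁆ = 0 := by
  have key : ∀ j : ℕ, ∀ x : L, ∀ m : M, ⁅x, m⁆ ∈ LieModule.lowerCentralSeries K L M j := by
    intro j
    induction j with
    | zero => intro x m; simp
    | succ j ih =>
      intro x m
      have hx : x ∈ ⁅(⊤ : LieIdeal K L), (⊤ : LieIdeal K L)⁆ := by rw [hperf]; trivial
      rw [← LieSubmodule.mem_toSubmodule, LieSubmodule.lieIdeal_oper_eq_linear_span'] at hx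
      induction hx using Submodule.span_induction with
      | mem y hy =>
        obtain ⟨a, -, b, -, rfl⟩ := hy
        rw [lie_lie, LieModule.lowerCentralSeries_succ]
        exact sub_mem (LieSubmodule.lie_mem_lie trivial (ih _ _))
          (LieSubmodule.lie_mem_lie trivial (ih _ _))
      | zero => simp
      | add a b _ _ ha hb => rw [add_lie]; exact add_mem ha hb
      | smul c a _ ha =>
        rw [smul_lie]; exact (LieModule.lowerCentralSeries K L M (j + 1)).smul_mem c ha
  obtain ⟨j, hj⟩ := LieModule.IsNilpotent.nilpotent K L M
  have := key j x m
  rwa [hj, LieSubmodule.mem_bot] at this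

/-- Ideals of Killing Lie algebras are perfect. -/
theorem LieIdeal.lie_self_of_isKilling {K L : Type*} [Field K] [LieRing L] [LieAlgebra K L]
    [Module.Finite K L] [LieAlgebra.IsKilling K L] (I : LieIdeal K L) : ⁅I, I⁆ = I := by
  apply le_antisymm (LieSubmodule.lie_le_left I I)
  have hdis : ∀ z ∈ I, z ∈ (⁅I, I⁆ : LieIdeal K L).killingCompl → z = 0 := by
    intro z hz hzc
    have hI := I.isCompl_killingCompl
    have hcen : z ∈ LieAlgebra.center K L := by
      rw [LieModule.mem_maxTrivSubmodule]
      intro x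
      obtain ⟨a, ha, b, hb, rfl⟩ := (LieSubmodule.mem_sup _ _ _).1
        (show x ∈ I ⊔ I.killingCompl by rw [hI.sup_eq_top]; trivial)
      have hb' : ⁅b, z⁆ = 0 := by
        have : ⁅b, z⁆ ∈ I ⊓ I.killingCompl :=
          ⟨lie_mem_right K L I b z hz, lie_mem_left K L _ b z hb⟩
        rwa [hI.inf_eq_bot, LieSubmodule.mem_bot] at this
      have ha' : ⁅a, z⁆ = 0 := by
        have : ⁅a, z⁆ ∈ I ⊓ I.killingCompl := by
          refine ⟨lie_mem_right K L I a z hz, ?_⟩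
          refine (LieIdeal.mem_killingCompl K L I).2 fun y hy => ?_
          have h1 := (LieIdeal.mem_killingCompl K L _).1 hzc ⁅y, a⁆
            (LieSubmodule.lie_mem_lie hy ha)
          rw [LieModule.traceForm_apply_lie_apply] at h1
          exact h1
        rwa [hI.inf_eq_bot, LieSubmodule.mem_bot] at this
      rw [add_lie, ha', hb', add_zero]
    rwa [LieAlgebra.center_eq_bot, LieSubmodule.mem_bot] at hcen
  intro x hx
  have hQ := (⁅I, I⁆ : LieIdeal K L).isCompl_killingCompl
  obtain ⟨a, ha, b, hb, rfl⟩ := (LieSubmodule.mem_sup _ _ _).1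
    (show x ∈ ⁅I, I⁆ ⊔ (⁅I, I⁆ : LieIdeal K L).killingCompl by rw [hQ.sup_eq_top]; trivial)
  have hbI : b ∈ I := by
    have := sub_mem hx (LieSubmodule.lie_le_left I I ha)
    simpa using this
  rw [hdis b hbI hb, add_zero]
  exact ha

/-- An ideal on which the trace form of a module vanishes acts trivially on the module. -/
theorem lie_eq_zero_of_traceForm_eq_zero {K L M : Type*} [Field K] [CharZero K] [LieRing L]
    [LieAlgebra K L] [Module.Finite K L] [LieAlgebra.IsKilling K L]
    [AddCommGroup M] [Module K M] [LieRingModule L M] [LieModule K L M] [Module.Finite K M]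
    (I : LieIdeal K L) (hI : LieModule.traceForm K I M = 0) (x : L) (hx : x ∈ I) (m : M) :
    ⁅x, m⁆ = 0 := by
  have h1 := LieModule.isNilpotent_derivedSeries_of_traceForm_eq_zero hI
  have hperf : ⁅(⊤ : LieIdeal K I), (⊤ : LieIdeal K I)⁆ = ⊤ := by
    have h2 : LieAlgebra.derivedSeries K I 1 = ⊤ := by
      rw [eq_top_iff]
      rintro ⟨y, hy⟩ -
      rw [LieIdeal.derivedSeries_eq_derivedSeriesOfIdeal_comap]
      rw [LieIdeal.mem_comap, LieAlgebra.derivedSeriesOfIdeal_succ,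
        LieAlgebra.derivedSeriesOfIdeal_zero, I.lie_self_of_isKilling]
      exact hy
    exact h2
  have h3 : LieModule.IsNilpotent I M := by
    rw [LieModule.isNilpotent_iff_forall' (R := K)]
    intro y
    have := (LieModule.isNilpotent_iff_forall' (R := K)).1 h1 ⟨y, by
      show y ∈ ⁅(⊤ : LieIdeal K I), (⊤ : LieIdeal K I)⁆
      rw [hperf]; trivial⟩
    exact this
  exact lie_eq_zero_of_isNilpotent_of_perfect (K := K) hperf (⟨x, hx⟩ : I) m

/-- If `X` acts on the families `u` and `w` by contragredient matrices, then it commutes with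
`∑ i, u i * w i`. -/
theorem commute_sum_mul_of_dual {K A ι : Type*} [Field K] [Ring A] [Algebra K A] [Fintype ι]
    (u w : ι → A) (p : ι → ι → K) (X : A)
    (hu : ∀ i, X * u i - u i * X = ∑ j, p i j • u j)
    (hw : ∀ i, X * w i - w i * X = -∑ j, p j i • w j) :
    X * ∑ i, u i * w i = (∑ i, u i * w i) * X := by
  have e : X * ∑ i, u i * w i - (∑ i, u i * w i) * X
      = ∑ i, (X * u i - u i * X) * w i + ∑ i, u i * (X * w i - w i * X) := by
    rw [← Finset.sum_add_distrib, Finset.mul_sum, Finset.sum_mul, ← Finset.sum_sub_distrib]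
    exact Finset.sum_congr rfl fun i _ => by noncomm_ring
  rw [← sub_eq_zero, e]
  simp only [hu, hw, Finset.sum_mul, mul_neg, Finset.mul_sum, Finset.sum_neg_distrib,
    smul_mul_assoc, mul_smul_comm]
  rw [Finset.sum_comm, add_neg_cancel]

open LieModule in
/-- The Casimir operator of the trace form of a module: it commutes with the action, its image is
contained in the span of all `⁅x, m⁆`, it kills the invariants, and if it is nilpotent then the
action is trivial. -/
theorem exists_casimir (K L M : Type*) [Field K] [CharZero K] [LieRing L]
    [LieAlgebra K L] [Module.Finite K L] [LieAlgebra.IsKilling K L]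
    [AddCommGroup M] [Module K M] [LieRingModule L M] [LieModule K L M] [Module.Finite K M] :
    ∃ c : Module.End K M, (∀ (x : L) (m : M), c ⁅x, m⁆ = ⁅x, c m⁆) ∧
      (∀ m, c m ∈ ⁅(⊤ : LieIdeal K L), (⊤ : LieSubmodule K L M)⁆) ∧
      (∀ m, (∀ x : L, ⁅x, m⁆ = 0) → c m = 0) ∧
      (IsNilpotent c → ∀ (x : L) (m : M), ⁅x, m⁆ = 0) := by
  classical
  have hinv := traceForm_lieInvariant K L M
  -- `I` is the radical of the trace form; the form is nondegenerate on the complementary ideal `J`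
  let I : LieIdeal K L := LieAlgebra.InvariantForm.orthogonal (traceForm K L M) hinv ⊤
  have hmemI : ∀ y, y ∈ I ↔ ∀ x, traceForm K L M x y = 0 := by
    intro y
    rw [LieAlgebra.InvariantForm.mem_orthogonal]
    simp
  have hI0 : ∀ x ∈ I, ∀ m : M, ⁅x, m⁆ = 0 := by
    apply lie_eq_zero_of_traceForm_eq_zero (K := K)
    ext ⟨x, hx⟩ ⟨y, hy⟩
    exact (hmemI y).1 hy x
  let J : LieIdeal K L := I.killingCompl
  have hIJ : IsCompl I J := I.isCompl_killingCompl
  let B : LinearMap.BilinForm K J := (traceForm K L M).restrict J.toSubmodule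
  have hBapp : ∀ x y : J, B x y = traceForm K L M x y := fun x y => rfl
  have hsymm : B.IsSymm := ⟨fun x y => traceForm_comm K L M x y⟩
  have hB : B.Nondegenerate := by
    refine hsymm.isRefl.nondegenerate_iff_separatingLeft.2 ?_
    intro x hx
    have : (x : L) ∈ I ⊓ J := by
      refine ⟨(hmemI _).2 fun y => ?_, x.2⟩
      obtain ⟨a, ha, b, hb, rfl⟩ := (LieSubmodule.mem_sup _ _ _).1
        (show y ∈ I ⊔ J by rw [hIJ.sup_eq_top]; trivial)
      have h1 := hx ⟨b, hb⟩
      rw [hBapp] at h1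
      have h2 := (hmemI _).1 ha x
      rw [map_add, LinearMap.add_apply, traceForm_comm K L M a, h2, zero_add, traceForm_comm]
      exact h1
    rw [hIJ.inf_eq_bot, LieSubmodule.mem_bot] at this
    exact Subtype.ext this
  let b := Module.finBasis K J
  let b' := B.dualBasis hB b
  let ρ := toEnd K L M
  let c : Module.End K M := ∑ i, ρ (b i) * ρ (b' i)
  have hexp : ∀ x : J, ρ x = ∑ j, B x (b' j) • ρ (b j) := by
    intro x
    conv_lhs => rw [← b.sum_repr x]
    have : ∀ j, b.repr x j = B x (b' j) := by
      intro j
      rw [← LinearMap.BilinForm.dualBasis_repr_apply hB b',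
        LinearMap.BilinForm.dualBasis_dualBasis hB hsymm]
    simp [this]
  have hexp' : ∀ x : J, ρ x = ∑ j, B x (b j) • ρ (b' j) := by
    intro x
    conv_lhs => rw [← b'.sum_repr x]
    have : ∀ j, b'.repr x j = B x (b j) := by
      intro j
      rw [LinearMap.BilinForm.dualBasis_repr_apply hB b]
    simp [this]
  have hcommJ : ∀ x : J, ρ x * c = c * ρ x := by
    intro x
    refine commute_sum_mul_of_dual _ _ (fun i j => B ⁅x, b i⁆ (b' j)) _ (fun i => ?_) fun i => ?_
    · rw [← hexp, ← Ring.lie_def, ← LieHom.map_lie]; rfl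
    · have h1 : ∀ j, B ⁅x, b j⁆ (b' i) = - B ⁅x, b' i⁆ (b j) := fun j => by
        rw [hBapp, hBapp]
        exact (hinv (x : L) (b j : L) (b' i : L)).trans
          (congrArg Neg.neg (traceForm_comm K L M (b j : L) (⁅(x : L), (b' i : L)⁆)))
      have h2 : ∑ j, B ⁅x, b j⁆ (b' i) • ρ (b' j) = - ρ (⁅x, b' i⁆ : J) := by
        rw [hexp' ⁅x, b' i⁆, ← Finset.sum_neg_distrib]
        exact Finset.sum_congr rfl fun j _ => by rw [h1, neg_smul]
      rw [h2, neg_neg, ← Ring.lie_def, ← LieHom.map_lie]; rfl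
  have hcomm : ∀ (x : L) (m : M), c ⁅x, m⁆ = ⁅x, c m⁆ := by
    intro x m
    obtain ⟨a, ha, d, hd, rfl⟩ := (LieSubmodule.mem_sup _ _ _).1
      (show x ∈ I ⊔ J by rw [hIJ.sup_eq_top]; trivial)
    rw [add_lie, add_lie, hI0 a ha, hI0 a ha, zero_add, zero_add]
    have := LinearMap.congr_fun (hcommJ ⟨d, hd⟩) m
    exact this.symm
  refine ⟨c, hcomm, ?_, ?_, ?_⟩
  · intro m
    simp only [c, LinearMap.sum_apply, Module.End.mul_apply]
    exact sum_mem fun i _ => LieSubmodule.lie_mem_lie trivial trivial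
  · intro m hm
    simp only [c, LinearMap.sum_apply, Module.End.mul_apply]
    refine Finset.sum_eq_zero fun i _ => ?_
    simp [ρ, hm]
  -- the trace of the Casimir operator is the dimension of `J`
  · intro hnil
    have htr : LinearMap.trace K M c = (Module.finrank K J : K) := by
      simp only [c, map_sum]
      have : ∀ i, LinearMap.trace K M (ρ (b i) * ρ (b' i)) = 1 := by
        intro i
        have := LinearMap.BilinForm.apply_dualBasis_right (B := B) hB hsymm b i i
        rw [if_pos rfl, hBapp, traceForm_apply_apply] at this
        exact this
      simp [this]
    have h0 := (LinearMap.isNilpotent_trace_of_isNilpotent hnil).eq_zero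
    rw [htr, Nat.cast_eq_zero] at h0
    have hJ : J = ⊥ := by
      rw [LieSubmodule.eq_bot_iff]
      intro x hx
      have := Module.finrank_zero_iff.1 h0
      exact congrArg Subtype.val (Subsingleton.elim (⟨x, hx⟩ : J) 0)
    rw [hJ] at hIJ
    have hI : I = ⊤ := by simpa using hIJ.sup_eq_top
    intro x m
    exact hI0 x (by rw [hI]; trivial) m

/-- Every finite-dimensional module `M` over a semisimple Lie algebra is the direct sum of its
invariants and of the span of all `⁅x, m⁆`. The proof is by induction on the dimension of `M`, using
the Fitting decomposition of the Casimir operator. -/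
theorem isCompl_maxTriv_lie_top (K L : Type*) [Field K] [CharZero K] [LieRing L]
    [LieAlgebra K L] [Module.Finite K L] [LieAlgebra.IsKilling K L] (n : ℕ) :
    ∀ (M : Type v) [AddCommGroup M] [Module K M] [LieRingModule L M] [LieModule K L M]
    [Module.Finite K M], Module.finrank K M = n →
    (∀ m : M, ∃ m₀ m₁ : M, m = m₀ + m₁ ∧ (∀ x : L, ⁅x, m₀⁆ = 0) ∧
      m₁ ∈ ⁅(⊤ : LieIdeal K L), (⊤ : LieSubmodule K L M)⁆) ∧
    (∀ m : M, (∀ x : L, ⁅x, m⁆ = 0) →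
      m ∈ ⁅(⊤ : LieIdeal K L), (⊤ : LieSubmodule K L M)⁆ → m = 0) := by
  induction n using Nat.strong_induction_on with
  | _ n ih =>
  intro M _ _ _ _ _ hn
  obtain ⟨c, hc1, hc2, hc3, hc4⟩ := exists_casimir K L M
  by_cases hnil : IsNilpotent c
  · have h0 := hc4 hnil
    refine ⟨fun m => ⟨m, 0, by simp, fun x => h0 x m, zero_mem _⟩, fun m hm' hm => ?_⟩
    clear hm'
    rw [← LieSubmodule.mem_toSubmodule, LieSubmodule.lieIdeal_oper_eq_linear_span'] at hm
    induction hm using Submodule.span_induction with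
    | mem y hy => obtain ⟨a, -, b, -, rfl⟩ := hy; exact h0 a b
    | zero => rfl
    | add a b _ _ ha hb => rw [ha, hb, add_zero]
    | smul c a _ ha => rw [ha, smul_zero]
  · obtain ⟨k, hk1, hk0⟩ := ((LinearMap.eventually_isCompl_ker_pow_range_pow c).and
      (Filter.eventually_ge_atTop 1)).exists
    have hck : ∀ (j : ℕ) (x : L) (m : M), (c ^ j) ⁅x, m⁆ = ⁅x, (c ^ j) m⁆ := by
      intro j
      induction j with
      | zero => intro x m; simp
      | succ j ihj => intro x m; rw [pow_succ, Module.End.mul_apply, hc1, ihj]; rfl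
    let M₀ : LieSubmodule K L M :=
      { LinearMap.ker (c ^ k) with
        lie_mem := by
          intro x m hm
          have hm' : (c ^ k) m = 0 := hm
          show (c ^ k) ⁅x, m⁆ = 0
          rw [hck, hm', lie_zero] }
    have hmem : ∀ m, m ∈ M₀ ↔ (c ^ k) m = 0 := fun m => Iff.rfl
    have hlt : Module.finrank K M₀ < n := by
      rw [← hn]
      apply Submodule.finrank_lt (s := M₀.toSubmodule)
      intro htop
      apply hnil
      refine ⟨k, LinearMap.ext fun m => ?_⟩
      have : m ∈ M₀.toSubmodule := by rw [htop]; trivial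
      exact this
    have hsub : ∀ w : M₀, w ∈ ⁅(⊤ : LieIdeal K L), (⊤ : LieSubmodule K L M₀)⁆ →
        (w : M) ∈ ⁅(⊤ : LieIdeal K L), (⊤ : LieSubmodule K L M)⁆ := by
      intro w hw
      have := LieSubmodule.mem_map_of_mem (f := M₀.incl) hw
      rw [LieSubmodule.map_bracket_eq] at this
      exact LieSubmodule.mono_lie_right _ le_top this
    obtain ⟨ih1, ih2⟩ := ih _ hlt M₀ rfl
    have hdec : ∀ m : M, ∃ a ∈ M₀, ∃ b : M, m = a + (c ^ k) b := by
      intro m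
      have : m ∈ LinearMap.ker (c ^ k) ⊔ LinearMap.range (c ^ k) := by
        rw [hk1.sup_eq_top]; trivial
      obtain ⟨a, ha, _, ⟨b, rfl⟩, rfl⟩ := Submodule.mem_sup.1 this
      exact ⟨a, ha, b, rfl⟩
    constructor
    · intro m
      obtain ⟨a, ha, b, rfl⟩ := hdec m
      obtain ⟨m₀, m₁, e, h0, h1⟩ := ih1 ⟨a, ha⟩
      refine ⟨m₀, m₁ + (c ^ k) b, ?_, fun x => ?_, add_mem (hsub _ h1) ?_⟩
      · rw [← add_assoc, ← LieSubmodule.coe_add, ← e]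
      · exact congrArg Subtype.val (h0 x)
      · obtain ⟨j, rfl⟩ := Nat.exists_eq_add_of_le' hk0
        rw [pow_succ', Module.End.mul_apply]
        exact hc2 _
    · intro m hm0 hm1
      have hmk : (c ^ k) m = 0 := by
        obtain ⟨j, rfl⟩ := Nat.exists_eq_add_of_le' hk0
        rw [pow_succ, Module.End.mul_apply, hc3 m hm0, map_zero]
      have : ∃ w : M₀, w ∈ ⁅(⊤ : LieIdeal K L), (⊤ : LieSubmodule K L M₀)⁆ ∧
          ∃ b, m = w + (c ^ k) b := by
        clear hm0 hmk
        rw [← LieSubmodule.mem_toSubmodule, LieSubmodule.lieIdeal_oper_eq_linear_span'] at hm1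
        induction hm1 using Submodule.span_induction with
        | mem y hy =>
          obtain ⟨x, -, z, -, rfl⟩ := hy
          obtain ⟨a, ha, b, rfl⟩ := hdec z
          refine ⟨⁅x, (⟨a, ha⟩ : M₀)⁆, LieSubmodule.lie_mem_lie trivial trivial, ⁅x, b⁆, ?_⟩
          rw [lie_add, hck]; rfl
        | zero => exact ⟨0, zero_mem _, 0, by simp⟩
        | add a b _ _ ha hb =>
          obtain ⟨w, hw, y, rfl⟩ := ha
          obtain ⟨w', hw', y', rfl⟩ := hb
          exact ⟨w + w', add_mem hw hw', y + y', by simp; abel⟩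
        | smul t a _ ha =>
          obtain ⟨w, hw, y, rfl⟩ := ha
          exact ⟨t • w, (⁅(⊤ : LieIdeal K L), (⊤ : LieSubmodule K L M₀)⁆).smul_mem t hw, t • y,
            by simp⟩
      obtain ⟨w, hw, b, rfl⟩ := this
      have hb : (c ^ k) b = 0 := by
        have h1 : (c ^ k) b ∈ LinearMap.ker (c ^ k) ⊓ LinearMap.range (c ^ k) := by
          refine ⟨?_, b, rfl⟩
          rw [map_add, (hmem _).1 w.2, zero_add] at hmk
          exact hmk
        rwa [hk1.inf_eq_bot] at h1
      rw [hb, add_zero] at hm0 ⊢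
      have := ih2 w (fun x => Subtype.ext (hm0 x)) hw
      rw [this]; rfl

/-! ### Decompositions of stable subspaces of a representation -/

section Reps

variable {K L V : Type*} [Field K] [LieRing L] [LieAlgebra K L] [AddCommGroup V] [Module K V]

/-- The Lie ring module structure of a subspace stable under a representation. -/
abbrev LieHom.restrictLieRingModule (ρ : L →ₗ⁅K⁆ Module.End K V) (W : Submodule K V)
    (hW : ∀ x, ∀ w ∈ W, ρ x w ∈ W) : LieRingModule L W where
  bracket x w := ⟨ρ x w, hW x w w.2⟩
  add_lie x y w := by ext; simp
  lie_add x w w' := by ext; simp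
  leibniz_lie x y w := by ext; simp [Ring.lie_def]

theorem LieHom.restrictLieModule (ρ : L →ₗ⁅K⁆ Module.End K V) (W : Submodule K V)
    (hW : ∀ x, ∀ w ∈ W, ρ x w ∈ W) :
    letI := ρ.restrictLieRingModule W hW
    LieModule K L W :=
  let := ρ.restrictLieRingModule W hW
  { smul_lie := fun c x w => by ext; change ρ (c • x) w = c • ρ x w; simp
    lie_smul := fun c x w => by ext; change ρ x (c • (w : V)) = c • ρ x w; simp }

/-- The span of all `ρ x w` with `w ∈ W`. -/
def LieHom.actSpan (ρ : L →ₗ⁅K⁆ Module.End K V) (W : Submodule K V) : Submodule K V :=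
  Submodule.span K {v | ∃ x, ∃ w ∈ W, ρ x w = v}

theorem LieHom.act_mem_actSpan (ρ : L →ₗ⁅K⁆ Module.End K V) {W : Submodule K V} (x : L) {w : V}
    (hw : w ∈ W) : ρ x w ∈ ρ.actSpan W :=
  Submodule.subset_span ⟨x, w, hw, rfl⟩

theorem LieHom.actSpan_le (ρ : L →ₗ⁅K⁆ Module.End K V) {W U : Submodule K V}
    (h : ∀ x, ∀ w ∈ W, ρ x w ∈ U) : ρ.actSpan W ≤ U := by
  refine Submodule.span_le.2 ?_
  rintro _ ⟨x, w, hw, rfl⟩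
  exact h x w hw

theorem LieHom.actSpan_mono (ρ : L →ₗ⁅K⁆ Module.End K V) {W U : Submodule K V} (h : W ≤ U) :
    ρ.actSpan W ≤ ρ.actSpan U :=
  ρ.actSpan_le fun x _ hw => ρ.act_mem_actSpan x (h hw)

theorem LieHom.coe_mem_actSpan (ρ : L →ₗ⁅K⁆ Module.End K V) (W : Submodule K V)
    (hW : ∀ x, ∀ w ∈ W, ρ x w ∈ W) (w : W) :
    letI := ρ.restrictLieRingModule W hW
    letI := ρ.restrictLieModule W hW
    w ∈ ⁅(⊤ : LieIdeal K L), (⊤ : LieSubmodule K L W)⁆ ↔ (w : V) ∈ ρ.actSpan W := by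
  let := ρ.restrictLieRingModule W hW
  let := ρ.restrictLieModule W hW
  rw [← LieSubmodule.mem_toSubmodule, LieSubmodule.lieIdeal_oper_eq_linear_span']
  have : ρ.actSpan W = (Submodule.span K {m : W | ∃ x ∈ (⊤ : LieIdeal K L),
      ∃ n ∈ (⊤ : LieSubmodule K L W), ⁅x, n⁆ = m}).map W.subtype := by
    rw [Submodule.map_span]
    apply le_antisymm
    · refine ρ.actSpan_le fun x w hw => Submodule.subset_span ?_
      exact ⟨⟨ρ x w, hW x w hw⟩, ⟨x, trivial, ⟨w, hw⟩, trivial, rfl⟩, rfl⟩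
    · refine Submodule.span_le.2 ?_
      rintro _ ⟨_, ⟨x, -, n, -, rfl⟩, rfl⟩
      exact ρ.act_mem_actSpan x n.2
  rw [this]
  constructor
  · intro h; exact ⟨w, h, rfl⟩
  · rintro ⟨w', h, e⟩
    rwa [← Subtype.ext e]

/-- A stable subspace of a representation of a semisimple Lie algebra is the sum of its invariants
and of the image of the action. -/
theorem LieHom.exists_invariant_add_actSpan [CharZero K] [Module.Finite K L]
    [LieAlgebra.IsKilling K L] [Module.Finite K V] (ρ : L →ₗ⁅K⁆ Module.End K V) (W : Submodule K V)
    (hW : ∀ x, ∀ w ∈ W, ρ x w ∈ W) {w : V} (hw : w ∈ W) :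
    ∃ w₀ ∈ W, ∃ w₁ ∈ ρ.actSpan W, w = w₀ + w₁ ∧ ∀ x, ρ x w₀ = 0 := by
  let := ρ.restrictLieRingModule W hW
  let := ρ.restrictLieModule W hW
  obtain ⟨w₀, w₁, e, h0, h1⟩ := (isCompl_maxTriv_lie_top K L _ W rfl).1 ⟨w, hw⟩
  exact ⟨w₀, w₀.2, w₁, (ρ.coe_mem_actSpan W hW w₁).1 h1, congrArg Subtype.val e,
    fun x => congrArg Subtype.val (h0 x)⟩

/-- In a representation of a semisimple Lie algebra, no nonzero invariant lies in the image of the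
action. -/
theorem LieHom.eq_zero_of_invariant_of_mem_actSpan [CharZero K] [Module.Finite K L]
    [LieAlgebra.IsKilling K L] [Module.Finite K V] (ρ : L →ₗ⁅K⁆ Module.End K V) {w : V}
    (h0 : ∀ x, ρ x w = 0) (h1 : w ∈ ρ.actSpan ⊤) : w = 0 := by
  have hW : ∀ x, ∀ w ∈ (⊤ : Submodule K V), ρ x w ∈ (⊤ : Submodule K V) := fun _ _ _ => trivial
  let := ρ.restrictLieRingModule ⊤ hW
  let := ρ.restrictLieModule ⊤ hW
  have := (isCompl_maxTriv_lie_top K L _ (⊤ : Submodule K V) rfl).2 ⟨w, trivial⟩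
    (fun x => Subtype.ext (h0 x)) ((ρ.coe_mem_actSpan ⊤ hW _).2 h1)
  exact congrArg Subtype.val this

/-- The vectors killed by all `j`-fold products of operators of a representation. -/
def LieHom.nilSeries (ρ : L →ₗ⁅K⁆ Module.End K V) : ℕ → Submodule K V
  | 0 => ⊥
  | j + 1 => ⨅ x, (LieHom.nilSeries ρ j).comap (ρ x)

theorem LieHom.mem_nilSeries_succ (ρ : L →ₗ⁅K⁆ Module.End K V) {j : ℕ} {v : V} :
    v ∈ ρ.nilSeries (j + 1) ↔ ∀ x, ρ x v ∈ ρ.nilSeries j := by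
  simp [LieHom.nilSeries]

theorem LieHom.nilSeries_mono (ρ : L →ₗ⁅K⁆ Module.End K V) : Monotone ρ.nilSeries := by
  refine monotone_nat_of_le_succ fun j => ?_
  induction j with
  | zero => exact bot_le
  | succ j ih =>
    intro v hv
    exact ρ.mem_nilSeries_succ.2 fun x => ih (ρ.mem_nilSeries_succ.1 hv x)

/-- A subspace of the null component which is contained in its own image under the action is
zero. -/
theorem LieHom.eq_bot_of_le_actSpan (ρ : L →ₗ⁅K⁆ Module.End K V) {W : Submodule K V} {j : ℕ}
    (hj : W ≤ ρ.nilSeries j) (h : W ≤ ρ.actSpan W) : W = ⊥ := by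
  induction j with
  | zero => exact le_bot_iff.1 hj
  | succ j ih => exact ih (h.trans (ρ.actSpan_le fun x w hw => ρ.mem_nilSeries_succ.1 (hj hw) x))

/-- Fitting decomposition of a stable subspace of a representation of a nilpotent Lie algebra. -/
theorem LieHom.exists_nilSeries_add_actSpan [LieRing.IsNilpotent L] [Module.Finite K V]
    (ρ : L →ₗ⁅K⁆ Module.End K V) (W : Submodule K V)
    (hW : ∀ x, ∀ w ∈ W, ρ x w ∈ W) {w : V} (hw : w ∈ W) :
    ∃ w₀ ∈ W, ∃ w₁ ∈ ρ.actSpan W, w = w₀ + w₁ ∧ ∃ j, w₀ ∈ ρ.nilSeries j := by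
  let := ρ.restrictLieRingModule W hW
  let := ρ.restrictLieModule W hW
  have hc := LieModule.isCompl_genWeightSpace_zero_posFittingComp K L W
  obtain ⟨w₀, h0, w₁, h1, e⟩ := (LieSubmodule.mem_sup _ _ _).1
    (show (⟨w, hw⟩ : W) ∈ LieModule.genWeightSpace W (0 : L → K) ⊔ LieModule.posFittingComp K L W by
      rw [hc.sup_eq_top]; trivial)
  refine ⟨w₀, w₀.2, w₁, ?_, (congrArg Subtype.val e).symm, ?_⟩
  · rw [← ρ.coe_mem_actSpan W hW]
    have := LieModule.posFittingComp_le_iInf_lowerCentralSeries K L W h1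
    have h2 := (iInf_le (LieModule.lowerCentralSeries K L W) 1) this
    exact h2
  · obtain ⟨j, hj⟩ := (LieSubmodule.isNilpotent_iff_exists_self_le_ucs
      (LieModule.genWeightSpace W (0 : L → K))).1 inferInstance
    have : ∀ j : ℕ, ∀ u : W, u ∈ (⊥ : LieSubmodule K L W).ucs j → (u : V) ∈ ρ.nilSeries j := by
      intro j
      induction j with
      | zero => intro u hu; simpa [LieHom.nilSeries] using hu
      | succ j ih =>
        intro u hu
        rw [LieSubmodule.ucs_succ, LieSubmodule.mem_normalizer] at hu
        exact ρ.mem_nilSeries_succ.2 fun x => ih _ (hu x)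
    exact ⟨j, this j _ (hj h0)⟩

/-- If a nilpotent Lie algebra maps a stable subspace `W` onto itself, then `W` has no invariants
except zero. -/
theorem LieHom.eq_zero_of_invariant_of_le_actSpan [LieRing.IsNilpotent L] [Module.Finite K V]
    (ρ : L →ₗ⁅K⁆ Module.End K V) {W : Submodule K V}
    (hW : ∀ x, ∀ w ∈ W, ρ x w ∈ W) (h : W ≤ ρ.actSpan W) {w : V} (hw : w ∈ W)
    (h0 : ∀ x, ρ x w = 0) : w = 0 := by
  let := ρ.restrictLieRingModule W hW
  let := ρ.restrictLieModule W hW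
  have htop : ⁅(⊤ : LieIdeal K L), (⊤ : LieSubmodule K L W)⁆ = ⊤ := by
    rw [eq_top_iff]
    intro u _
    exact (ρ.coe_mem_actSpan W hW u).2 (h u.2)
  have hlcs : ∀ j, LieModule.lowerCentralSeries K L W j = ⊤ := by
    intro j
    induction j with
    | zero => simp
    | succ j ih => rw [LieModule.lowerCentralSeries_succ, ih, htop]
  have hpos : LieModule.posFittingComp K L W = ⊤ := by
    rw [← LieModule.iInf_lowerCentralSeries_eq_posFittingComp]
    simp [hlcs]
  have hc := LieModule.isCompl_genWeightSpace_zero_posFittingComp K L W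
  rw [hpos] at hc
  have h1 : (⟨w, hw⟩ : W) ∈ LieModule.genWeightSpace W (0 : L → K) := by
    refine LieModule.iSup_ucs_le_genWeightSpace_zero K L W ?_
    refine (le_iSup (fun j => (⊥ : LieSubmodule K L W).ucs j) 1) ?_
    show _ ∈ (⊥ : LieSubmodule K L W).ucs 1
    rw [LieSubmodule.ucs_succ, LieSubmodule.mem_normalizer]
    intro x
    have : ⁅x, (⟨w, hw⟩ : W)⁆ = 0 := Subtype.ext (h0 x)
    rw [this]; exact zero_mem _
  have h2 : LieModule.genWeightSpace W (0 : L → K) = ⊥ := by simpa using hc.inf_eq_bot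
  rw [h2, LieSubmodule.mem_bot] at h1
  exact congrArg Subtype.val h1

end Reps

/-- Let a semisimple Lie algebra `s` and a nilpotent Lie algebra `k` act on `V` by commuting
representations. If `W` is a stable subspace with `W = s W + k W`, then no nonzero vector of `W` is
invariant under both. -/
theorem eq_zero_of_invariant_of_le_sup_actSpan {K s k V : Type*} [Field K] [CharZero K]
    [LieRing s] [LieAlgebra K s] [Module.Finite K s] [LieAlgebra.IsKilling K s]
    [LieRing k] [LieAlgebra K k] [LieRing.IsNilpotent k]
    [AddCommGroup V] [Module K V] [Module.Finite K V]
    (σ : s →ₗ⁅K⁆ Module.End K V) (κ : k →ₗ⁅K⁆ Module.End K V)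
    (hcomm : ∀ x y v, σ x (κ y v) = κ y (σ x v)) {W : Submodule K V}
    (hσ : ∀ x, ∀ w ∈ W, σ x w ∈ W) (hκ : ∀ y, ∀ w ∈ W, κ y w ∈ W)
    (h : W ≤ σ.actSpan W ⊔ κ.actSpan W) {w : V} (hw : w ∈ W)
    (h0 : ∀ x, σ x w = 0) (h1 : ∀ y, κ y w = 0) : w = 0 := by
  -- by complete reducibility, the space `U` of all `s`-invariants in `W` satisfies `U ≤ k U`
  let U : Submodule K V := W ⊓ ⨅ x, LinearMap.ker (σ x)
  have hU : ∀ v, v ∈ U ↔ v ∈ W ∧ ∀ x, σ x v = 0 := by intro v; simp [U]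
  have hUκ : ∀ y, ∀ v ∈ U, κ y v ∈ U := by
    intro y v hv
    rw [hU] at hv ⊢
    exact ⟨hκ y v hv.1, fun x => by rw [hcomm, hv.2, map_zero]⟩
  have hκσ : ∀ y, ∀ v ∈ σ.actSpan W, κ y v ∈ σ.actSpan W := by
    intro y v hv
    induction hv using Submodule.span_induction with
    | mem v hv =>
      obtain ⟨x, u, hu, rfl⟩ := hv
      rw [← hcomm]
      exact σ.act_mem_actSpan x (hκ y u hu)
    | zero => simp
    | add a b _ _ ha hb => rw [map_add]; exact add_mem ha hb
    | smul c a _ ha => rw [map_smul]; exact Submodule.smul_mem _ c ha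
  refine κ.eq_zero_of_invariant_of_le_actSpan hUκ (w := w) ?_ ((hU w).2 ⟨hw, h0⟩) h1
  intro v hv
  obtain ⟨hvW, hv0⟩ := (hU v).1 hv
  have hle : κ.actSpan W ≤ κ.actSpan U ⊔ σ.actSpan W := by
    refine κ.actSpan_le fun y u hu => ?_
    obtain ⟨u₀, hu₀, u₁, hu₁, rfl, hinv⟩ := σ.exists_invariant_add_actSpan W hσ hu
    rw [map_add]
    exact Submodule.add_mem_sup (κ.act_mem_actSpan y ((hU _).2 ⟨hu₀, hinv⟩)) (hκσ y _ hu₁)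
  have h2 : v ∈ κ.actSpan U ⊔ σ.actSpan W := by
    have := h hvW
    exact (sup_le le_sup_right hle) this
  obtain ⟨a, ha, b, hb, rfl⟩ := Submodule.mem_sup.1 h2
  have haU : a ∈ U := κ.actSpan_le hUκ ha
  have hb0 : b = 0 := by
    refine σ.eq_zero_of_invariant_of_mem_actSpan (fun x => ?_) (σ.actSpan_mono le_top hb)
    have := hv0 x
    rwa [map_add, ((hU a).1 haU).2 x, zero_add] at this
  rw [hb0, add_zero]
  exact ha

/-! ### Completely reducible Lie algebras of endomorphisms -/

/-- Engel's theorem: a Lie algebra of nilpotent endomorphisms maps no nonzero subspace onto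
itself. -/
theorem LieHom.eq_bot_of_le_actSpan_of_isNilpotent {K L V : Type*} [Field K] [LieRing L]
    [LieAlgebra K L] [AddCommGroup V] [Module K V] [Module.Finite K V]
    (ρ : L →ₗ⁅K⁆ Module.End K V) (hρ : ∀ x, IsNilpotent (ρ x)) {U : Submodule K V}
    (hU : U ≤ ρ.actSpan U) : U = ⊥ := by
  let : LieRingModule L V :=
    { bracket := fun x w => ρ x w
      add_lie := fun x y w => by simp
      lie_add := fun x w w' => map_add _ _ _
      leibniz_lie := fun x y w => by
        change ρ x (ρ y w) = ρ ⁅x, y⁆ w + ρ y (ρ x w); simp [Ring.lie_def] }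
  have : LieModule K L V :=
    { smul_lie := fun c x w => by change ρ (c • x) w = c • ρ x w; simp
      lie_smul := fun c x w => map_smul _ _ _ }
  have hnil : LieModule.IsNilpotent L V := (LieModule.isNilpotent_iff_forall' (R := K)).2 hρ
  obtain ⟨j, hj⟩ := LieModule.IsNilpotent.nilpotent K L V
  have : ∀ i, ∀ u ∈ U, u ∈ LieModule.lowerCentralSeries K L V i := by
    intro i
    induction i with
    | zero => intro u _; simp
    | succ i ih =>
      intro u hu
      rw [LieModule.lowerCentralSeries_succ]
      refine ρ.actSpan_le (U := (⁅(⊤ : LieIdeal K L),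
        LieModule.lowerCentralSeries K L V i⁆ : LieSubmodule K L V).toSubmodule) ?_ (hU hu)
      intro x w hw
      exact LieSubmodule.lie_mem_lie (I := (⊤ : LieIdeal K L)) (x := x) trivial (ih w hw)
  rw [eq_bot_iff]
  intro u hu
  have := this j u hu
  rwa [hj] at this

/-- In characteristic zero, an endomorphism is nilpotent if the traces of its powers vanish. -/
theorem isNilpotent_of_trace_pow_eq_zero {K V : Type*} [Field K] [CharZero K] [AddCommGroup V]
    [Module K V] [Module.Finite K V] (x : Module.End K V)
    (h : ∀ n : ℕ, LinearMap.trace K V (x ^ (n + 1)) = 0) : IsNilpotent x := by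
  -- The idempotent `e` with kernel the null component of `x` is a polynomial in `x` without
  -- constant term.
  obtain ⟨a, q, hq, hm⟩ : ∃ (a : ℕ) (q : Polynomial K), q.eval 0 ≠ 0 ∧
      minpoly K x = Polynomial.X ^ a * q := by
    have h0 : minpoly K x ≠ 0 := minpoly.ne_zero (Algebra.IsIntegral.isIntegral x)
    obtain ⟨q, hq, hnd⟩ := Polynomial.exists_eq_pow_rootMultiplicity_mul_and_not_dvd
      (minpoly K x) h0 0
    refine ⟨_, q, fun h1 => hnd ?_, by simpa using hq⟩
    exact Polynomial.dvd_iff_isRoot.2 h1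
  have hcop : IsCoprime (Polynomial.X ^ (a + 1)) q := by
    refine IsCoprime.pow_left ?_
    refine (Polynomial.irreducible_X.coprime_iff_not_dvd).2 fun hd => hq ?_
    simpa using Polynomial.X_dvd_iff.1 hd ▸ (Polynomial.coeff_zero_eq_eval_zero q).symm
  obtain ⟨r, w, hrw⟩ := hcop
  have hx0 : x ^ a * Polynomial.aeval x q = 0 := by
    have := minpoly.aeval K x
    rw [hm] at this
    simpa using this
  let e := Polynomial.aeval x (r * Polynomial.X ^ (a + 1))
  let f := Polynomial.aeval x (w * q)
  have hef : e + f = 1 := by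
    simp only [e, f, ← map_add, hrw, map_one]
  have hxf : x ^ a * f = 0 := by
    have : x ^ a * f = Polynomial.aeval x w * (x ^ a * Polynomial.aeval x q) := by
      have h1 : Polynomial.X ^ a * (w * q) = w * (Polynomial.X ^ a * q) := by ring
      simpa [f] using congrArg (Polynomial.aeval x) h1
    rw [this, hx0, mul_zero]
  have hef0 : e * f = 0 := by
    have h1 : r * Polynomial.X ^ (a + 1) = r * Polynomial.X * Polynomial.X ^ a := by ring
    simp only [e]
    rw [h1, map_mul, map_pow, Polynomial.aeval_X, mul_assoc, hxf, mul_zero]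
  have hidem : IsIdempotentElem e := by
    have : e * (e + f) = e := by rw [hef, mul_one]
    rwa [mul_add, hef0, add_zero] at this
  have htr : LinearMap.trace K V e = 0 := by
    have : ∀ r : Polynomial K,
        LinearMap.trace K V (Polynomial.aeval x (r * Polynomial.X ^ (a + 1))) = 0 := by
      intro r
      induction r using Polynomial.induction_on' with
      | add p q hp hq => rw [add_mul, map_add, map_add, hp, hq, add_zero]
      | monomial n c =>
        rw [map_mul, map_pow, Polynomial.aeval_X, Polynomial.aeval_monomial, mul_assoc, ← pow_add,
          ← Algebra.smul_def, map_smul, ← add_assoc, h, smul_zero]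
    exact this r
  have he : e = 0 := (LinearMap.IsIdempotentElem.trace_eq_zero_iff hidem).1 htr
  rw [he, zero_add] at hef
  exact ⟨a, by rwa [hef, mul_one] at hxf⟩

/-- In characteristic zero, an endomorphism is nilpotent if it is a sum of commutators `[a, b]` in
which `b` commutes with it. -/
theorem isNilpotent_of_mem_span_commutators {K V : Type*} [Field K] [CharZero K] [AddCommGroup V]
    [Module K V] [Module.Finite K V] (x : Module.End K V)
    (h : x ∈ Submodule.span K {y | ∃ a b : Module.End K V, Commute b x ∧ a * b - b * a = y}) :
    IsNilpotent x := by
  refine isNilpotent_of_trace_pow_eq_zero x fun n => ?_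
  have key : ∀ y ∈ Submodule.span K {y | ∃ a b : Module.End K V, Commute b x ∧ a * b - b * a = y},
      LinearMap.trace K V (y * x ^ n) = 0 := by
    intro y hy
    induction hy using Submodule.span_induction with
    | mem y hy =>
      obtain ⟨a, b, hb, rfl⟩ := hy
      rw [sub_mul, map_sub, mul_assoc, mul_assoc, LinearMap.trace_mul_comm K b, mul_assoc,
        (hb.pow_right n).eq, sub_self]
    | zero => simp
    | add y z _ _ hy hz => rw [add_mul, map_add, hy, hz, add_zero]
    | smul c y _ hy => rw [smul_mul_assoc, map_smul, hy, smul_zero]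
  rw [pow_succ']
  exact key x h

section CompletelyReducible

variable {K : Type u} [Field K] {V : Type v} [AddCommGroup V] [Module K V]
    {Γ : LieSubalgebra K (Module.End K V)}

/-- Let `P` be a space of endomorphisms normalized by a completely reducible `Γ` and preserving
all `Γ`-stable subspaces. If `P` maps no nonzero subspace onto itself, then `P = 0`. -/
theorem IsCompletelyReducible.eq_zero_of_mem (hΓ : IsCompletelyReducible Γ)
    (P : Submodule K (Module.End K V))
    (hP : ∀ γ ∈ Γ, ∀ p ∈ P, γ * p - p * γ ∈ P)
    (hstab : ∀ W : Submodule K V, (∀ γ ∈ Γ, ∀ w ∈ W, γ w ∈ W) → ∀ p ∈ P, ∀ w ∈ W, p w ∈ W)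
    (hnil : ∀ U : Submodule K V, U ≤ Submodule.span K {v | ∃ p ∈ P, ∃ u ∈ U, p u = v} → U = ⊥)
    {p : Module.End K V} (hp : p ∈ P) : p = 0 := by
  let U : Submodule K V := Submodule.span K {v | ∃ p ∈ P, ∃ u : V, p u = v}
  have hmem : ∀ p ∈ P, ∀ v, p v ∈ U := fun p hp v => Submodule.subset_span ⟨p, hp, v, rfl⟩
  obtain ⟨W, hW, hc⟩ := hΓ U (by
    intro γ hγ u hu
    induction hu using Submodule.span_induction with
    | mem u hu =>
      obtain ⟨p, hp, v, rfl⟩ := hu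
      have e : γ (p v) = p (γ v) + (γ * p - p * γ) v := by simp
      rw [e]
      exact add_mem (hmem p hp _) (hmem _ (hP γ hγ p hp) _)
    | zero => simp
    | add a b _ _ ha hb => rw [map_add]; exact add_mem ha hb
    | smul c a _ ha => rw [map_smul]; exact Submodule.smul_mem _ c ha)
  have hU : U = ⊥ := by
    refine hnil U (Submodule.span_le.2 ?_)
    rintro _ ⟨p, hp, v, rfl⟩
    obtain ⟨a, ha, b, hb, rfl⟩ := Submodule.mem_sup.1
      (show v ∈ U ⊔ W by rw [hc.sup_eq_top]; trivial)
    have hpb : p b = 0 := by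
      have : p b ∈ U ⊓ W := ⟨hmem p hp b, hstab W hW p hp b hb⟩
      rwa [hc.inf_eq_bot] at this
    rw [map_add, hpb, add_zero]
    exact Submodule.subset_span ⟨p, hp, a, ha, rfl⟩
  ext v
  have := hmem p hp v
  rwa [hU] at this

variable [Module.Finite K V]

/-- A completely reducible Lie algebra has no nonzero ideals of nilpotent endomorphisms. -/
theorem IsCompletelyReducible.eq_bot_of_isNilpotent (hΓ : IsCompletelyReducible Γ)
    (P : LieIdeal K Γ) (hP : ∀ p ∈ P, IsNilpotent (p : Module.End K V)) : P = ⊥ := by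
  rw [LieSubmodule.eq_bot_iff]
  intro p hp
  refine Subtype.ext (hΓ.eq_zero_of_mem (P.toSubmodule.map Γ.toSubmodule.subtype) ?_ ?_ ?_
    ⟨p, hp, rfl⟩)
  · rintro γ hγ _ ⟨p, hp, rfl⟩
    exact ⟨⁅(⟨γ, hγ⟩ : Γ), p⁆, lie_mem_right K Γ P _ _ hp, rfl⟩
  · rintro W hW _ ⟨p, hp, rfl⟩ w hw
    exact hW _ p.2 w hw
  · intro U hU
    refine (Γ.incl.comp P.incl).eq_bot_of_le_actSpan_of_isNilpotent
      (fun x => hP x x.2) (hU.trans (Submodule.span_le.2 ?_))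
    rintro _ ⟨_, ⟨p, hp, rfl⟩, u, hu, rfl⟩
    exact (Γ.incl.comp P.incl).act_mem_actSpan ⟨p, hp⟩ hu

variable [CharZero K]

/-- An ideal `⁅I, J⁆` of a completely reducible Lie algebra vanishes if it commutes with `J`. -/
theorem IsCompletelyReducible.lie_eq_bot_of_commute (hΓ : IsCompletelyReducible Γ)
    (I J : LieIdeal K Γ) (h : ∀ x ∈ ⁅I, J⁆, ∀ y ∈ J, ⁅y, x⁆ = 0) : ⁅I, J⁆ = ⊥ := by
  refine hΓ.eq_bot_of_isNilpotent _ fun x hx => ?_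
  refine isNilpotent_of_mem_span_commutators _ ?_
  have hx' := hx
  rw [← LieSubmodule.mem_toSubmodule, LieSubmodule.lieIdeal_oper_eq_linear_span'] at hx'
  have := Submodule.mem_map_of_mem (f := Γ.toSubmodule.subtype) hx'
  rw [Submodule.map_span] at this
  refine Submodule.span_mono ?_ this
  rintro _ ⟨_, ⟨a, -, b, hb, rfl⟩, rfl⟩
  refine ⟨a, b, ?_, rfl⟩
  have := congrArg Subtype.val (h x hx b hb)
  exact sub_eq_zero.1 this

/-- The solvable ideals of a completely reducible Lie algebra are central. -/
theorem IsCompletelyReducible.top_lie_eq_bot_of_isSolvable (hΓ : IsCompletelyReducible Γ)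
    (I : LieIdeal K Γ) [hI : LieAlgebra.IsSolvable I] : ⁅(⊤ : LieIdeal K Γ), I⁆ = ⊥ := by
  have key : ∀ j : ℕ, ∀ I : LieIdeal K Γ, LieAlgebra.derivedSeriesOfIdeal K Γ j I = ⊥ →
      ⁅(⊤ : LieIdeal K Γ), I⁆ = ⊥ := by
    intro j
    induction j with
    | zero =>
      intro I hI
      rw [LieAlgebra.derivedSeriesOfIdeal_zero] at hI
      rw [hI, LieSubmodule.lie_bot]
    | succ j ih =>
      intro I hI
      rw [LieAlgebra.derivedSeriesOfIdeal_add, LieAlgebra.derivedSeriesOfIdeal_succ,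
        LieAlgebra.derivedSeriesOfIdeal_zero] at hI
      have h1 := ih _ hI
      have h2 : ⁅I, I⁆ = ⊥ := by
        refine hΓ.lie_eq_bot_of_commute I I fun x hx y hy => ?_
        have := LieSubmodule.lie_mem_lie (show y ∈ (⊤ : LieIdeal K Γ) from trivial) hx
        rwa [h1, LieSubmodule.mem_bot] at this
      refine hΓ.lie_eq_bot_of_commute ⊤ I fun x hx y hy => ?_
      have hxI : x ∈ I := LieSubmodule.lie_le_right _ _ hx
      have := LieSubmodule.lie_mem_lie hy hxI
      rwa [h2, LieSubmodule.mem_bot] at this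
  obtain ⟨j, hj⟩ := hI.solvable K
  exact key j I ((LieIdeal.derivedSeries_eq_bot_iff I j).1 hj)

/-- The central elements of a completely reducible Lie algebra are semisimple. -/
theorem IsCompletelyReducible.isSemisimple_of_commute (hΓ : IsCompletelyReducible Γ)
    {t : Module.End K V} (ht : t ∈ Γ) (hcomm : ∀ γ ∈ Γ, Commute γ t) : t.IsSemisimple := by
  obtain ⟨n, hn, s, -, hnil, hs, e⟩ := t.exists_isNilpotent_isSemisimple
  have hn0 : n = 0 := by
    refine hΓ.eq_zero_of_mem (K ∙ n) ?_ ?_ ?_ (Submodule.mem_span_singleton_self n)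
    · intro γ hγ p hp
      obtain ⟨c, rfl⟩ := Submodule.mem_span_singleton.1 hp
      have : Commute γ n := Algebra.commute_of_mem_adjoin_singleton_of_commute hn (hcomm γ hγ)
      rw [((this.smul_right c).eq), sub_self]
      exact zero_mem _
    · intro W hW p hp w hw
      obtain ⟨c, rfl⟩ := Submodule.mem_span_singleton.1 hp
      refine W.smul_mem c ?_
      clear hnil e hp
      induction hn using Algebra.adjoin_induction generalizing w with
      | mem x hx => rw [Set.mem_singleton_iff.1 hx]; exact hW t ht w hw
      | algebraMap r => exact W.smul_mem r hw
      | add x y _ _ hx hy => exact add_mem (hx w hw) (hy w hw)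
      | mul x y _ _ hx hy => exact hx _ (hy w hw)
    · intro U hU
      obtain ⟨j, hj⟩ := hnil
      have : ∀ i, ∀ u ∈ U, u ∈ LinearMap.range (n ^ i) := by
        intro i
        induction i with
        | zero => intro u _; exact ⟨u, rfl⟩
        | succ i ih =>
          intro u hu
          refine (Submodule.span_le (p := LinearMap.range (n ^ (i + 1)))).2 ?_ (hU hu)
          rintro _ ⟨p, hp, w, hw, rfl⟩
          obtain ⟨c, rfl⟩ := Submodule.mem_span_singleton.1 hp
          obtain ⟨y, rfl⟩ := ih w hw
          exact ⟨c • y, by rw [pow_succ']; simp⟩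
      rw [eq_bot_iff]
      intro u hu
      obtain ⟨y, rfl⟩ := this j u hu
      rw [hj]; simp
  rw [e, hn0, zero_add]
  exact hs

end CompletelyReducible

/-- If the double commutator of a semisimple `t` with `Y` vanishes, then `t` commutes with `Y`. -/
theorem Module.End.IsSemisimple.commute_of_lie_lie_eq_zero {K V : Type*} [Field K] [CharZero K]
    [AddCommGroup V] [Module K V] [Module.Finite K V] {t Y : Module.End K V}
    (ht : t.IsSemisimple) (h : ⁅t, ⁅t, Y⁆⁆ = 0) : ⁅t, Y⁆ = 0 := by
  have h1 := LieAlgebra.ad_isSemisimple_of_isSemisimple ht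
  have h2 := h1.isFinitelySemisimple.genEigenspace_eq_eigenspace 0 (k := 2) (by norm_num)
  have h3 : Y ∈ (LieAlgebra.ad K (Module.End K V) t).genEigenspace 0 2 := by
    rw [show (2 : ℕ∞) = ((2 : ℕ) : ℕ∞) from rfl, Module.End.mem_genEigenspace_nat]
    simp [pow_two, h]
  rw [h2] at h3
  simpa using h3

/-! ### Algebraicity of derivation algebras and of transporters -/

section Algebraic

variable {K : Type u} [Field K] {V : Type v} [AddCommGroup V] [Module K V]

/-- A Lie subalgebra is algebraic if it is cut out by the linearization of a family `F` of functions
of a matrix and its inverse, which is natural in the coefficient ring and whose common zeros are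
closed under multiplication. The equations of the group are imposed on a matrix and on its inverse,
so that closedness under inversion is automatic. -/
theorem isAlgebraicLie_of_natural [FiniteDimensional K V]
    (h : LieSubalgebra K (Module.End K V)) {ι : Type*}
    (F : ι → ∀ (A : Type u) [CommRing A] [Algebra K A],
      Matrix (Fin (Module.finrank K V)) (Fin (Module.finrank K V)) A →
      Matrix (Fin (Module.finrank K V)) (Fin (Module.finrank K V)) A → A)
    (hnat : ∀ (i : ι) (A B : Type u) [CommRing A] [CommRing B] [Algebra K A] [Algebra K B]
      (φ : A →ₐ[K] B) (a b : Matrix (Fin (Module.finrank K V)) (Fin (Module.finrank K V)) A),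
      F i B (a.map φ) (b.map φ) = φ (F i A a b))
    (hone : ∀ (i : ι) (A : Type u) [CommRing A] [Algebra K A], F i A 1 1 = 0)
    (hmul : ∀ (A : Type u) [CommRing A] [Algebra K A]
      (a b a' b' : Matrix (Fin (Module.finrank K V)) (Fin (Module.finrank K V)) A),
      b * a = 1 → b' * a' = 1 → (∀ i, F i A a b = 0) → (∀ i, F i A a' b' = 0) →
      ∀ i, F i A (a * a') (b' * b) = 0)
    (htan : ∀ f : Module.End K V, f ∈ h ↔ ∀ i, F i (DualNumber K)
      (1 + (LinearMap.toMatrix (Module.finBasis K V) (Module.finBasis K V) f).map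
        (TrivSqZeroExt.inr : K → DualNumber K))
      (1 - (LinearMap.toMatrix (Module.finBasis K V) (Module.finBasis K V) f).map
        (TrivSqZeroExt.inr : K → DualNumber K)) = 0) :
    IsAlgebraicLie h := by
  let d := Module.finrank K V
  let R := MvPolynomial ((Fin d × Fin d) ⊕ (Fin d × Fin d)) K
  let G : Matrix (Fin d) (Fin d) R := Matrix.of fun i j => MvPolynomial.X (Sum.inl (i, j))
  let H : Matrix (Fin d) (Fin d) R := Matrix.of fun i j => MvPolynomial.X (Sum.inr (i, j))
  have hG : ∀ (A : Type u) [CommRing A] [Algebra K A] (a b : Matrix (Fin d) (Fin d) A),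
      G.map (matrixEval (K := K) a b) = a := by
    intro A _ _ a b; ext i j; simp [G, matrixEval]
  have hH : ∀ (A : Type u) [CommRing A] [Algebra K A] (a b : Matrix (Fin d) (Fin d) A),
      H.map (matrixEval (K := K) a b) = b := by
    intro A _ _ a b; ext i j; simp [H, matrixEval]
  have e1 : ∀ (i : ι) (A : Type u) [CommRing A] [Algebra K A] (a b : Matrix (Fin d) (Fin d) A),
      matrixEval a b (F i R G H) = F i A a b := by
    intro i A _ _ a b
    rw [← hnat i R A (matrixEval a b), hG, hH]
  have e2 : ∀ (i : ι) (A : Type u) [CommRing A] [Algebra K A] (a b : Matrix (Fin d) (Fin d) A),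
      matrixEval a b (F i R H G) = F i A b a := by
    intro i A _ _ a b
    rw [← hnat i R A (matrixEval a b), hG, hH]
  let E : Set R := {p | ∃ i, p = F i R G H ∨ p = F i R H G}
  have hE : ∀ (A : Type u) [CommRing A] [Algebra K A] (a b : Matrix (Fin d) (Fin d) A),
      (∀ p ∈ E, matrixEval a b p = 0) ↔ (∀ i, F i A a b = 0) ∧ ∀ i, F i A b a = 0 := by
    intro A _ _ a b
    constructor
    · intro hp
      exact ⟨fun i => by rw [← e1]; exact hp _ ⟨i, Or.inl rfl⟩,
        fun i => by rw [← e2]; exact hp _ ⟨i, Or.inr rfl⟩⟩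
    · rintro ⟨h1, h2⟩ p ⟨i, rfl | rfl⟩
      · rw [e1, h1]
      · rw [e2, h2]
  refine ⟨⟨E, ?_, ?_, ?_⟩, ?_⟩
  · intro A _ _
    refine (hE A _ _).2 ?_
    rw [inv_one, Units.val_one]
    exact ⟨fun i => hone i A, fun i => hone i A⟩
  · intro A _ _ g g' hg hg'
    obtain ⟨h1, h2⟩ := (hE A _ _).1 hg
    obtain ⟨h3, h4⟩ := (hE A _ _).1 hg'
    refine (hE A _ _).2 ?_
    rw [mul_inv_rev, Units.val_mul, Units.val_mul]
    exact ⟨hmul A _ _ _ _ (Units.inv_mul g) (Units.inv_mul g') h1 h3,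
      hmul A _ _ _ _ (Units.mul_inv g') (Units.mul_inv g) h4 h2⟩
  · intro A _ _ g hg
    obtain ⟨h1, h2⟩ := (hE A _ _).1 hg
    refine (hE A _ _).2 ?_
    rw [inv_inv]
    exact ⟨h2, h1⟩
  · intro f
    have hneg := htan (-f)
    rw [map_neg, Matrix.map_neg _ (TrivSqZeroExt.inr_neg K), sub_neg_eq_add,
      ← sub_eq_add_neg] at hneg
    refine ⟨fun hf => (hE _ _ _).2 ⟨(htan f).1 hf, hneg.1 (neg_mem hf)⟩,
      fun hf => (htan f).2 ((hE _ _ _).1 hf).1⟩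

theorem dualNumber_inr_mul_algebraMap (x y : K) :
    (TrivSqZeroExt.inr x : DualNumber K) * algebraMap K (DualNumber K) y
      = TrivSqZeroExt.inr (x * y) := by
  rw [TrivSqZeroExt.algebraMap_eq_inl, TrivSqZeroExt.inr_mul_inl]
  rfl

/-- The linear part of `(1 + ε X) Y (1 - ε X)` is the commutator `X Y - Y X`. -/
theorem dualNumber_conj {d : ℕ} (X Y : Matrix (Fin d) (Fin d) K) :
    (1 + X.map (TrivSqZeroExt.inr : K → DualNumber K)) * Y.map (algebraMap K (DualNumber K)) *
      (1 - X.map (TrivSqZeroExt.inr : K → DualNumber K)) = Y.map (algebraMap K (DualNumber K)) +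
      (X * Y - Y * X).map (TrivSqZeroExt.inr : K → DualNumber K) := by
  have h1 : X.map (TrivSqZeroExt.inr : K → DualNumber K) * Y.map (algebraMap K (DualNumber K))
      = (X * Y).map (TrivSqZeroExt.inr : K → DualNumber K) := by
    refine Matrix.ext fun i j => ?_
    simp only [Matrix.mul_apply, Matrix.map_apply, dualNumber_inr_mul_algebraMap,
      TrivSqZeroExt.inr_sum]
  have h2 : Y.map (algebraMap K (DualNumber K)) * X.map (TrivSqZeroExt.inr : K → DualNumber K)
      = (Y * X).map (TrivSqZeroExt.inr : K → DualNumber K) := by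
    refine Matrix.ext fun i j => ?_
    simp only [Matrix.mul_apply, Matrix.map_apply, TrivSqZeroExt.inr_sum]
    refine Finset.sum_congr rfl fun p _ => ?_
    rw [mul_comm, dualNumber_inr_mul_algebraMap, mul_comm]
  have h3 : ∀ Z : Matrix (Fin d) (Fin d) K, Z.map (TrivSqZeroExt.inr : K → DualNumber K) *
      X.map (TrivSqZeroExt.inr : K → DualNumber K) = 0 := by
    intro Z
    refine Matrix.ext fun i j => ?_
    simp only [Matrix.mul_apply, Matrix.map_apply, TrivSqZeroExt.inr_mul_inr,
      Finset.sum_const_zero, Matrix.zero_apply]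
  rw [Matrix.map_sub _ (TrivSqZeroExt.inr_sub K), add_mul, mul_sub, mul_one, one_mul, add_mul, h1,
    h2, h3, add_zero]
  abel

/-- For `W ≤ U` in `gl(V)`, the `X` with `[X, U] ⊆ W`. -/
def lieTransporter (U W : Submodule K (Module.End K V)) (hWU : W ≤ U) :
    LieSubalgebra K (Module.End K V) where
  carrier := {X | ∀ Y ∈ U, ⁅X, Y⁆ ∈ W}
  add_mem' := by intro X X' h h' Y hY; rw [add_lie]; exact add_mem (h Y hY) (h' Y hY)
  zero_mem' := by intro Y _; rw [zero_lie]; exact zero_mem _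
  smul_mem' := by intro c X h Y hY; rw [smul_lie]; exact W.smul_mem c (h Y hY)
  lie_mem' := by
    intro X X' h h' Y hY
    rw [lie_lie]
    exact sub_mem (h _ (hWU (h' Y hY))) (h' _ (hWU (h Y hY)))

theorem mem_lieTransporter {U W : Submodule K (Module.End K V)} (hWU : W ≤ U)
    {X : Module.End K V} : X ∈ lieTransporter U W hWU ↔ ∀ Y ∈ U, ⁅X, Y⁆ ∈ W := Iff.rfl

/-- The transporter is the Lie algebra of the group of those `a` for which `a Y a⁻¹ - Y ∈ W` for
all `Y ∈ U`. -/
theorem isAlgebraicLie_lieTransporter [FiniteDimensional K V]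
    (U W : Submodule K (Module.End K V)) (hWU : W ≤ U) :
    IsAlgebraicLie (lieTransporter U W hWU) := by
  let d := Module.finrank K V
  let e := LinearMap.toMatrix (Module.finBasis K V) (Module.finBasis K V)
  obtain ⟨C, hC⟩ := Submodule.exists_isCompl (W.map e.toLinearMap)
  -- the projection onto `W`, in matrix form
  let π : Matrix (Fin d) (Fin d) K →ₗ[K] Matrix (Fin d) (Fin d) K :=
    Submodule.subtype _ ∘ₗ Submodule.projectionOnto _ C hC
  have hπ : ∀ Z, π Z ∈ W.map e.toLinearMap := fun Z => Submodule.coe_mem _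
  have hπ' : ∀ w ∈ W, π (e w) = e w := fun w hw =>
    congrArg Subtype.val (Submodule.projectionOnto_apply_left hC ⟨e w, w, hw, rfl⟩)
  let S : ∀ i j, Matrix (Fin d) (Fin d) K := fun i j => Matrix.single i j 1
  have hS : ∀ Z : Matrix (Fin d) (Fin d) K, Z = ∑ i, ∑ j, Z i j • S i j := by
    intro Z
    conv_lhs => rw [Matrix.matrix_eq_sum_single Z]
    simp [S]
  let q : ∀ (A : Type u) [CommRing A] [Algebra K A], Fin d → Fin d → Matrix (Fin d) (Fin d) A → A :=
    fun A _ _ k l Z => ∑ i, ∑ j, Z i j * algebraMap K A ((S i j - π (S i j)) k l)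
  have hqadd : ∀ (A : Type u) [CommRing A] [Algebra K A] (k l) (Z Z' : Matrix (Fin d) (Fin d) A),
      q A k l (Z + Z') = q A k l Z + q A k l Z' := by
    intro A _ _ k l Z Z'
    simp only [q, Matrix.add_apply, add_mul, Finset.sum_add_distrib]
  have hqK : ∀ (A : Type u) [CommRing A] [Algebra K A] (k l) (Z : Matrix (Fin d) (Fin d) K),
      q A k l (Z.map (algebraMap K A)) = algebraMap K A ((Z - π Z) k l) := by
    intro A _ _ k l Z
    have : (Z - π Z) k l = ∑ i, ∑ j, Z i j * ((S i j - π (S i j)) k l) := by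
      conv_lhs => rw [hS Z]
      simp [Matrix.sum_apply, mul_sub, Finset.sum_sub_distrib]
    rw [this]
    simp [q]
  -- a matrix over `A` killed by all `q` is an `A`-combination of elements of `W`
  have hspan : ∀ (A : Type u) [CommRing A] [Algebra K A] (Z : Matrix (Fin d) (Fin d) A),
      (∀ k l, q A k l Z = 0) → Z = ∑ i, ∑ j, Z i j • (π (S i j)).map (algebraMap K A) := by
    intro A _ _ Z hZ
    ext k l
    have h1 := hZ k l
    simp only [q, Matrix.sub_apply, map_sub, mul_sub, Finset.sum_sub_distrib] at h1
    rw [sub_eq_zero] at h1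
    have h2 : Z k l = ∑ i, ∑ j, Z i j * algebraMap K A (S i j k l) := by
      simp [S, Matrix.single_apply, apply_ite (algebraMap K A), ite_and]
    rw [h2, h1]
    simp [Matrix.sum_apply]
  have hqsmul : ∀ (A : Type u) [CommRing A] [Algebra K A] (k l) (c : A)
      (Z : Matrix (Fin d) (Fin d) A), q A k l (c • Z) = c * q A k l Z := by
    intro A _ _ k l c Z
    simp only [q, Matrix.smul_apply, smul_eq_mul, Finset.mul_sum, mul_assoc]
  have hqsum : ∀ (A : Type u) [CommRing A] [Algebra K A] (k l)
      (Z : Fin d → Matrix (Fin d) (Fin d) A), q A k l (∑ i, Z i) = ∑ i, q A k l (Z i) := by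
    intro A _ _ k l Z
    simp only [q, Matrix.sum_apply, Finset.sum_mul]
    rw [Finset.sum_congr rfl fun i _ => Finset.sum_comm, Finset.sum_comm]
  refine isAlgebraicLie_of_natural _ (ι := U × Fin d × Fin d)
    (fun i A _ _ a b => q A i.2.1 i.2.2 (a * (e i.1).map (algebraMap K A) * b
      - (e i.1).map (algebraMap K A))) ?_ ?_ ?_ ?_
  · rintro ⟨Y, k, l⟩ A B _ _ _ _ φ a b
    have h1 : a.map φ * (e Y).map (algebraMap K B) * b.map φ - (e Y).map (algebraMap K B)
        = (a * (e Y).map (algebraMap K A) * b - (e Y).map (algebraMap K A)).map φ := by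
      have h2 : (e Y).map (algebraMap K B) = ((e Y).map (algebraMap K A)).map φ := by
        ext i j; simp
      rw [h2, Matrix.map_sub _ (map_sub φ), Matrix.map_mul, Matrix.map_mul]
    simp only [h1]
    simp [q]
  · rintro ⟨Y, k, l⟩ A _ _
    simp [q]
  · rintro A _ _ a b a' b' hba hba' h h' ⟨Y, k, l⟩
    let Z := a' * (e Y).map (algebraMap K A) * b' - (e Y).map (algebraMap K A)
    have h1 : a * a' * (e Y).map (algebraMap K A) * (b' * b) - (e Y).map (algebraMap K A)
        = a * Z * b + (a * (e Y).map (algebraMap K A) * b - (e Y).map (algebraMap K A)) := by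
      simp only [Z]; noncomm_ring
    show q A k l _ = 0
    rw [h1, hqadd, h (Y, k, l), add_zero]
    have h2 := hspan A Z fun k l => h' (Y, k, l)
    have h3 : ∀ i j, q A k l (a * (π (S i j)).map (algebraMap K A) * b) = 0 := by
      intro i j
      obtain ⟨w, hw, hwe⟩ := hπ (S i j)
      have hwe' : e w = π (S i j) := hwe
      have h4 : a * (π (S i j)).map (algebraMap K A) * b
          = (a * (e w).map (algebraMap K A) * b - (e w).map (algebraMap K A))
            + (e w).map (algebraMap K A) := by rw [sub_add_cancel, hwe']
      rw [h4, hqadd, h (⟨w, hWU hw⟩, k, l), zero_add, hqK, hπ' w hw, sub_self]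
      simp
    rw [h2]
    simp only [Finset.mul_sum, Finset.sum_mul, hqsum, mul_smul_comm, smul_mul_assoc, hqsmul, h3,
      mul_zero, Finset.sum_const_zero]
  · intro f
    have h1 : ∀ (Y : U) (k l : Fin d), q (DualNumber K) k l
        ((1 + (e f).map (TrivSqZeroExt.inr : K → DualNumber K)) *
          (e Y).map (algebraMap K (DualNumber K)) *
          (1 - (e f).map (TrivSqZeroExt.inr : K → DualNumber K))
          - (e Y).map (algebraMap K (DualNumber K)))
        = TrivSqZeroExt.inr
          ((e ⁅f, (Y : Module.End K V)⁆ - π (e ⁅f, (Y : Module.End K V)⁆)) k l) := by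
      intro Y k l
      rw [dualNumber_conj, add_sub_cancel_left]
      have h2 : e f * e Y - e Y * e f = e ⁅f, (Y : Module.End K V)⁆ := by
        rw [Ring.lie_def, map_sub]
        exact congrArg₂ _ (LinearMap.toMatrix_mul _ _ _).symm (LinearMap.toMatrix_mul _ _ _).symm
      rw [h2]
      have h3 := hqK K k l (e ⁅f, (Y : Module.End K V)⁆)
      simp only [q, Algebra.algebraMap_self, RingHom.id_apply, Matrix.map_apply] at h3
      rw [← h3]
      simp only [q, TrivSqZeroExt.inr_sum, Matrix.map_apply, dualNumber_inr_mul_algebraMap]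
    rw [mem_lieTransporter]
    constructor
    · rintro hf ⟨Y, k, l⟩
      refine (h1 Y k l).trans ?_
      rw [hπ' _ (hf Y Y.2), sub_self]
      simp
    · intro hf Y hY
      have h2 : π (e ⁅f, Y⁆) = e ⁅f, Y⁆ := by
        ext k l
        have := (h1 ⟨Y, hY⟩ k l).symm.trans (hf (⟨Y, hY⟩, k, l))
        have := TrivSqZeroExt.inr_injective (this.trans (TrivSqZeroExt.inr_zero K).symm)
        exact (sub_eq_zero.1 this).symm
      obtain ⟨w, hw, hwe⟩ := hπ (e ⁅f, Y⁆)
      rw [h2] at hwe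
      rwa [← e.injective hwe]

end Algebraic

section Derivations

variable (K : Type u) [Field K] (g : Type v) [LieRing g] [LieAlgebra K g]

/-- The derivations of `g`, as a Lie subalgebra of `gl(g)`. -/
def derivationSubalgebra : LieSubalgebra K (Module.End K g) where
  carrier := {f | ∀ x y, f ⁅x, y⁆ = ⁅f x, y⁆ + ⁅x, f y⁆}
  add_mem' := by intro f f' h h' x y; simp [h x y, h' x y]; abel
  zero_mem' := by intro x y; simp
  smul_mem' := by intro c f h x y; simp [h x y]
  lie_mem' := by
    intro f f' h h' x y
    simp only [Ring.lie_def, LinearMap.sub_apply, Module.End.mul_apply]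
    rw [h' x y, h x y, map_add, map_add, h, h, h', h', sub_lie, lie_sub]
    abel

variable {K g}

theorem mem_derivationSubalgebra {f : Module.End K g} :
    f ∈ derivationSubalgebra K g ↔ ∀ x y, f ⁅x, y⁆ = ⁅f x, y⁆ + ⁅x, f y⁆ := Iff.rfl

theorem lie_ad_of_mem_derivationSubalgebra {f : Module.End K g}
    (hf : f ∈ derivationSubalgebra K g) (x : g) :
    ⁅f, LieAlgebra.ad K g x⁆ = LieAlgebra.ad K g (f x) := by
  ext y
  simp [Ring.lie_def, mem_derivationSubalgebra.1 hf]

theorem mem_derivationSubalgebra_iff_lie_ad {f : Module.End K g} :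
    f ∈ derivationSubalgebra K g ↔
      ∀ x, ⁅f, LieAlgebra.ad K g x⁆ = LieAlgebra.ad K g (f x) := by
  refine ⟨lie_ad_of_mem_derivationSubalgebra, fun h x y => ?_⟩
  have := LinearMap.congr_fun (h x) y
  simp only [Ring.lie_def, LinearMap.sub_apply, Module.End.mul_apply, LieAlgebra.ad_apply] at this
  rw [← this, sub_add_cancel]

variable [FiniteDimensional K g]

variable (K g) in
/-- The derivation algebra is the Lie algebra of the automorphism group. -/
theorem isAlgebraicLie_derivationSubalgebra : IsAlgebraicLie (derivationSubalgebra K g) := by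
  let d := Module.finrank K g
  let b := Module.finBasis K g
  let e := LinearMap.toMatrix b b
  let M : Fin d → Matrix (Fin d) (Fin d) K := fun i => e (LieAlgebra.ad K g (b i))
  -- `a ∈ GL(g)` is an automorphism if `a (ad bᵢ) a⁻¹ = ad (a bᵢ)` for all basis vectors `bᵢ`
  refine isAlgebraicLie_of_natural _ (ι := Fin d × Fin d × Fin d)
    (fun i A _ _ a b => (a * (M i.1).map (algebraMap K A) * b
      - ∑ p, a p i.1 • (M p).map (algebraMap K A)) i.2.1 i.2.2) ?_ ?_ ?_ ?_
  · rintro ⟨i, k, l⟩ A B _ _ _ _ φ a b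
    have h2 : ∀ i, (M i).map (algebraMap K B) = ((M i).map (algebraMap K A)).map φ := by
      intro i; ext i j; simp
    have h1 : a.map φ * (M i).map (algebraMap K B) * b.map φ
        - ∑ p, (a.map φ) p i • (M p).map (algebraMap K B)
        = (a * (M i).map (algebraMap K A) * b
          - ∑ p, a p i • (M p).map (algebraMap K A)).map φ := by
      rw [h2, Matrix.map_sub _ (map_sub φ), Matrix.map_mul, Matrix.map_mul]
      congr 1
      ext k l
      simp [Matrix.sum_apply]
    exact congrFun (congrFun h1 k) l
  · rintro ⟨i, k, l⟩ A _ _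
    simp [Matrix.one_apply]
  · rintro A _ _ a b a' b' hba hba' h h' ⟨i, k, l⟩
    have h1 : ∀ i, a * (M i).map (algebraMap K A) * b
        = ∑ p, a p i • (M p).map (algebraMap K A) := by
      intro i
      ext k l
      exact sub_eq_zero.1 (h (i, k, l))
    have h2 : ∀ i, a' * (M i).map (algebraMap K A) * b'
        = ∑ p, a' p i • (M p).map (algebraMap K A) := by
      intro i
      ext k l
      exact sub_eq_zero.1 (h' (i, k, l))
    have h3 : a * a' * (M i).map (algebraMap K A) * (b' * b)
        = ∑ p, (a * a') p i • (M p).map (algebraMap K A) := by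
      have : a * a' * (M i).map (algebraMap K A) * (b' * b)
          = a * (a' * (M i).map (algebraMap K A) * b') * b := by noncomm_ring
      rw [this, h2]
      simp only [Finset.mul_sum, Finset.sum_mul, mul_smul_comm, smul_mul_assoc, h1,
        Finset.smul_sum, smul_smul, Matrix.mul_apply, Finset.sum_smul]
      rw [Finset.sum_comm]
      simp only [mul_comm]
    simp only [h3, sub_self]
    rfl
  · intro f
    have h1 : ∀ i, e (⁅f, LieAlgebra.ad K g (b i)⁆ - LieAlgebra.ad K g (f (b i)))
        = e f * M i - M i * e f - ∑ p, e f p i • M p := by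
      intro i
      rw [map_sub, Ring.lie_def, map_sub]
      have h2 : e (LieAlgebra.ad K g (f (b i))) = ∑ p, e f p i • M p := by
        conv_lhs => rw [← b.sum_repr (f (b i))]
        simp only [map_sum, map_smul, M, e, LinearMap.toMatrix_apply]
      rw [h2]
      exact congrArg (· - _) (congrArg₂ _ (LinearMap.toMatrix_mul _ _ _)
        (LinearMap.toMatrix_mul _ _ _))
    have h2 : ∀ i, (1 + (e f).map (TrivSqZeroExt.inr : K → DualNumber K)) *
          (M i).map (algebraMap K (DualNumber K)) *
          (1 - (e f).map (TrivSqZeroExt.inr : K → DualNumber K))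
        - ∑ p, (1 + (e f).map (TrivSqZeroExt.inr : K → DualNumber K)) p i •
          (M p).map (algebraMap K (DualNumber K))
        = (e (⁅f, LieAlgebra.ad K g (b i)⁆ - LieAlgebra.ad K g (f (b i)))).map
          (TrivSqZeroExt.inr : K → DualNumber K) := by
      intro i
      have h3 : ∑ p, (1 + (e f).map (TrivSqZeroExt.inr : K → DualNumber K)) p i •
          (M p).map (algebraMap K (DualNumber K)) = (M i).map (algebraMap K (DualNumber K))
            + (∑ p, e f p i • M p).map (TrivSqZeroExt.inr : K → DualNumber K) := by
        simp only [Matrix.add_apply, add_smul, Finset.sum_add_distrib, Matrix.one_apply, ite_smul,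
          one_smul, zero_smul, Finset.sum_ite_eq', Finset.mem_univ, if_true]
        congr 1
        refine Matrix.ext fun k l => ?_
        simp only [Matrix.sum_apply, Matrix.smul_apply, Matrix.map_apply, smul_eq_mul,
          dualNumber_inr_mul_algebraMap, TrivSqZeroExt.inr_sum]
      rw [h3, dualNumber_conj, h1, Matrix.map_sub _ (TrivSqZeroExt.inr_sub K) _ (∑ p, _)]
      abel
    rw [mem_derivationSubalgebra_iff_lie_ad]
    constructor
    · rintro hf ⟨i, k, l⟩
      refine (congrFun (congrFun (h2 i) k) l).trans ?_
      rw [hf, sub_self, map_zero]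
      simp
    · intro hf x
      have h3 : ∀ i, ⁅f, LieAlgebra.ad K g (b i)⁆ - LieAlgebra.ad K g (f (b i)) = 0 := by
        intro i
        refine e.injective ?_
        rw [map_zero]
        ext k l
        have := (congrFun (congrFun (h2 i) k) l).symm.trans (hf (i, k, l))
        exact TrivSqZeroExt.inr_injective (this.trans (TrivSqZeroExt.inr_zero K).symm)
      rw [← b.sum_repr x]
      simp only [map_sum, map_smul, lie_sum]
      refine Finset.sum_congr rfl fun i _ => ?_
      rw [← sub_eq_zero.1 (h3 i), Ring.lie_def, Ring.lie_def, mul_smul_comm, smul_mul_assoc,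
        smul_sub]

/-- The algebraic hull of `ad g` consists of derivations. -/
theorem algHullAd_le_derivationSubalgebra : algHullAd K g ≤ derivationSubalgebra K g := by
  refine sInf_le ⟨isAlgebraicLie_derivationSubalgebra K g, ?_⟩
  rintro _ ⟨x, rfl⟩
  rw [mem_derivationSubalgebra]
  intro y z
  simp

/-- If `W ≤ U` and `[ad g, U] ⊆ W`, then the algebraic hull `e` of `ad g` satisfies
`[e, U] ⊆ W`. -/
theorem lie_mem_of_mem_algHullAd {U W : Submodule K (Module.End K g)} (hWU : W ≤ U)
    (h : ∀ x : g, ∀ Y ∈ U, ⁅LieAlgebra.ad K g x, Y⁆ ∈ W) {X : Module.End K g}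
    (hX : X ∈ algHullAd K g) {Y : Module.End K g} (hY : Y ∈ U) : ⁅X, Y⁆ ∈ W := by
  have : algHullAd K g ≤ lieTransporter U W hWU := by
    refine sInf_le ⟨isAlgebraicLie_lieTransporter U W hWU, ?_⟩
    rintro _ ⟨x, rfl⟩
    exact h x
  exact this hX Y hY

/-- Commutators of elements of the algebraic hull of `ad g` are inner derivations. -/
theorem exists_ad_eq_lie_of_mem_algHullAd {X Y : Module.End K g} (hX : X ∈ algHullAd K g)
    (hY : Y ∈ algHullAd K g) : ∃ x : g, LieAlgebra.ad K g x = ⁅X, Y⁆ := by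
  refine lie_mem_of_mem_algHullAd (U := (derivationSubalgebra K g).toSubmodule)
    (W := LinearMap.range (LieAlgebra.ad K g : g →ₗ[K] Module.End K g)) ?_ ?_ hX
    (algHullAd_le_derivationSubalgebra hY)
  · rintro _ ⟨x, rfl⟩
    show _ ∈ derivationSubalgebra K g
    rw [mem_derivationSubalgebra]
    intro y z
    simp
  · intro x Z hZ
    refine ⟨-Z x, ?_⟩
    rw [← lie_skew, lie_ad_of_mem_derivationSubalgebra hZ]
    simp

end Derivations

/-! ### The structure of Levi subalgebras and of the algebra `Γ` -/

section Levi

variable {K g : Type*} [Field K] [LieRing g] [LieAlgebra K g]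

/-- The projection onto a complement of an ideal which is a subalgebra. -/
noncomputable def LieSubalgebra.projOfIsCompl (s : LieSubalgebra K g) (r : LieIdeal K g)
    (h : IsCompl s.toSubmodule r.toSubmodule) : g →ₗ⁅K⁆ s :=
  { Submodule.projectionOnto s.toSubmodule r.toSubmodule h with
    map_lie' := by
      intro x y
      have key : ∀ z : g, ∃ a : s, ∃ b ∈ r, z = a + b := by
        intro z
        obtain ⟨a, ha, b, hb, rfl⟩ := Submodule.mem_sup.1
          (show z ∈ s.toSubmodule ⊔ r.toSubmodule by rw [h.sup_eq_top]; trivial)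
        exact ⟨⟨a, ha⟩, b, hb, rfl⟩
      obtain ⟨a, b, hb, rfl⟩ := key x
      obtain ⟨a', b', hb', rfl⟩ := key y
      have e : ⁅(a : g) + b, (a' : g) + b'⁆
          = ((⁅a, a'⁆ : s) : g) + (⁅b, (a' : g) + b'⁆ + ⁅(a : g), b'⁆) := by
        simp; abel
      have e1 : ∀ (a : s), ∀ b ∈ r,
          Submodule.projectionOnto s.toSubmodule r.toSubmodule h (a + b) = a := by
        intro a b hb
        rw [map_add]
        have h1 := Submodule.projectionOnto_apply_left h a
        have h2 := Submodule.projectionOnto_apply_right h ⟨b, hb⟩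
        rw [h1]
        erw [h2]
        rw [add_zero]
      simp only [AddHom.toFun_eq_coe, LinearMap.coe_toAddHom]
      rw [e, e1 _ _ (add_mem (lie_mem_left K g r _ _ hb) (lie_mem_right K g r _ _ hb')),
        e1 _ _ hb, e1 _ _ hb'] }

theorem LieSubalgebra.projOfIsCompl_add (s : LieSubalgebra K g) (r : LieIdeal K g)
    (h : IsCompl s.toSubmodule r.toSubmodule) (a : s) {b : g} (hb : b ∈ r) :
    s.projOfIsCompl r h (a + b) = a := by
  rw [map_add]
  have h1 : s.projOfIsCompl r h a = a := Submodule.projectionOnto_apply_left h a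
  have h2 : s.projOfIsCompl r h b = 0 := Submodule.projectionOnto_apply_right h ⟨b, hb⟩
  rw [h1, h2, add_zero]

/-- Levi subalgebras are semisimple. -/
theorem LieSubalgebra.isKilling_of_isCompl_radical [CharZero K] [Module.Finite K g]
    (s : LieSubalgebra K g)
    (h : IsCompl s.toSubmodule (LieAlgebra.radical K g).toSubmodule) :
    LieAlgebra.IsKilling K s := by
  have : LieAlgebra.HasTrivialRadical K s := by
    refine (LieAlgebra.hasTrivialRadical_iff_no_abelian_ideals K s).2 fun I hI => ?_
    let q := s.projOfIsCompl _ h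
    have hle : ⁅I.comap q, I.comap q⁆ ≤ LieAlgebra.radical K g := by
      rw [LieSubmodule.lie_le_iff]
      intro x hx y hy
      obtain ⟨a, ha, b, hb, e⟩ := Submodule.mem_sup.1
        (show ⁅x, y⁆ ∈ s.toSubmodule ⊔ (LieAlgebra.radical K g).toSubmodule by
          rw [h.sup_eq_top]; trivial)
      have h1 : q ⁅x, y⁆ = ⟨a, ha⟩ := by
        rw [← e]; exact s.projOfIsCompl_add _ h ⟨a, ha⟩ hb
      have h2 : q ⁅x, y⁆ = 0 := by
        rw [LieHom.map_lie]
        have := LieIdeal.mem_comap.1 hx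
        have h3 := hI.trivial ⟨q x, LieIdeal.mem_comap.1 hx⟩ ⟨q y, LieIdeal.mem_comap.1 hy⟩
        exact congrArg Subtype.val h3
      have h3 : a = 0 := congrArg Subtype.val (h1.symm.trans h2)
      rw [← e, h3, zero_add]
      exact hb
    have hsolv : LieAlgebra.IsSolvable (I.comap q) := by
      obtain ⟨j, hj⟩ := (LieAlgebra.radicalIsSolvable K g).solvable K
      rw [LieIdeal.derivedSeries_eq_bot_iff] at hj
      refine LieAlgebra.IsSolvable.mk (R := K) (k := j + 1) ?_
      rw [LieIdeal.derivedSeries_eq_bot_iff, LieAlgebra.derivedSeriesOfIdeal_add,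
        _root_.eq_bot_iff, ← hj]
      exact LieAlgebra.derivedSeriesOfIdeal_mono hle j
    have hle2 := (LieAlgebra.LieIdeal.solvable_iff_le_radical _ _ _).1 hsolv
    rw [LieSubmodule.eq_bot_iff]
    intro a ha
    have h1 : q a = a := by
      have := s.projOfIsCompl_add _ h a (zero_mem (LieAlgebra.radical K g))
      rwa [add_zero] at this
    have h2 : (a : g) ∈ LieAlgebra.radical K g := hle2 (LieIdeal.mem_comap.2 (by rwa [h1]))
    have h3 : (a : g) ∈ s.toSubmodule ⊓ (LieAlgebra.radical K g).toSubmodule := ⟨a.2, h2⟩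
    rw [h.inf_eq_bot] at h3
    exact Subtype.ext h3
  infer_instance

end Levi

/-- The elements of a semisimple Lie algebra are sums of brackets. -/
theorem LieAlgebra.IsKilling.mem_span_lie {K s : Type*} [Field K] [LieRing s] [LieAlgebra K s]
    [Module.Finite K s] [LieAlgebra.IsKilling K s] (x : s) :
    x ∈ Submodule.span K {z : s | ∃ a b : s, ⁅a, b⁆ = z} := by
  have hx : x ∈ ⁅(⊤ : LieIdeal K s), (⊤ : LieIdeal K s)⁆ := by
    rw [LieIdeal.lie_self_of_isKilling]; trivial
  rw [← LieSubmodule.mem_toSubmodule, LieSubmodule.lieIdeal_oper_eq_linear_span'] at hx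
  refine Submodule.span_mono ?_ hx
  rintro _ ⟨a, -, b, -, rfl⟩
  exact ⟨a, b, rfl⟩

theorem LieAlgebra.ad_injective_of_center_eq_bot {K g : Type*} [CommRing K] [LieRing g]
    [LieAlgebra K g] (h : LieAlgebra.center K g = ⊥) {x : g} (hx : ∀ y : g, ⁅x, y⁆ = 0) :
    x = 0 := by
  have : x ∈ LieAlgebra.center K g := by
    rw [LieModule.mem_maxTrivSubmodule]
    intro y
    rw [← lie_skew, hx, neg_zero]
  rwa [h, LieSubmodule.mem_bot] at this

namespace IsGammaTriple

variable {K : Type u} [Field K] {g : Type v} [LieRing g] [LieAlgebra K g]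
    [FiniteDimensional K g] {Γ : LieSubalgebra K (Module.End K g)}
    {s k : LieSubalgebra K g} {m : Submodule K g}

theorem le_algHullAd (h : IsGammaTriple Γ s k m) : Γ ≤ algHullAd K g := h.mcr.prop.1

theorem isCompletelyReducible (h : IsGammaTriple Γ s k m) : IsCompletelyReducible Γ :=
  h.mcr.prop.2

theorem apply_lie (h : IsGammaTriple Γ s k m) {γ : Module.End K g} (hγ : γ ∈ Γ) (x y : g) :
    γ ⁅x, y⁆ = ⁅γ x, y⁆ + ⁅x, γ y⁆ :=
  algHullAd_le_derivationSubalgebra (h.le_algHullAd hγ) x y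

theorem lie_ad (h : IsGammaTriple Γ s k m) {γ : Module.End K g} (hγ : γ ∈ Γ) (x : g) :
    ⁅γ, LieAlgebra.ad K g x⁆ = LieAlgebra.ad K g (γ x) :=
  lie_ad_of_mem_derivationSubalgebra (algHullAd_le_derivationSubalgebra (h.le_algHullAd hγ)) x

theorem k_le_radical (h : IsGammaTriple Γ s k m) {x : g} (hx : x ∈ k) :
    x ∈ LieAlgebra.radical K g := by
  have : x ∈ k.toSubmodule ⊔ m := Submodule.mem_sup_left hx
  rwa [h.sup_eq] at this

theorem m_le_radical (h : IsGammaTriple Γ s k m) {x : g} (hx : x ∈ m) :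
    x ∈ LieAlgebra.radical K g := by
  have : x ∈ k.toSubmodule ⊔ m := Submodule.mem_sup_right hx
  rwa [h.sup_eq] at this

theorem apply_mem_m (h : IsGammaTriple Γ s k m) {γ : Module.End K g} (hγ : γ ∈ Γ) {x : g}
    (hx : x ∈ LieAlgebra.radical K g) : γ x ∈ m := by
  rw [h.m_eq]
  exact Submodule.subset_span ⟨γ, hγ, x, hx, rfl⟩

theorem exists_add (h : IsGammaTriple Γ s k m) (x : g) :
    ∃ a ∈ s, ∃ b ∈ LieAlgebra.radical K g, x = a + b := by
  obtain ⟨a, ha, b, hb, rfl⟩ := Submodule.mem_sup.1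
    (show x ∈ s.toSubmodule ⊔ (LieAlgebra.radical K g).toSubmodule by
      rw [h.levi.sup_eq_top]; trivial)
  exact ⟨a, ha, b, hb, rfl⟩

theorem exists_add_add (h : IsGammaTriple Γ s k m) (x : g) :
    ∃ (a : s) (b : k) (c : m), x = a + b + c := by
  obtain ⟨a, ha, b, hb, rfl⟩ := h.exists_add x
  have hb' : b ∈ k.toSubmodule ⊔ m := by rw [h.sup_eq]; exact hb
  obtain ⟨c, hc, d, hd, rfl⟩ := Submodule.mem_sup.1 hb'
  exact ⟨⟨a, ha⟩, ⟨c, hc⟩, ⟨d, hd⟩, by rw [add_assoc]⟩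

variable [CharZero K]

theorem isKilling (h : IsGammaTriple Γ s k m) : LieAlgebra.IsKilling K s :=
  s.isKilling_of_isCompl_radical h.levi

/-- The elements of `s` are sums of brackets of elements of `s`. -/
theorem s_induction (h : IsGammaTriple Γ s k m) {P : g → Prop} (h0 : P 0)
    (hadd : ∀ x y, P x → P y → P (x + y)) (hsmul : ∀ (c : K) (x), P x → P (c • x))
    (hlie : ∀ x ∈ s, ∀ y ∈ s, P ⁅x, y⁆) {x : g} (hx : x ∈ s) : P x := by
  have := h.isKilling
  have key : ∀ x : s, P x := by
    intro x
    have hx := LieAlgebra.IsKilling.mem_span_lie (K := K) x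
    induction hx using Submodule.span_induction with
    | mem z hz => obtain ⟨a, b, rfl⟩ := hz; exact hlie a a.2 b b.2
    | zero => exact h0
    | add a b _ _ ha hb => exact hadd _ _ ha hb
    | smul c a _ ha => exact hsmul c _ ha
  exact key ⟨x, hx⟩

/-- The algebra `Γ ∩ ad r` is a solvable ideal of the completely reducible `Γ`, so it is central. -/
theorem apply_eq_zero_of_ad_mem (h : IsGammaTriple Γ s k m) (hc : LieAlgebra.center K g = ⊥)
    {b : g} (hb : b ∈ LieAlgebra.radical K g) (hbΓ : LieAlgebra.ad K g b ∈ Γ)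
    {γ : Module.End K g} (hγ : γ ∈ Γ) : γ b = 0 := by
  let R : LieIdeal K Γ :=
    { carrier := {γ | ∃ x ∈ LieAlgebra.radical K g, LieAlgebra.ad K g x = γ}
      add_mem' := by
        rintro _ _ ⟨x, hx, e⟩ ⟨y, hy, e'⟩
        exact ⟨x + y, add_mem hx hy, by rw [map_add, e, e']; rfl⟩
      zero_mem' := ⟨0, zero_mem _, by simp⟩
      smul_mem' := by
        rintro c _ ⟨x, hx, e⟩
        exact ⟨c • x, (LieAlgebra.radical K g).smul_mem c hx, by rw [map_smul, e]; rfl⟩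
      lie_mem := by
        rintro γ _ ⟨x, hx, e⟩
        refine ⟨(γ : Module.End K g) x, h.m_le_radical (h.apply_mem_m γ.2 hx), ?_⟩
        rw [← h.lie_ad γ.2, e]; rfl }
  let A : LieSubalgebra K (LieAlgebra.radical K g) :=
    Γ.comap ((LieAlgebra.ad K g).comp (LieAlgebra.radical K g).incl)
  have hA : LieAlgebra.IsSolvable A := Function.Injective.lieAlgebra_isSolvable
    (f := A.incl) Subtype.val_injective
  let f : A →ₗ⁅K⁆ R :=
    { toFun := fun x => ⟨⟨LieAlgebra.ad K g x, x.2⟩, x, (x : LieAlgebra.radical K g).2, rfl⟩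
      map_add' := fun x y => Subtype.ext (Subtype.ext (by simp))
      map_smul' := fun c x => Subtype.ext (Subtype.ext (by simp))
      map_lie' := fun {x y} => Subtype.ext (Subtype.ext (by simp)) }
  have hR : LieAlgebra.IsSolvable R := by
    refine Function.Surjective.lieAlgebra_isSolvable (f := f) ?_
    rintro ⟨⟨γ, hγ⟩, hx⟩
    obtain ⟨x, hx, e⟩ := id hx
    exact ⟨⟨⟨x, hx⟩, show LieAlgebra.ad K g x ∈ Γ by rw [e]; exact hγ⟩,
      Subtype.ext (Subtype.ext e)⟩
  have h1 := h.isCompletelyReducible.top_lie_eq_bot_of_isSolvable R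
  have h2 : ⁅(⟨γ, hγ⟩ : Γ), (⟨LieAlgebra.ad K g b, hbΓ⟩ : Γ)⁆ = 0 := by
    have : ⁅(⟨γ, hγ⟩ : Γ), (⟨LieAlgebra.ad K g b, hbΓ⟩ : Γ)⁆ ∈ ⁅(⊤ : LieIdeal K Γ), R⁆ :=
      LieSubmodule.lie_mem_lie trivial ⟨b, hb, rfl⟩
    rwa [h1, LieSubmodule.mem_bot] at this
  have h3 : ⁅γ, LieAlgebra.ad K g b⁆ = 0 := congrArg Subtype.val h2
  rw [h.lie_ad hγ] at h3
  exact LieAlgebra.ad_injective_of_center_eq_bot hc fun y => LinearMap.congr_fun h3 y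

/-- If `ad y ∈ Γ`, then `y` is the sum of an element of `s` and an element killed by `Γ`. -/
theorem exists_add_of_ad_mem (h : IsGammaTriple Γ s k m) (hc : LieAlgebra.center K g = ⊥)
    {y : g} (hy : LieAlgebra.ad K g y ∈ Γ) :
    ∃ a ∈ s, ∃ b, y = a + b ∧ ∀ γ ∈ Γ, γ b = 0 := by
  obtain ⟨a, ha, b, hb, rfl⟩ := h.exists_add y
  refine ⟨a, ha, b, rfl, fun γ hγ => h.apply_eq_zero_of_ad_mem hc hb ?_ hγ⟩
  rw [map_add] at hy
  simpa using sub_mem hy (h.ad_s_le a ha)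

/-- The Levi subalgebra `s` is stable under `Γ`. -/
theorem apply_mem_s (h : IsGammaTriple Γ s k m) (hc : LieAlgebra.center K g = ⊥)
    {γ : Module.End K g} (hγ : γ ∈ Γ) {x : g} (hx : x ∈ s) : γ x ∈ s := by
  have key : ∀ u ∈ s, ∀ v ∈ s, ⁅γ u, v⁆ ∈ s := by
    intro u hu v hv
    have h1 : LieAlgebra.ad K g (γ u) ∈ Γ := by
      rw [← h.lie_ad hγ]; exact Γ.lie_mem hγ (h.ad_s_le u hu)
    obtain ⟨a, ha, b, e, hb⟩ := h.exists_add_of_ad_mem hc h1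
    have h2 : ⁅b, v⁆ = 0 := by
      rw [← lie_skew]
      have := hb _ (h.ad_s_le v hv)
      rw [LieAlgebra.ad_apply] at this
      rw [this, neg_zero]
    rw [e, add_lie, h2, add_zero]
    exact s.lie_mem ha hv
  refine h.s_induction (P := fun x => γ x ∈ s) ?_ ?_ ?_ ?_ hx
  · rw [map_zero]; exact zero_mem _
  · intro x y hx hy; rw [map_add]; exact add_mem hx hy
  · intro c x hx; rw [map_smul]; exact s.smul_mem c hx
  · intro u hu v hv
    rw [h.apply_lie hγ]
    refine add_mem (key u hu v hv) ?_
    rw [← lie_skew]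
    exact neg_mem (key v hv u hu)

/-- `Γ = ad s + T`, where `T` consists of semisimple elements which kill `s`. -/
theorem exists_ad_add (h : IsGammaTriple Γ s k m) (hc : LieAlgebra.center K g = ⊥)
    {γ : Module.End K g} (hγ : γ ∈ Γ) : ∃ x ∈ s, ∃ t ∈ Γ, γ = LieAlgebra.ad K g x + t ∧
      (∀ y ∈ s, t y = 0) ∧ t.IsSemisimple := by
  have hK := h.isKilling
  -- first the decomposition, by complete reducibility of the action of `s` on `Γ`
  have hdec : ∀ γ ∈ Γ, ∃ x ∈ s, ∃ t ∈ Γ, γ = LieAlgebra.ad K g x + t ∧ ∀ y ∈ s, t y = 0 := by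
    intro γ hγ
    let ρ : s →ₗ⁅K⁆ Module.End K (Module.End K g) :=
      (LieAlgebra.ad K (Module.End K g)).comp ((LieAlgebra.ad K g).comp s.incl)
    have hρ : ∀ (x : s) (f : Module.End K g), ρ x f = ⁅LieAlgebra.ad K g x, f⁆ := fun x f => rfl
    obtain ⟨t, ht, γ₁, hγ₁, e, h0⟩ := ρ.exists_invariant_add_actSpan Γ.toSubmodule
      (fun x f hf => Γ.lie_mem (h.ad_s_le x x.2) hf) hγ
    have h1 : γ₁ ∈ s.toSubmodule.map (LieAlgebra.ad K g : g →ₗ[K] Module.End K g) := by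
      refine ρ.actSpan_le ?_ hγ₁
      intro x f hf
      refine ⟨- f x, neg_mem (h.apply_mem_s hc hf x.2), ?_⟩
      rw [hρ, ← lie_skew, h.lie_ad hf, map_neg]; rfl
    obtain ⟨x, hx, rfl⟩ := h1
    refine ⟨x, hx, t, ht, by rw [e, add_comm]; rfl, fun y hy => ?_⟩
    have h2 := h0 ⟨y, hy⟩
    rw [hρ, ← lie_skew, h.lie_ad ht, neg_eq_zero] at h2
    exact LieAlgebra.ad_injective_of_center_eq_bot hc fun z => LinearMap.congr_fun h2 z
  have hcomm_s : ∀ t ∈ Γ, (∀ y ∈ s, t y = 0) → ∀ x ∈ s, ⁅t, LieAlgebra.ad K g x⁆ = 0 := by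
    intro t ht ht0 x hx
    rw [h.lie_ad ht, ht0 x hx, map_zero]
  -- the part `T` is commutative: commutators are central, semisimple and nilpotent
  have hcomm : ∀ t ∈ Γ, (∀ y ∈ s, t y = 0) → ∀ t' ∈ Γ, (∀ y ∈ s, t' y = 0) → ⁅t, t'⁆ = 0 := by
    intro t ht ht0 t' ht' ht0'
    obtain ⟨y, hy⟩ := exists_ad_eq_lie_of_mem_algHullAd (h.le_algHullAd ht) (h.le_algHullAd ht')
    have hyΓ : LieAlgebra.ad K g y ∈ Γ := by rw [hy]; exact Γ.lie_mem ht ht'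
    obtain ⟨a, ha, b, rfl, hb⟩ := h.exists_add_of_ad_mem hc hyΓ
    have ha0 : a = 0 := by
      have h1 : (⟨a, ha⟩ : s) = 0 := by
        refine LieAlgebra.ad_injective_of_center_eq_bot
          (LieAlgebra.center_eq_bot K s) fun z => Subtype.ext ?_
        have h2 := LinearMap.congr_fun hy z
        have h3 := hb _ (h.ad_s_le z z.2)
        rw [LieAlgebra.ad_apply, ← lie_skew, neg_eq_zero] at h3
        rw [LieAlgebra.ad_apply, add_lie, h3, add_zero] at h2
        refine h2.trans ?_
        simp [Ring.lie_def, ht0 z z.2, ht0' z z.2]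
      exact congrArg Subtype.val h1
    rw [ha0, zero_add] at hy hyΓ
    have hcen : ∀ γ ∈ Γ, Commute γ ⁅t, t'⁆ := by
      intro γ hγ
      have h1 := h.lie_ad hγ b
      rw [hb γ hγ, map_zero, hy] at h1
      exact sub_eq_zero.1 h1
    refine Module.End.eq_zero_of_isNilpotent_isSemisimple ?_
      (h.isCompletelyReducible.isSemisimple_of_commute (Γ.lie_mem ht ht') hcen)
    exact isNilpotent_of_mem_span_commutators _
      (Submodule.subset_span ⟨t, t', hcen t' ht', rfl⟩)
  obtain ⟨x, hx, t, ht, e, ht0⟩ := hdec γ hγ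
  refine ⟨x, hx, t, ht, e, ht0, ?_⟩
  refine h.isCompletelyReducible.isSemisimple_of_commute ht fun γ' hγ' => ?_
  obtain ⟨x', hx', t', ht', rfl, ht0'⟩ := hdec γ' hγ'
  have h1 := hcomm_s t ht ht0 x' hx'
  have h2 := hcomm t ht ht0 t' ht' ht0'
  have h3 : ⁅t, LieAlgebra.ad K g x' + t'⁆ = 0 := by rw [lie_add, h1, h2, add_zero]
  exact (sub_eq_zero.1 h3).symm

end IsGammaTriple

/-! ### Derivations of a Lie algebra with a decomposition `s ⊕ N ⊕ M` -/

/-- In characteristic zero, a derivation maps a solvable ideal into the radical: its composition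
with a homomorphism onto a semisimple Lie algebra which kills the ideal kills the ideal too. If `J`
is the image of the ideal, then the `j`-th term of the derived series of `J` is the image under
`D ^ (2 ^ j)` of the `j`-th term of the derived series of the ideal. -/
theorem LieDerivation.apply_eq_zero_of_isSolvable {K L s : Type*} [Field K] [CharZero K]
    [LieRing L] [LieAlgebra K L] [LieRing s] [LieAlgebra K s] [LieAlgebra.HasTrivialRadical K s]
    (q : L →ₗ⁅K⁆ s) (hq : Function.Surjective q) (I : LieIdeal K L) [hI : LieAlgebra.IsSolvable I]
    (hqI : ∀ a ∈ I, q a = 0) (D : LieDerivation K L L) {a : L} (ha : a ∈ I) : q (D a) = 0 := by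
  let J : LieIdeal K s :=
    { I.toSubmodule.map (q.toLinearMap ∘ₗ D.toLinearMap) with
      lie_mem := by
        rintro y _ ⟨a, ha, rfl⟩
        obtain ⟨l, rfl⟩ := hq y
        refine ⟨⁅l, a⁆, lie_mem_right K L I l a ha, ?_⟩
        show q (D ⁅l, a⁆) = ⁅q l, q (D a)⁆
        rw [D.apply_lie_eq_add, map_add, LieHom.map_lie, LieHom.map_lie, hqI a ha, lie_zero,
          add_zero] }
  have hJ : ∀ a ∈ I, q (D a) ∈ J := fun a ha => ⟨a, ha, rfl⟩
  let T : ℕ → L →ₗ[K] s := fun n => q.toLinearMap ∘ₗ (D.toLinearMap ^ n)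
  have hT : ∀ n a, T n a = q (D^[n] a) := fun n a => by
    simp only [T, LinearMap.comp_apply, Module.End.pow_apply]; rfl
  have hlie : ∀ n a b, T n ⁅a, b⁆
      = ∑ i ∈ Finset.range (n + 1), n.choose i • ⁅T i a, T (n - i) b⁆ := by
    intro n a b
    simp only [hT, D.iterate_apply_lie', map_sum, map_nsmul, LieHom.map_lie]
  have key : ∀ j : ℕ, (∀ a ∈ LieAlgebra.derivedSeriesOfIdeal K L j I, ∀ i < 2 ^ j, T i a = 0) ∧
      ∀ x ∈ LieAlgebra.derivedSeriesOfIdeal K s j J,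
        ∃ a ∈ LieAlgebra.derivedSeriesOfIdeal K L j I, T (2 ^ j) a = x := by
    intro j
    induction j with
    | zero =>
      constructor
      · intro a ha i hi
        rw [pow_zero, Nat.lt_one_iff] at hi
        rw [hi, hT]
        exact hqI a ha
      · rintro _ ⟨a, ha, rfl⟩
        exact ⟨a, ha, rfl⟩
    | succ j ih =>
      obtain ⟨ih1, ih2⟩ := ih
      have hpow : 2 ^ (j + 1) = 2 ^ j + 2 ^ j := by ring
      have hpos : 0 < 2 ^ j := Nat.two_pow_pos j
      constructor
      · intro a ha i hi
        rw [LieAlgebra.derivedSeriesOfIdeal_succ, ← LieSubmodule.mem_toSubmodule,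
          LieSubmodule.lieIdeal_oper_eq_linear_span'] at ha
        induction ha using Submodule.span_induction with
        | mem y hy =>
          obtain ⟨b, hb, c, hc, rfl⟩ := hy
          rw [hlie]
          refine Finset.sum_eq_zero fun l _ => ?_
          by_cases hl : l < 2 ^ j
          · rw [ih1 b hb l hl, zero_lie, smul_zero]
          · rw [ih1 c hc (i - l) (by omega), lie_zero, smul_zero]
        | zero => rw [map_zero]
        | add a b _ _ ha hb => rw [map_add, ha, hb, add_zero]
        | smul c a _ ha => rw [map_smul, ha, smul_zero]
      · intro x hx
        rw [LieAlgebra.derivedSeriesOfIdeal_succ, ← LieSubmodule.mem_toSubmodule,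
          LieSubmodule.lieIdeal_oper_eq_linear_span'] at hx
        rw [LieAlgebra.derivedSeriesOfIdeal_succ]
        induction hx using Submodule.span_induction with
        | mem y hy =>
          obtain ⟨x₁, hx₁, x₂, hx₂, rfl⟩ := hy
          obtain ⟨b, hb, rfl⟩ := ih2 x₁ hx₁
          obtain ⟨c, hc, rfl⟩ := ih2 x₂ hx₂
          -- only the middle term of the Leibniz formula survives
          have h1 : T (2 ^ (j + 1)) ⁅b, c⁆
              = (2 ^ (j + 1)).choose (2 ^ j) • ⁅T (2 ^ j) b, T (2 ^ j) c⁆ := by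
            rw [hlie, Finset.sum_eq_single (2 ^ j)]
            · rw [hpow, Nat.add_sub_cancel]
            · intro l _ hl
              by_cases hl' : l < 2 ^ j
              · rw [ih1 b hb l hl', zero_lie, smul_zero]
              · rw [ih1 c hc _ (by omega), lie_zero, smul_zero]
            · intro hl
              exact absurd (Finset.mem_range.2 (by omega)) hl
          have h2 : (((2 ^ (j + 1)).choose (2 ^ j) : ℕ) : K) ≠ 0 :=
            Nat.cast_ne_zero.2 (Nat.choose_pos (by omega)).ne'
          refine ⟨(((2 ^ (j + 1)).choose (2 ^ j) : ℕ) : K)⁻¹ • ⁅b, c⁆,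
            SMulMemClass.smul_mem _ (LieSubmodule.lie_mem_lie hb hc), ?_⟩
          rw [map_smul, h1, ← Nat.cast_smul_eq_nsmul K, smul_smul, inv_mul_cancel₀ h2, one_smul]
        | zero => exact ⟨0, zero_mem _, map_zero _⟩
        | add a b _ _ ha hb =>
          obtain ⟨a, ha, rfl⟩ := ha
          obtain ⟨b, hb, rfl⟩ := hb
          exact ⟨a + b, add_mem ha hb, map_add _ _ _⟩
        | smul c a _ ha =>
          obtain ⟨a, ha, rfl⟩ := ha
          exact ⟨c • a, SMulMemClass.smul_mem _ ha, map_smul _ _ _⟩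
  have hJ0 : J = ⊥ := by
    obtain ⟨j, hj⟩ := hI.solvable K
    rw [LieIdeal.derivedSeries_eq_bot_iff] at hj
    have : LieAlgebra.IsSolvable J := by
      refine LieAlgebra.IsSolvable.mk (R := K) (k := j) ?_
      rw [LieIdeal.derivedSeries_eq_bot_iff, LieSubmodule.eq_bot_iff]
      intro x hx
      obtain ⟨a, ha, rfl⟩ := (key j).2 x hx
      rw [hj, LieSubmodule.mem_bot] at ha
      rw [ha, map_zero]
    exact LieAlgebra.HasTrivialRadical.eq_bot_of_isSolvable J
  have := hJ a ha
  rwa [hJ0, LieSubmodule.mem_bot] at this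

/-- Let `L = s ⊕ N ⊕ M` be a centerless Lie algebra, where `s` is semisimple and commutes with the
subalgebra `N`, and `M` is stable under `s ⊕ N` and contained in a solvable ideal. Let `k` be a
nilpotent Lie algebra with a homomorphism to `N`, acting nilpotently on `N`, such that
`M = [s, M] + [k, M]`. Then every derivation of `L` is, up to an inner derivation, zero on `s` and
preserves `N` and `M`. -/
theorem LieDerivation.exists_add_ad_of_decomp {K L s k : Type*} [Field K] [CharZero K]
    [LieRing L] [LieAlgebra K L] [Module.Finite K L]
    [LieRing s] [LieAlgebra K s] [Module.Finite K s] [LieAlgebra.IsKilling K s]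
    [LieRing k] [LieAlgebra K k] [LieRing.IsNilpotent k]
    (hL : LieAlgebra.center K L = ⊥) (iS : s →ₗ⁅K⁆ L) (iK : k →ₗ⁅K⁆ L) (q : L →ₗ⁅K⁆ s)
    (N M : Submodule K L) (p : L →ₗ[K] L)
    (hdec : ∀ l, ∃ x, ∃ n ∈ N, ∃ z ∈ M, l = iS x + n + z)
    (hqS : ∀ x, q (iS x) = x) (hqN : ∀ n ∈ N, q n = 0) (hqM : ∀ z ∈ M, q z = 0)
    (hpN : ∀ n ∈ N, p n = n) (hpM : ∀ z ∈ M, p z = 0)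
    (hKN : ∀ y, iK y ∈ N) (hNN : ∀ n ∈ N, ∀ n' ∈ N, ⁅n, n'⁆ ∈ N)
    (hSN : ∀ x, ∀ n ∈ N, ⁅iS x, n⁆ = 0) (hSM : ∀ x, ∀ z ∈ M, ⁅iS x, z⁆ ∈ M)
    (hNM : ∀ n ∈ N, ∀ z ∈ M, ⁅n, z⁆ ∈ M)
    (hM : M ≤ ((LieAlgebra.ad K L).comp iS).actSpan M ⊔ ((LieAlgebra.ad K L).comp iK).actSpan M)
    {j : ℕ} (hnil : N ≤ ((LieAlgebra.ad K L).comp iK).nilSeries j)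
    (I : LieIdeal K L) [LieAlgebra.IsSolvable I] (hMI : ∀ z ∈ M, z ∈ I) (hqI : ∀ a ∈ I, q a = 0)
    (D : LieDerivation K L L) :
    ∃ (l : L) (D' : LieDerivation K L L), D = D' + LieDerivation.ad K L l ∧
      (∀ x, D' (iS x) = 0) ∧ (∀ n ∈ N, D' n ∈ N) ∧ ∀ z ∈ M, D' z ∈ M := by
  let σ := (LieAlgebra.ad K L).comp iS
  let κ := (LieAlgebra.ad K L).comp iK
  have hσ : ∀ x l, σ x l = ⁅iS x, l⁆ := fun _ _ => rfl
  have hκ : ∀ y l, κ y l = ⁅iK y, l⁆ := fun _ _ => rfl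
  have hcen : ∀ l : L, LieDerivation.ad K L l = 0 → l = 0 := fun l hl =>
    LieDerivation.injective_ad_of_center_eq_bot hL (hl.trans (map_zero _).symm)
  have hSK : ∀ x y, ⁅iS x, iK y⁆ = 0 := fun x y => hSN x _ (hKN y)
  have hcomm : ∀ x y l, σ x (κ y l) = κ y (σ x l) := by
    intro x y l
    rw [hσ, hκ, hκ, hσ, leibniz_lie, hSK, zero_lie, zero_add]
  -- `N` is the space of all `s`-invariants on which `k` acts nilpotently
  have hnullM : ∀ i, ∀ z ∈ M, (∀ x, ⁅iS x, z⁆ = 0) → z ∈ κ.nilSeries i → z = 0 := by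
    intro i
    induction i with
    | zero => intro z _ _ hz; exact hz
    | succ i ih =>
      intro z hz hz0 hzi
      refine eq_zero_of_invariant_of_le_sup_actSpan σ κ hcomm hSM
        (fun y w hw => hNM _ (hKN y) w hw) hM hz hz0 fun y => ?_
      refine ih _ (hNM _ (hKN y) z hz) (fun x => ?_) (κ.mem_nilSeries_succ.1 hzi y)
      have := hcomm x y z
      rw [hσ x z, hz0, map_zero] at this
      exact this
  have hnull : ∀ i l, (∀ x, ⁅iS x, l⁆ = 0) → l ∈ κ.nilSeries i → l ∈ N := by
    intro i l hl0 hli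
    obtain ⟨a, n, hn, z, hz, rfl⟩ := hdec l
    have ha : a = 0 := by
      refine LieAlgebra.ad_injective_of_center_eq_bot (LieAlgebra.center_eq_bot K s) fun x => ?_
      have := congrArg q (hl0 x)
      rw [LieHom.map_lie, map_add, map_add, hqS, hqS, hqN n hn, hqM z hz, add_zero, add_zero,
        map_zero] at this
      rw [← lie_skew, this, neg_zero]
    rw [ha, map_zero, zero_add] at hl0 hli ⊢
    have hz0 : z = 0 := by
      refine hnullM (max i j) z hz (fun x => ?_) ?_
      · have := hl0 x
        rwa [lie_add, hSN x n hn, zero_add] at this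
      · have h1 := κ.nilSeries_mono (le_max_right i j) (hnil hn)
        have h2 := κ.nilSeries_mono (le_max_left i j) hli
        simpa using sub_mem h2 h1
    rw [hz0, add_zero]
    exact hn
  -- make `D` commute with `s`, by complete reducibility, and then `k`-nilpotent, by the Fitting
  -- decomposition
  obtain ⟨l, D', hD, hDs, i, hDi⟩ : ∃ (l : L) (D' : LieDerivation K L L),
      D = D' + LieDerivation.ad K L l ∧ (∀ x, ⁅LieDerivation.ad K L (iS x), D'⁆ = 0) ∧
      ∃ i, D' ∈ ((LieAlgebra.ad K (LieDerivation K L L)).comp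
        ((LieDerivation.ad K L).comp iK)).nilSeries i := by
    let σ' := (LieAlgebra.ad K (LieDerivation K L L)).comp ((LieDerivation.ad K L).comp iS)
    let κ' := (LieAlgebra.ad K (LieDerivation K L L)).comp ((LieDerivation.ad K L).comp iK)
    have hin : ∀ (l : L) (E : LieDerivation K L L),
        ⁅LieDerivation.ad K L l, E⁆ ∈ LinearMap.range (LieDerivation.ad K L).toLinearMap := by
      intro l E
      refine ⟨-E l, ?_⟩
      rw [← lie_skew, LieDerivation.lie_der_ad_eq_ad_der]
      exact map_neg (LieDerivation.ad K L) _
    obtain ⟨D₁, -, D₂, hD₂, e, hD₁⟩ := σ'.exists_invariant_add_actSpan ⊤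
      (fun _ _ _ => trivial) (w := D) trivial
    obtain ⟨l₂, rfl⟩ := σ'.actSpan_le (fun x E _ => hin (iS x) E) hD₂
    let W : Submodule K (LieDerivation K L L) := ⨅ x, LinearMap.ker (σ' x)
    have hW : ∀ E, E ∈ W ↔ ∀ x, ⁅LieDerivation.ad K L (iS x), E⁆ = 0 := by
      intro E; simp [W, σ']
    have hWκ : ∀ y, ∀ E ∈ W, κ' y E ∈ W := by
      intro y E hE
      rw [hW] at hE ⊢
      intro x
      show ⁅LieDerivation.ad K L (iS x), ⁅LieDerivation.ad K L (iK y), E⁆⁆ = 0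
      rw [leibniz_lie, hE, lie_zero, add_zero, ← LieHom.map_lie, hSK, map_zero, zero_lie]
    obtain ⟨D₃, hD₃, D₄, hD₄, e', i, hi⟩ := κ'.exists_nilSeries_add_actSpan W hWκ
      ((hW D₁).2 hD₁)
    obtain ⟨l₄, rfl⟩ := κ'.actSpan_le (fun y E _ => hin (iK y) E) hD₄
    refine ⟨l₄ + l₂, D₃, ?_, (hW D₃).1 hD₃, i, hi⟩
    rw [e, e', map_add, ← add_assoc]
    rfl
  have hDS : ∀ x l, D' ⁅iS x, l⁆ = ⁅iS x, D' l⁆ := by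
    intro x l
    have := LieDerivation.congr_fun (hDs x) l
    rw [LieDerivation.commutator_apply] at this
    simp only [LieDerivation.ad_apply_apply, LieDerivation.zero_apply] at this
    exact (sub_eq_zero.1 this).symm
  have hD0 : ∀ x, D' (iS x) = 0 := by
    intro x
    refine LieAlgebra.ad_injective_of_center_eq_bot hL fun l => ?_
    have := D'.apply_lie_eq_add (iS x) l
    rw [hDS] at this
    simpa using this
  have hDK : ∀ y, D' (iK y) ∈ N := by
    intro y
    have hinv : ∀ x, ⁅iS x, D' (iK y)⁆ = 0 := fun x => by rw [← hDS, hSK, map_zero]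
    have hup : ∀ i (l : L), LieDerivation.ad K L l ∈ ((LieAlgebra.ad K (LieDerivation K L L)).comp
        ((LieDerivation.ad K L).comp iK)).nilSeries i → l ∈ κ.nilSeries i := by
      intro i
      induction i with
      | zero => intro l hl; exact hcen l hl
      | succ i ih =>
        intro l hl
        rw [LieHom.mem_nilSeries_succ] at hl ⊢
        intro x
        refine ih _ ?_
        have := hl x
        rwa [LieHom.comp_apply, LieHom.comp_apply, LieAlgebra.ad_apply, ← LieHom.map_lie] at this
    refine hnull i _ hinv (hup i _ ?_)
    cases i with
    | zero =>
      have : D' = 0 := hDi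
      rw [this, LieDerivation.zero_apply, map_zero]
      exact zero_mem _
    | succ i =>
      have := (LieHom.mem_nilSeries_succ _).1 hDi y
      rw [LieHom.comp_apply, LieHom.comp_apply, LieAlgebra.ad_apply, ← lie_skew,
        LieDerivation.lie_der_ad_eq_ad_der] at this
      exact LieHom.nilSeries_mono _ (Nat.le_succ i)
        (neg_mem_iff.1 this)
  have hDN : ∀ n ∈ N, D' n ∈ N := by
    have key : ∀ i, ∀ n ∈ N, n ∈ κ.nilSeries i → D' n ∈ N := by
      intro i
      induction i with
      | zero =>
        intro n _ hn
        have : n = 0 := hn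
        rw [this, map_zero]
        exact zero_mem _
      | succ i ih =>
        intro n hn hni
        refine hnull (j + 1) _ (fun x => by rw [← hDS, hSN x n hn, map_zero]) ?_
        rw [LieHom.mem_nilSeries_succ]
        intro y
        have h1 : κ y (D' n) = D' ⁅iK y, n⁆ - ⁅D' (iK y), n⁆ := by
          rw [D'.apply_lie_eq_add, hκ]; abel
        rw [h1]
        exact hnil (sub_mem (ih _ (hNN _ (hKN y) n hn) ((LieHom.mem_nilSeries_succ _).1 hni y))
          (hNN _ (hDK y) n hn))
    exact fun n hn => key j n hn (hnil hn)
  refine ⟨l, D', hD, hD0, hDN, ?_⟩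
  have hqD : ∀ z ∈ M, q (D' z) = 0 := fun z hz =>
    D'.apply_eq_zero_of_isSolvable q (fun x => ⟨iS x, hqS x⟩) I hqI (hMI z hz)
  have hDz : ∀ z ∈ M, ∃ w ∈ M, D' z = p (D' z) + w ∧ p (D' z) ∈ N := by
    intro z hz
    obtain ⟨a, n, hn, w, hw, e⟩ := hdec (D' z)
    have ha : a = 0 := by
      have := hqD z hz
      rwa [e, map_add, map_add, hqS, hqN n hn, hqM w hw, add_zero, add_zero] at this
    rw [ha, map_zero, zero_add] at e
    have hp : p (D' z) = n := by rw [e, map_add, hpN n hn, hpM w hw, add_zero]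
    exact ⟨w, hw, by rw [hp, e], by rw [hp]; exact hn⟩
  -- the `N`-component of `D'` on `M` is `k`-equivariant and kills `[s, M]`
  let U : Submodule K L := M.map (p ∘ₗ D'.toLinearMap)
  have hU : ∀ z ∈ M, p (D' z) ∈ U := fun z hz => ⟨z, hz, rfl⟩
  have hU0 : U = ⊥ := by
    refine κ.eq_bot_of_le_actSpan (j := j) ?_ ?_
    · rintro _ ⟨z, hz, rfl⟩
      obtain ⟨w, -, -, hN⟩ := hDz z hz
      exact hnil hN
    · have hle : M ≤ (κ.actSpan U).comap (p ∘ₗ D'.toLinearMap) := by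
        refine hM.trans (sup_le (LieHom.actSpan_le _ fun x z hz => ?_)
          (LieHom.actSpan_le _ fun y z hz => ?_))
        · show p (D' ⁅iS x, z⁆) ∈ κ.actSpan U
          obtain ⟨w, hw, e, hN⟩ := hDz z hz
          rw [hDS, e, lie_add, hSN x _ hN, zero_add, hpM _ (hSM x w hw)]
          exact zero_mem _
        · show p (D' ⁅iK y, z⁆) ∈ κ.actSpan U
          obtain ⟨w, hw, e, hN⟩ := hDz z hz
          rw [D'.apply_lie_eq_add, map_add, hpM _ (hNM _ (hDK y) z hz), add_zero, e, lie_add,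
            map_add, hpM _ (hNM _ (hKN y) w hw), add_zero, hpN _ (hNN _ (hKN y) _ hN)]
          exact κ.act_mem_actSpan y (hU z hz)
      exact Submodule.map_le_iff_le_comap.2 hle
  intro z hz
  obtain ⟨w, hw, e, -⟩ := hDz z hz
  have h0 := hU z hz
  rw [hU0, Submodule.mem_bot] at h0
  rw [e, h0, zero_add]
  exact hw

/-! ### The algebra `B` and the law `Φ` -/

namespace IsGammaTriple

variable {K : Type u} [Field K] {g : Type v} [LieRing g] [LieAlgebra K g]
    [FiniteDimensional K g] {Γ : LieSubalgebra K (Module.End K g)}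
    {s k : LieSubalgebra K g} {m : Submodule K g}

theorem mu_apply (h : IsGammaTriple Γ s k m) (y : k) (z : m) :
    (h.mu y z : g) = ⁅(y : g), (z : g)⁆ := rfl

theorem sigma_apply (h : IsGammaTriple Γ s k m) (x : s) (z : m) :
    (h.sigma x z : g) = ⁅(x : g), (z : g)⁆ := rfl

theorem projK_of_mem (h : IsGammaTriple Γ s k m) {x : g} (hx : x ∈ k) : (h.projK x : g) = x := by
  have := Submodule.projectionOnto_apply_left h.isCompl_k ⟨x, hx⟩
  exact congrArg Subtype.val this

theorem projK_of_mem_m (h : IsGammaTriple Γ s k m) {x : g} (hx : x ∈ m) : h.projK x = 0 :=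
  Submodule.projectionOnto_apply_right h.isCompl_k ⟨x, Submodule.mem_sup_right hx⟩

theorem projK_of_mem_s (h : IsGammaTriple Γ s k m) {x : g} (hx : x ∈ s) : h.projK x = 0 :=
  Submodule.projectionOnto_apply_right h.isCompl_k ⟨x, Submodule.mem_sup_left hx⟩

theorem projM_of_mem (h : IsGammaTriple Γ s k m) {x : g} (hx : x ∈ m) : (h.projM x : g) = x := by
  have := Submodule.projectionOnto_apply_left h.isCompl_m ⟨x, hx⟩
  exact congrArg Subtype.val this

theorem projM_of_mem_k (h : IsGammaTriple Γ s k m) {x : g} (hx : x ∈ k) : h.projM x = 0 :=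
  Submodule.projectionOnto_apply_right h.isCompl_m ⟨x, Submodule.mem_sup_right hx⟩

theorem projM_of_mem_s (h : IsGammaTriple Γ s k m) {x : g} (hx : x ∈ s) : h.projM x = 0 :=
  Submodule.projectionOnto_apply_right h.isCompl_m ⟨x, Submodule.mem_sup_left hx⟩

theorem projK_add_projM (h : IsGammaTriple Γ s k m) {x : g} (hx : x ∈ LieAlgebra.radical K g) :
    (h.projK x : g) + (h.projM x : g) = x := by
  have hx' : x ∈ k.toSubmodule ⊔ m := by rw [h.sup_eq]; exact hx
  obtain ⟨c, hc, d, hd, rfl⟩ := Submodule.mem_sup.1 hx'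
  rw [map_add, map_add, h.projK_of_mem_m hd, h.projM_of_mem_k hc, add_zero, zero_add,
    h.projK_of_mem hc, h.projM_of_mem hd]

theorem lie_mem_radical (h : IsGammaTriple Γ s k m) (x : g) {z : g} (hz : z ∈ m) :
    ⁅x, z⁆ ∈ LieAlgebra.radical K g :=
  lie_mem_right K g _ x z (h.m_le_radical hz)

theorem projK_lie_add_projM_lie (h : IsGammaTriple Γ s k m) (z z' : m) :
    (h.projK ⁅(z : g), (z' : g)⁆ : g) + (h.projM ⁅(z : g), (z' : g)⁆ : g) = ⁅(z : g), (z' : g)⁆ :=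
  h.projK_add_projM (h.lie_mem_radical _ z'.2)

theorem apply_mem_lieSpan (h : IsGammaTriple Γ s k m) {γ : Module.End K g} (hγ : γ ∈ Γ) {x : g}
    (hx : x ∈ LieSubalgebra.lieSpan K g (m : Set g)) :
    γ x ∈ LieSubalgebra.lieSpan K g (m : Set g) := by
  induction hx using LieSubalgebra.lieSpan_induction with
  | mem x hx => exact LieSubalgebra.subset_lieSpan (h.apply_mem_m hγ (h.m_le_radical hx))
  | zero => rw [map_zero]; exact zero_mem _
  | add x y _ _ hx hy => rw [map_add]; exact add_mem hx hy
  | smul c x _ hx => rw [map_smul]; exact SMulMemClass.smul_mem _ hx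
  | lie x y hx' hy' hx hy =>
    rw [h.apply_lie hγ]
    exact add_mem (LieSubalgebra.lie_mem _ hx hy') (LieSubalgebra.lie_mem _ hx' hy)

theorem lieSpan_le_radical (h : IsGammaTriple Γ s k m) {x : g}
    (hx : x ∈ LieSubalgebra.lieSpan K g (m : Set g)) : x ∈ LieAlgebra.radical K g := by
  have : LieSubalgebra.lieSpan K g (m : Set g) ≤ (LieAlgebra.radical K g).toLieSubalgebra :=
    LieSubalgebra.lieSpan_le.2 fun z hz => h.m_le_radical hz
  exact this hx

/-- A derivation of the algebra generated by `m` which commutes with `Γ` preserves the intersection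
of this algebra with `k`, the space of invariants of `Γ`. -/
theorem derivation_apply_mem_k (h : IsGammaTriple Γ s k m)
    {δ : LieDerivation K (LieSubalgebra.lieSpan K g (m : Set g))
      (LieSubalgebra.lieSpan K g (m : Set g))}
    (hδ : ∀ γ ∈ Γ, ∀ x y : LieSubalgebra.lieSpan K g (m : Set g),
      (y : g) = γ (x : g) → (δ y : g) = γ (δ x : g))
    {x : LieSubalgebra.lieSpan K g (m : Set g)} (hx : (x : g) ∈ k) : (δ x : g) ∈ k := by
  rw [h.mem_k] at hx ⊢
  intro γ hγ
  rw [← hδ γ hγ x 0 (by rw [hx γ hγ]; rfl), map_zero]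
  rfl

theorem mu_range_le_algB (h : IsGammaTriple Γ s k m) : h.mu.range ≤ algB Γ m := by
  rintro _ ⟨y, rfl⟩
  have hy : ∀ z ∈ LieSubalgebra.lieSpan K g (m : Set g),
      ⁅(y : g), z⁆ ∈ LieSubalgebra.lieSpan K g (m : Set g) := by
    intro z hz
    induction hz using LieSubalgebra.lieSpan_induction with
    | mem x hx => exact LieSubalgebra.subset_lieSpan (h.k_lie_mem y.2 hx)
    | zero => rw [lie_zero]; exact zero_mem _
    | add x y _ _ hx hy => rw [lie_add]; exact add_mem hx hy
    | smul c x _ hx => rw [lie_smul]; exact SMulMemClass.smul_mem _ hx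
    | lie x y hx' hy' hx hy =>
      rw [leibniz_lie]
      exact add_mem (LieSubalgebra.lie_mem _ hx hy') (LieSubalgebra.lie_mem _ hx' hy)
  let δ : LieDerivation K (LieSubalgebra.lieSpan K g (m : Set g))
      (LieSubalgebra.lieSpan K g (m : Set g)) :=
    { toFun := fun z => ⟨⁅(y : g), (z : g)⁆, hy z z.2⟩
      map_add' := fun a b => Subtype.ext (by simp)
      map_smul' := fun a b => Subtype.ext (by simp)
      leibniz' := fun a b => Subtype.ext (by
        show ⁅(y : g), ⁅(a : g), (b : g)⁆⁆
          = ⁅(a : g), ⁅(y : g), (b : g)⁆⁆ - ⁅(b : g), ⁅(y : g), (a : g)⁆⁆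
        rw [leibniz_lie, ← lie_skew (b : g), sub_neg_eq_add, add_comm]) }
  refine ⟨δ, fun γ hγ a b e => ?_, fun z => rfl⟩
  show ⁅(y : g), (b : g)⁆ = γ ⁅(y : g), (a : g)⁆
  rw [h.apply_lie hγ, (h.mem_k y).1 y.2 γ hγ, zero_lie, zero_add, e]

/-- The elements of `B` commute with the action of `s`. -/
theorem algB_apply_sigma (h : IsGammaTriple Γ s k m) {d : Module.End K m} (hd : d ∈ algB Γ m)
    (x : s) (z : m) : d (h.sigma x z) = h.sigma x (d z) := by
  obtain ⟨δ, h1, h2⟩ := hd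
  refine Subtype.ext ?_
  rw [← h2, h1 _ (h.ad_s_le x x.2) ⟨z, LieSubalgebra.subset_lieSpan z.2⟩ _ rfl, h2]
  rfl

/-- If `d` is the restriction to `m` of a derivation `δ` commuting with `Γ`, then
`[d, μ(c)] = μ(δ c)`. -/
theorem lie_mu_eq (h : IsGammaTriple Γ s k m) {d : Module.End K m}
    {δ : LieDerivation K (LieSubalgebra.lieSpan K g (m : Set g))
      (LieSubalgebra.lieSpan K g (m : Set g))}
    (h2 : ∀ z : m, (δ ⟨(z : g), LieSubalgebra.subset_lieSpan z.2⟩ : g) = (d z : g))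
    {c : LieSubalgebra.lieSpan K g (m : Set g)} (hc : (c : g) ∈ k) (hδc : (δ c : g) ∈ k) :
    ⁅d, h.mu ⟨c, hc⟩⁆ = h.mu ⟨δ c, hδc⟩ := by
  ext z
  have e1 := h2 (h.mu ⟨c, hc⟩ z)
  have e2 : (⟨(h.mu ⟨c, hc⟩ z : g), LieSubalgebra.subset_lieSpan (h.mu ⟨c, hc⟩ z).2⟩ :
      LieSubalgebra.lieSpan K g (m : Set g)) = ⁅c, ⟨(z : g), LieSubalgebra.subset_lieSpan z.2⟩⁆ :=
    rfl
  rw [e2, δ.apply_lie_eq_add] at e1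
  have e3 : ⁅(c : g), (d z : g)⁆ + ⁅(δ c : g), (z : g)⁆ = (d (h.mu ⟨c, hc⟩ z) : g) := by
    rw [← h2, ← e1]; rfl
  rw [Ring.lie_def]
  show (d (h.mu ⟨c, hc⟩ z) : g) - ⁅(c : g), (d z : g)⁆ = ⁅(δ c : g), (z : g)⁆
  rw [← e3, add_sub_cancel_left]

/-- The components of `[m, m]` in `k` and `m` are respected by the elements of `B`. -/
theorem algB_lie_mu_projK_and (h : IsGammaTriple Γ s k m) {d : Module.End K m}
    (hd : d ∈ algB Γ m) (z z' : m) :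
    ⁅d, h.mu (h.projK ⁅(z : g), (z' : g)⁆)⁆ = h.mu (h.projK ⁅(d z : g), (z' : g)⁆)
        + h.mu (h.projK ⁅(z : g), (d z' : g)⁆) ∧
      d (h.projM ⁅(z : g), (z' : g)⁆) = h.projM ⁅(d z : g), (z' : g)⁆
        + h.projM ⁅(z : g), (d z' : g)⁆ := by
  obtain ⟨δ, h1, h2⟩ := hd
  let j : m → LieSubalgebra.lieSpan K g (m : Set g) := fun z =>
    ⟨(z : g), LieSubalgebra.subset_lieSpan z.2⟩
  have hz := h.projK_lie_add_projM_lie z z'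
  have hc : (h.projK ⁅(z : g), (z' : g)⁆ : g) ∈ LieSubalgebra.lieSpan K g (m : Set g) := by
    rw [eq_sub_of_add_eq hz]
    exact sub_mem (LieSubalgebra.lie_mem _ (j z).2 (j z').2) (j _).2
  have hδ := h.derivation_apply_mem_k h1 (x := ⟨_, hc⟩) (h.projK ⁅(z : g), (z' : g)⁆).2
  have e : (⟨_, hc⟩ : LieSubalgebra.lieSpan K g (m : Set g)) + j (h.projM ⁅(z : g), (z' : g)⁆)
      = ⁅j z, j z'⁆ := Subtype.ext hz
  have e1 := congrArg (fun x => (δ x : g)) e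
  have e2 : (δ ⟨_, hc⟩ : g) + (d (h.projM ⁅(z : g), (z' : g)⁆) : g)
      = ⁅(d z : g), (z' : g)⁆ + ⁅(z : g), (d z' : g)⁆ := by
    rw [← h2, ← h2 z, ← h2 z', add_comm ⁅_, (z' : g)⁆]
    simpa [δ.apply_lie_eq_add] using e1
  constructor
  · rw [← map_add, ← map_add, ← e2, map_add, h.projK_of_mem_m (d _).2, add_zero]
    rw [h.lie_mu_eq (c := ⟨_, hc⟩) h2 (h.projK ⁅(z : g), (z' : g)⁆).2 hδ]
    exact congrArg _ (Subtype.ext (h.projK_of_mem hδ).symm)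
  · rw [← map_add, ← e2, map_add, h.projM_of_mem_k hδ, zero_add]
    exact Subtype.ext (h.projM_of_mem (d _).2).symm

/-- The components of `[m, m]` in `k` and `m` are respected by the action of `s`. -/
theorem sigma_lie_mu_projK_and (h : IsGammaTriple Γ s k m) (x : s) (z z' : m) :
    h.mu (h.projK ⁅(h.sigma x z : g), (z' : g)⁆)
        + h.mu (h.projK ⁅(z : g), (h.sigma x z' : g)⁆) = 0 ∧
      h.sigma x (h.projM ⁅(z : g), (z' : g)⁆) = h.projM ⁅(h.sigma x z : g), (z' : g)⁆
        + h.projM ⁅(z : g), (h.sigma x z' : g)⁆ := by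
  have hz := congrArg (fun y => ⁅(x : g), y⁆) (h.projK_lie_add_projM_lie z z')
  simp only [lie_add, h.lie_s_k _ x.2 _ (h.projK ⁅(z : g), (z' : g)⁆).2, zero_add] at hz
  rw [leibniz_lie, ← h.sigma_apply, ← h.sigma_apply, ← h.sigma_apply] at hz
  constructor
  · rw [← map_add, ← map_add, ← hz, h.projK_of_mem_m (Subtype.prop _), map_zero]
  · rw [← map_add, ← hz]
    exact Subtype.ext (h.projM_of_mem (Subtype.prop _)).symm

/-- The Jacobi identity of `m`, split into its components in `k` and `m`. -/
theorem jacobi_m (h : IsGammaTriple Γ s k m) (z₁ z₂ z₃ : m) :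
    h.projK ⁅(z₁ : g), (h.projM ⁅(z₂ : g), (z₃ : g)⁆ : g)⁆
        = h.projK ⁅(h.projM ⁅(z₁ : g), (z₂ : g)⁆ : g), (z₃ : g)⁆
          + h.projK ⁅(z₂ : g), (h.projM ⁅(z₁ : g), (z₃ : g)⁆ : g)⁆ ∧
      h.projM ⁅(z₁ : g), (h.projM ⁅(z₂ : g), (z₃ : g)⁆ : g)⁆
          - h.mu (h.projK ⁅(z₂ : g), (z₃ : g)⁆) z₁
        = h.projM ⁅(h.projM ⁅(z₁ : g), (z₂ : g)⁆ : g), (z₃ : g)⁆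
          + h.mu (h.projK ⁅(z₁ : g), (z₂ : g)⁆) z₃
          + h.projM ⁅(z₂ : g), (h.projM ⁅(z₁ : g), (z₃ : g)⁆ : g)⁆
          - h.mu (h.projK ⁅(z₁ : g), (z₃ : g)⁆) z₂ := by
  have hz := leibniz_lie (z₁ : g) (z₂ : g) (z₃ : g)
  rw [← h.projK_lie_add_projM_lie z₂ z₃, ← h.projK_lie_add_projM_lie z₁ z₂,
    ← h.projK_lie_add_projM_lie z₁ z₃, lie_add, add_lie, lie_add,
    ← lie_skew (z₁ : g) (h.projK _ : g), ← lie_skew (z₂ : g) (h.projK _ : g), ← h.mu_apply,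
    ← h.mu_apply, ← h.mu_apply] at hz
  constructor
  · have := congrArg h.projK hz
    simpa only [map_add, map_neg, h.projK_of_mem_m (Subtype.prop _), neg_zero, zero_add] using this
  · have := congrArg h.projM hz
    have e : ∀ z : m, h.projM (z : g) = z := fun z => Subtype.ext (h.projM_of_mem z.2)
    simp only [map_add, map_neg, e] at this
    rw [sub_eq_add_neg, add_comm, this]
    abel

theorem law_apply (h : IsGammaTriple Γ s k m) (a b : s × Module.End K m × m) :
    h.law a b = (⁅a.1, b.1⁆, ⁅a.2.1, b.2.1⁆ + h.mu (h.projK ⁅(a.2.2 : g), (b.2.2 : g)⁆),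
       h.sigma a.1 b.2.2 - h.sigma b.1 a.2.2 + a.2.1 b.2.2 - b.2.1 a.2.2
         + h.projM ⁅(a.2.2 : g), (b.2.2 : g)⁆) := rfl

theorem isLieOn_gammaSum (h : IsGammaTriple Γ s k m) {N : LieSubalgebra K (Module.End K m)}
    (hμ : h.mu.range ≤ N) (hN : N ≤ algB Γ m) : IsLieOn h.law (gammaSum s N) where
  mem := by
    rintro ⟨x, y, z⟩ ⟨-, hy, -⟩ ⟨x', y', z'⟩ ⟨-, hy', -⟩
    exact ⟨trivial, add_mem (N.lie_mem hy hy') (hμ ⟨_, rfl⟩), trivial⟩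
  self := by
    rintro ⟨x, y, z⟩ -
    simp [law]
  leibniz := by
    rintro ⟨x₁, y₁, z₁⟩ ⟨-, hy₁, -⟩ ⟨x₂, y₂, z₂⟩ ⟨-, hy₂, -⟩ ⟨x₃, y₃, z₃⟩ ⟨-, hy₃, -⟩
    have e1 := fun y (hy : y ∈ N) z z' => (h.algB_lie_mu_projK_and (hN hy) z z').1
    have e2 := fun y (hy : y ∈ N) z z' => (h.algB_lie_mu_projK_and (hN hy) z z').2
    have e3 := fun x z z' => eq_neg_of_add_eq_zero_left (h.sigma_lie_mu_projK_and x z z').1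
    have e4 := fun x z z' => (h.sigma_lie_mu_projK_and x z z').2
    have e5 := (h.jacobi_m z₁ z₂ z₃).1
    have e6 := (h.jacobi_m z₁ z₂ z₃).2
    have e7 := fun y (hy : y ∈ N) x z => h.algB_apply_sigma (hN hy) x z
    have e8 : ∀ z z' : m, ⁅(z : g), (z' : g)⁆ = - ⁅(z' : g), (z : g)⁆ := fun z z' =>
      (lie_skew _ _).symm
    have e9 : ∀ (x x' : s) (z : m), h.sigma ⁅x, x'⁆ z
        = h.sigma x (h.sigma x' z) - h.sigma x' (h.sigma x z) := fun x x' z => by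
      rw [LieHom.map_lie, Ring.lie_def]; rfl
    have e10 : ∀ (y y' : Module.End K m) (z : m), ⁅y, y'⁆ z = y (y' z) - y' (y z) :=
      fun y y' z => by rw [Ring.lie_def]; rfl
    have e11 : ∀ y ∈ N, ∀ z z' : m, ⁅h.mu (h.projK ⁅(z : g), (z' : g)⁆), y⁆
        = - (h.mu (h.projK ⁅(y z : g), (z' : g)⁆) + h.mu (h.projK ⁅(z : g), (y z' : g)⁆)) :=
      fun y hy z z' => by rw [← lie_skew, e1 y hy]
    refine Prod.ext ?_ (Prod.ext ?_ ?_)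
    · exact leibniz_lie x₁ x₂ x₃
    · simp only [law_apply, Prod.snd_add, Prod.fst_add, lie_add, add_lie, Submodule.coe_add,
        Submodule.coe_sub, lie_sub, sub_lie, map_add, map_sub, e1 _ hy₁, e1 _ hy₂, e11 _ hy₃,
        e3, e5]
      rw [e8 z₂ (h.sigma x₃ z₁), e8 z₂ (y₃ z₁), leibniz_lie y₁ y₂ y₃]
      simp only [map_neg, e3]
      abel
    · simp only [law_apply, Prod.snd_add, lie_add, add_lie, Submodule.coe_add,
        Submodule.coe_sub, lie_sub, sub_lie, map_add, map_sub, e2 _ hy₁, e2 _ hy₂,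
        e2 _ hy₃, e4, e7 _ hy₁, e7 _ hy₂, e7 _ hy₃, e9, e10, LinearMap.add_apply]
      rw [eq_add_of_sub_eq e6, e8 z₂ (h.sigma x₃ z₁), e8 z₂ (y₃ z₁)]
      simp only [map_neg]
      abel

end IsGammaTriple

/-! ### The Lie algebras `s ⊕ N ⊕ m` -/

/-- The adjoint action of a nilpotent Lie algebra is nilpotent. -/
theorem LieHom.exists_nilSeries_eq_top_of_isNilpotent {K k : Type*} [Field K] [LieRing k]
    [LieAlgebra K k] [LieRing.IsNilpotent k] : ∃ j, (LieAlgebra.ad K k).nilSeries j = ⊤ := by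
  obtain ⟨j, hj⟩ := (LieModule.isNilpotent_iff K k k).1 inferInstance
  have key : ∀ i ≤ j, ∀ v ∈ LieModule.lowerCentralSeries K k k (j - i),
      v ∈ (LieAlgebra.ad K k).nilSeries i := by
    intro i
    induction i with
    | zero =>
      intro _ v hv
      rwa [Nat.sub_zero, hj, LieSubmodule.mem_bot] at hv
    | succ i ih =>
      intro hi v hv
      rw [LieHom.mem_nilSeries_succ]
      intro x
      refine ih (by omega) _ ?_
      rw [show j - i = j - (i + 1) + 1 by omega, LieModule.lowerCentralSeries_succ]
      exact LieSubmodule.lie_mem_lie trivial hv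
  refine ⟨j, _root_.eq_top_iff.2 fun v _ => key j le_rfl v ?_⟩
  rw [Nat.sub_self]
  trivial

theorem LieHom.map_mem_nilSeries {K L V W : Type*} [Field K] [LieRing L] [LieAlgebra K L]
    [AddCommGroup V] [Module K V] [AddCommGroup W] [Module K W] {ρ : L →ₗ⁅K⁆ Module.End K V}
    {τ : L →ₗ⁅K⁆ Module.End K W} (f : V →ₗ[K] W) (hf : ∀ x v, f (ρ x v) = τ x (f v)) {j : ℕ}
    {v : V} (hv : v ∈ ρ.nilSeries j) : f v ∈ τ.nilSeries j := by
  induction j generalizing v with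
  | zero => rw [show v = 0 from hv, map_zero]; exact zero_mem _
  | succ j ih =>
    rw [LieHom.mem_nilSeries_succ] at hv ⊢
    intro x
    rw [← hf]
    exact ih (hv x)

theorem iterNormalizer_le {K L : Type*} [Field K] [LieRing L] [LieAlgebra K L]
    {B A : LieSubalgebra K L} (hAB : A ≤ B) (n : ℕ) : iterNormalizer B A n ≤ B := by
  cases n with
  | zero => exact hAB
  | succ n => exact inf_le_left

theorem lie_mem_iterNormalizer {K L : Type*} [Field K] [LieRing L] [LieAlgebra K L]
    {B A : LieSubalgebra K L} {n : ℕ} {x y : L} (hx : x ∈ iterNormalizer B A (n + 1))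
    (hy : y ∈ iterNormalizer B A n) : ⁅x, y⁆ ∈ iterNormalizer B A n :=
  (LieSubalgebra.mem_normalizer_iff _ _).1 hx.2 y hy

theorem iterNormalizer_mono {K L : Type*} [Field K] [LieRing L] [LieAlgebra K L]
    {B A : LieSubalgebra K L} (hAB : A ≤ B) : Monotone (iterNormalizer B A) :=
  monotone_nat_of_le_succ fun n => le_inf (iterNormalizer_le hAB n) (LieSubalgebra.le_normalizer _)

theorem iterNormalizer_eq_of_le {K L : Type*} [Field K] [LieRing L] [LieAlgebra K L]
    {B A : LieSubalgebra K L} {q : ℕ} (hq : iterNormalizer B A (q + 1) = iterNormalizer B A q)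
    {n : ℕ} (hn : q ≤ n) : iterNormalizer B A n = iterNormalizer B A q := by
  induction n, hn using Nat.le_induction with
  | base => rfl
  | succ n _ ih => rw [← hq]; show B ⊓ _ = B ⊓ _; rw [ih]

theorem exists_iterNormalizer_succ_eq {K L : Type*} [Field K] [LieRing L] [LieAlgebra K L]
    [Module.Finite K L] {B A : LieSubalgebra K L} (hAB : A ≤ B) :
    ∃ q, iterNormalizer B A (q + 1) = iterNormalizer B A q := by
  obtain ⟨q, hq⟩ := WellFoundedGT.monotone_chain_condition
    (⟨iterNormalizer B A, iterNormalizer_mono hAB⟩ : ℕ →o LieSubalgebra K L)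
  exact ⟨q, (hq (q + 1) (Nat.le_succ q)).symm⟩

namespace IsGammaTriple

variable {K : Type u} [Field K] {g : Type v} [LieRing g] [LieAlgebra K g]
    [FiniteDimensional K g] {Γ : LieSubalgebra K (Module.End K g)}
    {s k : LieSubalgebra K g} {m : Submodule K g}

/-- The kernel of `μ` is an ideal of the nilpotent `k`, and its elements which are central in `k`
are central in `g`. -/
theorem mu_injective (h : IsGammaTriple Γ s k m) (hc : LieAlgebra.center K g = ⊥) :
    Function.Injective h.mu := by
  have := h.nilpotent
  obtain ⟨j, hj⟩ := LieHom.exists_nilSeries_eq_top_of_isNilpotent (K := K) (k := k)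
  have key : ∀ i, ∀ y ∈ (LieAlgebra.ad K k).nilSeries i, h.mu y = 0 → y = 0 := by
    intro i
    induction i with
    | zero => intro y hy _; exact hy
    | succ i ih =>
      intro y hy h0
      rw [LieHom.mem_nilSeries_succ] at hy
      -- the kernel of `μ` is an ideal of `k`
      have h1 : ∀ x : k, ⁅x, y⁆ = 0 := fun x =>
        ih _ (hy x) (by rw [LieHom.map_lie, h0, lie_zero])
      refine Subtype.ext (LieAlgebra.ad_injective_of_center_eq_bot hc fun x => ?_)
      obtain ⟨a, b, c, rfl⟩ := h.exists_add_add x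
      have h2 : ⁅(y : g), (a : g)⁆ = 0 := by rw [← lie_skew, h.lie_s_k _ a.2 _ y.2, neg_zero]
      have h3 : ⁅(y : g), (b : g)⁆ = 0 := by
        rw [← lie_skew]
        exact neg_eq_zero.2 (congrArg Subtype.val (h1 b))
      have h4 : ⁅(y : g), (c : g)⁆ = 0 := congrArg Subtype.val (LinearMap.congr_fun h0 c)
      rw [lie_add, lie_add, h2, h3, h4, add_zero, add_zero]
  refine (injective_iff_map_eq_zero _).2 fun y hy => key j y ?_ hy
  rw [hj]; trivial

/-- The canonical map `s ⊕ k ⊕ m → s ⊕ gl(m) ⊕ m`, `x + y + z ↦ (x, μ(y), z)`. -/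
noncomputable def emb (h : IsGammaTriple Γ s k m) : g →ₗ[K] s × Module.End K m × m :=
  (s.projOfIsCompl (LieAlgebra.radical K g) h.levi : g →ₗ[K] s).prod
    (((h.mu : k →ₗ[K] Module.End K m) ∘ₗ h.projK).prod h.projM)

theorem emb_add_add (h : IsGammaTriple Γ s k m) (x : s) (y : k) (z : m) :
    h.emb (x + y + z) = (x, h.mu y, z) := by
  refine Prod.ext ?_ (Prod.ext ?_ ?_)
  · show s.projOfIsCompl _ h.levi _ = x
    rw [add_assoc]
    exact s.projOfIsCompl_add _ h.levi x
      (add_mem (h.k_le_radical y.2) (h.m_le_radical z.2))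
  · show h.mu (h.projK _) = h.mu y
    refine congrArg h.mu ?_
    rw [map_add, map_add, h.projK_of_mem_s x.2, h.projK_of_mem_m z.2, zero_add, add_zero]
    exact Subtype.ext (h.projK_of_mem y.2)
  · show h.projM _ = z
    rw [map_add, map_add, h.projM_of_mem_s x.2, h.projM_of_mem_k y.2, zero_add, zero_add]
    exact Subtype.ext (h.projM_of_mem z.2)

theorem emb_lie (h : IsGammaTriple Γ s k m) (a b : g) :
    h.emb ⁅a, b⁆ = h.law (h.emb a) (h.emb b) := by
  obtain ⟨x, y, z, rfl⟩ := h.exists_add_add a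
  obtain ⟨x', y', z', rfl⟩ := h.exists_add_add b
  have e : ⁅(x : g) + y + z, (x' : g) + y' + z'⁆
      = (⁅x, x'⁆ : s) + ((⁅y, y'⁆ + h.projK ⁅(z : g), (z' : g)⁆ : k) : g)
        + ((h.sigma x z' - h.sigma x' z + h.mu y z' - h.mu y' z
          + h.projM ⁅(z : g), (z' : g)⁆ : m) : g) := by
    have e0 := h.projK_lie_add_projM_lie z z'
    rw [AddMemClass.coe_add, Submodule.coe_add, add_comm _ (h.projM _ : g)]
    generalize (h.projM ⁅(z : g), (z' : g)⁆ : g) = w at e0 ⊢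
    generalize (h.projK ⁅(z : g), (z' : g)⁆ : g) = c at e0 ⊢
    simp only [lie_add, add_lie, Submodule.coe_add, Submodule.coe_sub, mu_apply, sigma_apply]
    rw [← e0, h.lie_s_k _ x.2 _ y'.2, ← lie_skew (y : g) (x' : g),
      h.lie_s_k _ x'.2 _ y.2, ← lie_skew (z : g) (x' : g), ← lie_skew (z : g) (y' : g)]
    push_cast
    abel
  rw [e, emb_add_add, emb_add_add, emb_add_add, law_apply, map_add, LieHom.map_lie]

theorem emb_injective (h : IsGammaTriple Γ s k m) (hc : LieAlgebra.center K g = ⊥) :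
    Function.Injective h.emb := by
  refine (injective_iff_map_eq_zero _).2 fun a ha => ?_
  obtain ⟨x, y, z, rfl⟩ := h.exists_add_add a
  rw [emb_add_add] at ha
  have h1 : x = 0 := congrArg Prod.fst ha
  have h2 : h.mu y = 0 := congrArg (fun a => a.2.1) ha
  have h3 : z = 0 := congrArg (fun a => a.2.2) ha
  rw [h1, (injective_iff_map_eq_zero _).1 (h.mu_injective hc) y h2, h3]
  simp

theorem emb_mem (h : IsGammaTriple Γ s k m) {N : LieSubalgebra K (Module.End K m)}
    (hμ : h.mu.range ≤ N) (a : g) : h.emb a ∈ gammaSum s N :=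
  ⟨trivial, hμ ⟨_, rfl⟩, trivial⟩

theorem le_sup_actSpan (h : IsGammaTriple Γ s k m) : m ≤ ((LieAlgebra.ad K g).comp s.incl).actSpan m
    ⊔ ((LieAlgebra.ad K g).comp k.incl).actSpan m := by
  intro z hz
  rw [← h.lie_m] at hz
  refine Submodule.span_le.2 ?_ hz
  rintro _ ⟨x, hx, z, hz, rfl⟩
  obtain ⟨a, ha, b, hb, rfl⟩ := Submodule.mem_sup.1 hx
  rw [add_lie]
  exact Submodule.add_mem_sup
    (((LieAlgebra.ad K g).comp s.incl).act_mem_actSpan (⟨a, ha⟩ : s) hz)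
    (((LieAlgebra.ad K g).comp k.incl).act_mem_actSpan (⟨b, hb⟩ : k) hz)

/-- Since `[Nⁿ⁺¹, μ(k)] ⊆ Nⁿ`, the nilpotent algebra `k` acts nilpotently on every `Nⁿ`. -/
theorem iterNormalizer_nil (h : IsGammaTriple Γ s k m) (n : ℕ) : ∃ j,
    (iterNormalizer (algB Γ m) h.mu.range n).toSubmodule ≤
      ((LieAlgebra.ad K (Module.End K m)).comp h.mu).nilSeries j := by
  have := h.nilpotent
  induction n with
  | zero =>
    obtain ⟨j, hj⟩ := LieHom.exists_nilSeries_eq_top_of_isNilpotent (K := K) (k := k)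
    refine ⟨j, ?_⟩
    rintro _ ⟨y, rfl⟩
    refine LieHom.map_mem_nilSeries (ρ := LieAlgebra.ad K k) (h.mu : k →ₗ[K] Module.End K m)
      (τ := (LieAlgebra.ad K (Module.End K m)).comp h.mu) (fun x v => h.mu.map_lie x v) ?_
    rw [hj]; trivial
  | succ n ih =>
    obtain ⟨j, hj⟩ := ih
    refine ⟨j + 1, fun d hd => ?_⟩
    rw [LieHom.mem_nilSeries_succ]
    intro y
    refine hj ?_
    show ⁅h.mu y, d⁆ ∈ iterNormalizer (algB Γ m) h.mu.range n
    rw [← lie_skew]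
    refine neg_mem (lie_mem_iterNormalizer hd ?_)
    exact iterNormalizer_mono h.mu_range_le_algB (Nat.zero_le n) ⟨y, rfl⟩

variable [CharZero K]

/-- The space `m` contains no nonzero element commuting with `s` and `k`, as `[s ⊕ k, m] = m`. -/
theorem eq_zero_of_mem_m (h : IsGammaTriple Γ s k m) {z : m} (h0 : ∀ x, h.sigma x z = 0)
    (h1 : ∀ y, h.mu y z = 0) : z = 0 := by
  have := h.isKilling
  have := h.nilpotent
  refine Subtype.ext (eq_zero_of_invariant_of_le_sup_actSpan ((LieAlgebra.ad K g).comp s.incl)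
    ((LieAlgebra.ad K g).comp k.incl) ?_ ?_ ?_ h.le_sup_actSpan z.2 ?_ ?_)
  · intro x y v
    show ⁅(x : g), ⁅(y : g), v⁆⁆ = ⁅(y : g), ⁅(x : g), v⁆⁆
    rw [leibniz_lie, h.lie_s_k x x.2 y y.2, zero_lie, zero_add]
  · exact fun x w hw => h.s_lie_mem x.2 hw
  · exact fun x w hw => h.k_lie_mem x.2 hw
  · exact fun x => congrArg Subtype.val (h0 x)
  · exact fun y => congrArg Subtype.val (h1 y)

/-- The image of `g` has trivial centralizer with respect to the law `Φ`. -/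
theorem eq_zero_of_law_emb_eq_zero (h : IsGammaTriple Γ s k m) {a : s × Module.End K m × m}
    (ha : ∀ b, h.law a (h.emb b) = 0) : a = 0 := by
  have := h.isKilling
  obtain ⟨x, y, z⟩ := a
  have hb : ∀ x' y' z', h.law (x, y, z) (x', h.mu y', z') = 0 := fun x' y' z' => by
    rw [← emb_add_add]; exact ha _
  have hx : x = 0 := LieAlgebra.ad_injective_of_center_eq_bot (LieAlgebra.center_eq_bot K s)
    fun x' => congrArg Prod.fst (hb x' 0 0)
  have hz : z = 0 := by
    refine h.eq_zero_of_mem_m (fun x' => ?_) (fun y' => ?_)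
    · simpa [law_apply] using congrArg (fun a => a.2.2) (hb x' 0 0)
    · simpa [law_apply] using congrArg (fun a => a.2.2) (hb 0 y' 0)
  subst hx hz
  have hy : y = 0 := LinearMap.ext fun z' => by
    simpa [law_apply] using congrArg (fun a => a.2.2) (hb 0 0 z')
  rw [hy]; rfl

end IsGammaTriple

/-! ### Derivations of `s ⊕ N ⊕ m` -/

/-- A derivation of `L` which preserves the image of an injective homomorphism can be pulled
back. -/
theorem LieDerivation.exists_pullback {K n L : Type*} [Field K] [LieRing n] [LieAlgebra K n]
    [LieRing L] [LieAlgebra K L] (f : n →ₗ⁅K⁆ L) (hf : Function.Injective f)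
    (D : LieDerivation K L L) (hD : ∀ v, ∃ w, D (f v) = f w) :
    ∃ δ : LieDerivation K n n, ∀ v, f (δ v) = D (f v) := by
  choose δ hδ using hD
  refine ⟨{ toFun := δ, map_add' := fun v w => hf ?_, map_smul' := fun c v => hf ?_,
            leibniz' := fun v w => hf ?_ }, fun v => (hδ v).symm⟩
  · rw [map_add, ← hδ, ← hδ, ← hδ, map_add, map_add]
  · rw [map_smul, ← hδ, ← hδ, map_smul, map_smul]; rfl
  · show f (δ ⁅v, w⁆) = f (⁅v, δ w⁆ - ⁅w, δ v⁆)
    rw [map_sub, LieHom.map_lie, LieHom.map_lie, ← hδ, ← hδ, ← hδ, LieHom.map_lie,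
      D.apply_lie_eq_sub]

namespace IsGammaTriple

variable {K : Type u} [Field K] {g : Type v} [LieRing g] [LieAlgebra K g]
    [FiniteDimensional K g] {Γ : LieSubalgebra K (Module.End K g)}
    {s k : LieSubalgebra K g} {m : Submodule K g}

/-- If `d ∈ B` is the restriction to `m` of a derivation `δ` commuting with `Γ`, then `d` acts on
the algebra generated by `m` as `δ`. -/
theorem law_emb_of_derivation (h : IsGammaTriple Γ s k m) {d : Module.End K m}
    {δ : LieDerivation K (LieSubalgebra.lieSpan K g (m : Set g))
      (LieSubalgebra.lieSpan K g (m : Set g))}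
    (h1 : ∀ γ ∈ Γ, ∀ x y : LieSubalgebra.lieSpan K g (m : Set g),
      (y : g) = γ (x : g) → (δ y : g) = γ (δ x : g))
    (h2 : ∀ z : m, (δ ⟨(z : g), LieSubalgebra.subset_lieSpan z.2⟩ : g) = (d z : g))
    (v : LieSubalgebra.lieSpan K g (m : Set g)) :
    h.law (0, d, 0) (h.emb v) = h.emb (δ v) := by
  have hv := h.projK_add_projM (h.lieSpan_le_radical v.2)
  have hc : (h.projK (v : g) : g) ∈ LieSubalgebra.lieSpan K g (m : Set g) := by
    rw [eq_sub_of_add_eq hv]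
    exact sub_mem v.2 (LieSubalgebra.subset_lieSpan (h.projM (v : g)).2)
  have hδ := h.derivation_apply_mem_k h1 (x := ⟨_, hc⟩) (h.projK (v : g)).2
  have e : (⟨_, hc⟩ : LieSubalgebra.lieSpan K g (m : Set g))
      + ⟨(h.projM (v : g) : g), LieSubalgebra.subset_lieSpan (h.projM (v : g)).2⟩ = v :=
    Subtype.ext hv
  have e1 : (δ v : g)
      = ((0 : s) : g) + ((⟨(δ ⟨_, hc⟩ : g), hδ⟩ : k) : g) + (d (h.projM (v : g)) : g) := by
    rw [← h2, ← congrArg (fun x => (δ x : g)) e, map_add]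
    simp
  have e2 : (v : g) = ((0 : s) : g) + (h.projK (v : g) : g) + (h.projM (v : g) : g) := by
    rw [add_assoc, hv]; simp
  rw [e1, emb_add_add, ← h.lie_mu_eq h2 (c := ⟨_, hc⟩) (h.projK (v : g)).2 hδ]
  rw [(congrArg h.emb e2).trans (h.emb_add_add _ _ _), law_apply]
  simp

/-- The subalgebra generated by `m` is an ideal of `g`. -/
theorem lie_mem_lieSpan (h : IsGammaTriple Γ s k m) (x : g) {v : g}
    (hv : v ∈ LieSubalgebra.lieSpan K g (m : Set g)) :
    ⁅x, v⁆ ∈ LieSubalgebra.lieSpan K g (m : Set g) := by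
  induction hv using LieSubalgebra.lieSpan_induction with
  | mem z hz =>
    obtain ⟨a, b, c, rfl⟩ := h.exists_add_add x
    rw [add_lie, add_lie]
    exact add_mem (add_mem (LieSubalgebra.subset_lieSpan (h.s_lie_mem a.2 hz))
      (LieSubalgebra.subset_lieSpan (h.k_lie_mem b.2 hz)))
      (LieSubalgebra.lie_mem _ (LieSubalgebra.subset_lieSpan c.2) (LieSubalgebra.subset_lieSpan hz))
  | zero => rw [lie_zero]; exact zero_mem _
  | add x y _ _ hx hy => rw [lie_add]; exact add_mem hx hy
  | smul c x _ hx => rw [lie_smul]; exact SMulMemClass.smul_mem _ hx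
  | lie x y hx' hy' hx hy =>
    rw [leibniz_lie]
    exact add_mem (LieSubalgebra.lie_mem _ hx hy') (LieSubalgebra.lie_mem _ hx' hy)

/-- The representation of `g` in the ideal generated by `m`. -/
def adSpan (h : IsGammaTriple Γ s k m) :
    g →ₗ⁅K⁆ Module.End K (LieSubalgebra.lieSpan K g (m : Set g)) where
  toFun x :=
    { toFun v := ⟨⁅x, (v : g)⁆, h.lie_mem_lieSpan x v.2⟩
      map_add' v w := by ext; simp
      map_smul' c v := by ext; simp }
  map_add' x y := by ext v; simp
  map_smul' c x := by ext v; simp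
  map_lie' := by intro x y; ext v; simp [Ring.lie_def]

theorem adSpan_apply (h : IsGammaTriple Γ s k m) (x : g)
    (v : LieSubalgebra.lieSpan K g (m : Set g)) : (h.adSpan x v : g) = ⁅x, (v : g)⁆ := rfl

/-- The restriction of an element of `Γ` to the ideal generated by `m`. -/
def restrictSpan (h : IsGammaTriple Γ s k m) {γ : Module.End K g} (hγ : γ ∈ Γ) :
    Module.End K (LieSubalgebra.lieSpan K g (m : Set g)) :=
  γ.restrict (p := (LieSubalgebra.lieSpan K g (m : Set g)).toSubmodule)
    fun _ hx => h.apply_mem_lieSpan hγ hx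

theorem restrictSpan_isSemisimple (h : IsGammaTriple Γ s k m) {γ : Module.End K g} (hγ : γ ∈ Γ)
    (hs : γ.IsSemisimple) : (h.restrictSpan hγ).IsSemisimple :=
  Module.End.IsSemisimple.restrict (p := (LieSubalgebra.lieSpan K g (m : Set g)).toSubmodule)
    (fun _ hx => h.apply_mem_lieSpan hγ hx) hs

theorem lie_restrictSpan_adSpan (h : IsGammaTriple Γ s k m) {γ : Module.End K g} (hγ : γ ∈ Γ)
    (x : g) : ⁅h.restrictSpan hγ, h.adSpan x⁆ = h.adSpan (γ x) := by
  ext v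
  show γ ⁅x, (v : g)⁆ - ⁅x, γ v⁆ = ⁅γ x, (v : g)⁆
  rw [h.apply_lie hγ, add_sub_cancel_right]

/-- An element of `m` whose adjoint action on the ideal generated by `m` commutes with the actions
of `s` and `k` acts trivially on this ideal. -/
theorem adSpan_eq_zero [CharZero K] (h : IsGammaTriple Γ s k m) {z : g} (hz : z ∈ m)
    (h0 : ∀ x ∈ s, ⁅h.adSpan x, h.adSpan z⁆ = 0) (h1 : ∀ y ∈ k, ⁅h.adSpan y, h.adSpan z⁆ = 0) :
    h.adSpan z = 0 := by
  have := h.isKilling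
  have := h.nilpotent
  let ρ := (LieAlgebra.ad K _).comp h.adSpan
  have hρ : ∀ x w, ρ x (h.adSpan w) = h.adSpan ⁅x, w⁆ := fun x w => (h.adSpan.map_lie x w).symm
  refine eq_zero_of_invariant_of_le_sup_actSpan (ρ.comp s.incl) (ρ.comp k.incl) ?_
    (W := m.map (h.adSpan : g →ₗ[K] _)) ?_ ?_ ?_ ⟨z, hz, rfl⟩ (fun x => h0 x x.2) fun y => h1 y y.2
  · intro x y v
    have e : ⁅h.adSpan x, h.adSpan y⁆ = 0 := by
      rw [← LieHom.map_lie, h.lie_s_k x x.2 y y.2, map_zero]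
    show ⁅h.adSpan x, ⁅h.adSpan y, v⁆⁆ = ⁅h.adSpan y, ⁅h.adSpan x, v⁆⁆
    rw [leibniz_lie, e, zero_lie, zero_add]
  · rintro x _ ⟨w, hw, rfl⟩
    exact ⟨⁅(x : g), w⁆, h.s_lie_mem x.2 hw, (hρ x w).symm⟩
  · rintro x _ ⟨w, hw, rfl⟩
    exact ⟨⁅(x : g), w⁆, h.k_lie_mem x.2 hw, (hρ x w).symm⟩
  · refine (Submodule.map_mono h.le_sup_actSpan).trans ?_
    rw [Submodule.map_sup]
    refine sup_le_sup (Submodule.map_le_iff_le_comap.2 (LieHom.actSpan_le _ fun x w hw => ?_))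
      (Submodule.map_le_iff_le_comap.2 (LieHom.actSpan_le _ fun x w hw => ?_))
    · rw [Submodule.mem_comap]
      refine Eq.mp (congrArg (· ∈ (ρ.comp s.incl).actSpan _) (hρ x w)) ?_
      exact LieHom.act_mem_actSpan (ρ.comp s.incl) x ⟨w, hw, rfl⟩
    · rw [Submodule.mem_comap]
      refine Eq.mp (congrArg (· ∈ (ρ.comp k.incl).actSpan _) (hρ x w)) ?_
      exact LieHom.act_mem_actSpan (ρ.comp k.incl) x ⟨w, hw, rfl⟩

end IsGammaTriple

namespace IsLieOn

variable {K : Type u} [Field K] {V : Type v} [AddCommGroup V] [Module K V]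
    {Φ : V →ₗ[K] V →ₗ[K] V} {W : Submodule K V}

instance [Module.Finite K V] (h : IsLieOn Φ W) : Module.Finite K h.Carrier :=
  inferInstanceAs (Module.Finite K W)

/-- The element of the Lie algebra on `W` given by a vector of `W`. -/
def mkCarrier (h : IsLieOn Φ W) (v : V) (hv : v ∈ W) : h.Carrier := (⟨v, hv⟩ : W)

/-- A linear map to `V` with values in `W` which is compatible with the brackets, as a
homomorphism to the Lie algebra on `W`. -/
def lieLift (h : IsLieOn Φ W) {L : Type*} [LieRing L] [LieAlgebra K L] (f : L →ₗ[K] V)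
    (hf : ∀ x, f x ∈ W) (hlie : ∀ x y, f ⁅x, y⁆ = Φ (f x) (f y)) : L →ₗ⁅K⁆ h.Carrier where
  toFun x := h.mkCarrier (f x) (hf x)
  map_add' x y := h.incl_injective (f.map_add x y)
  map_smul' c x := h.incl_injective (f.map_smul c x)
  map_lie' {x y} := h.incl_injective (hlie x y)

end IsLieOn

namespace IsGammaTriple

variable {K : Type u} [Field K] {g : Type v} [LieRing g] [LieAlgebra K g]
    [FiniteDimensional K g] {Γ : LieSubalgebra K (Module.End K g)}
    {s k : LieSubalgebra K g} {m : Submodule K g}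

theorem emb_s (h : IsGammaTriple Γ s k m) (x : s) : h.emb x = (x, 0, 0) := by
  simpa using h.emb_add_add x 0 0

theorem emb_k (h : IsGammaTriple Γ s k m) (y : k) : h.emb y = (0, h.mu y, 0) := by
  simpa using h.emb_add_add 0 y 0

theorem emb_m (h : IsGammaTriple Γ s k m) (z : m) : h.emb z = (0, 0, z) := by
  simpa using h.emb_add_add 0 0 z

/-- The action of `a ∈ s ⊕ B ⊕ m` on the subalgebra of `g` generated by `m`, if `δ` is the
derivation of this subalgebra that corresponds to the component of `a` in `B`. -/
theorem law_emb_eq (h : IsGammaTriple Γ s k m) {a : s × Module.End K m × m}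
    {δ : LieDerivation K (LieSubalgebra.lieSpan K g (m : Set g))
      (LieSubalgebra.lieSpan K g (m : Set g))}
    (h1 : ∀ γ ∈ Γ, ∀ x y : LieSubalgebra.lieSpan K g (m : Set g),
      (y : g) = γ (x : g) → (δ y : g) = γ (δ x : g))
    (h2 : ∀ z : m, (δ ⟨(z : g), LieSubalgebra.subset_lieSpan z.2⟩ : g) = (a.2.1 z : g))
    (v : LieSubalgebra.lieSpan K g (m : Set g)) :
    h.law a (h.emb v) = h.emb (⁅(a.1 : g) + (a.2.2 : g), (v : g)⁆ + δ v) := by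
  rw [map_add, emb_lie, ← h.law_emb_of_derivation h1 h2 v, ← LinearMap.add_apply, ← map_add,
    map_add h.emb, h.emb_s, h.emb_m]
  congr 2
  simp

/-- The canonical homomorphism `g → s ⊕ N ⊕ m`. -/
noncomputable def embHom (h : IsGammaTriple Γ s k m) {N : LieSubalgebra K (Module.End K m)}
    (hμ : h.mu.range ≤ N) (hL : IsLieOn h.law (gammaSum s N)) : g →ₗ⁅K⁆ hL.Carrier :=
  hL.lieLift h.emb (h.emb_mem hμ) h.emb_lie

theorem incl_embHom (h : IsGammaTriple Γ s k m) {N : LieSubalgebra K (Module.End K m)}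
    (hμ : h.mu.range ≤ N) (hL : IsLieOn h.law (gammaSum s N)) (x : g) :
    hL.incl (h.embHom hμ hL x) = h.emb x := rfl

theorem embHom_injective (h : IsGammaTriple Γ s k m) (hc : LieAlgebra.center K g = ⊥)
    {N : LieSubalgebra K (Module.End K m)}
    (hμ : h.mu.range ≤ N) (hL : IsLieOn h.law (gammaSum s N)) :
    Function.Injective (h.embHom hμ hL) := fun _ _ e =>
  h.emb_injective hc (congrArg hL.incl e)

/-- The ideal of `s ⊕ N ⊕ m` given by the subalgebra of `g` generated by `m`. -/
noncomputable def spanIdeal (h : IsGammaTriple Γ s k m) {N : LieSubalgebra K (Module.End K m)}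
    (hμ : h.mu.range ≤ N) (hN : N ≤ algB Γ m) (hL : IsLieOn h.law (gammaSum s N)) :
    LieIdeal K hL.Carrier :=
  { (LieSubalgebra.lieSpan K g (m : Set g)).toSubmodule.map
      (h.embHom hμ hL : g →ₗ[K] hL.Carrier) with
    lie_mem := by
      rintro l _ ⟨v, hv, rfl⟩
      obtain ⟨δ, h1, h2⟩ := hN (hL.incl_mem l).2.1
      exact ⟨_, add_mem (h.lie_mem_lieSpan _ hv) (δ ⟨v, hv⟩).2,
        hL.incl_injective (h.law_emb_eq h1 h2 ⟨v, hv⟩).symm⟩ }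

theorem embHom_mem_spanIdeal (h : IsGammaTriple Γ s k m) {N : LieSubalgebra K (Module.End K m)}
    (hμ : h.mu.range ≤ N) (hN : N ≤ algB Γ m) (hL : IsLieOn h.law (gammaSum s N)) {z : g}
    (hz : z ∈ m) : h.embHom hμ hL z ∈ h.spanIdeal hμ hN hL :=
  ⟨z, LieSubalgebra.subset_lieSpan hz, rfl⟩

theorem isSolvable_spanIdeal (h : IsGammaTriple Γ s k m) {N : LieSubalgebra K (Module.End K m)}
    (hμ : h.mu.range ≤ N) (hN : N ≤ algB Γ m) (hL : IsLieOn h.law (gammaSum s N)) :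
    LieAlgebra.IsSolvable (h.spanIdeal hμ hN hL) := by
  have : LieAlgebra.IsSolvable (LieSubalgebra.lieSpan K g (m : Set g)) := by
    let f : LieSubalgebra.lieSpan K g (m : Set g) →ₗ⁅K⁆ LieAlgebra.radical K g :=
      { toFun := fun v => ⟨v, h.lieSpan_le_radical v.2⟩
        map_add' := fun _ _ => rfl
        map_smul' := fun _ _ => rfl
        map_lie' := rfl }
    exact Function.Injective.lieAlgebra_isSolvable (f := f)
      fun a b e => Subtype.ext (congrArg (fun x : LieAlgebra.radical K g => (x : g)) e)
  let f : LieSubalgebra.lieSpan K g (m : Set g) →ₗ⁅K⁆ h.spanIdeal hμ hN hL :=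
    { toFun := fun v => ⟨h.embHom hμ hL v, v, v.2, rfl⟩
      map_add' := fun v w => Subtype.ext (map_add (h.embHom hμ hL) (v : g) w)
      map_smul' := fun c v => Subtype.ext (map_smul (h.embHom hμ hL) c (v : g))
      map_lie' := fun {v w} => Subtype.ext (LieHom.map_lie (h.embHom hμ hL) (v : g) w) }
  refine Function.Surjective.lieAlgebra_isSolvable (f := f) ?_
  rintro ⟨_, v, hv, rfl⟩
  exact ⟨⟨v, hv⟩, rfl⟩

theorem center_carrier_eq_bot [CharZero K] (h : IsGammaTriple Γ s k m)
    {N : LieSubalgebra K (Module.End K m)}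
    (hμ : h.mu.range ≤ N) (hL : IsLieOn h.law (gammaSum s N)) :
    LieAlgebra.center K hL.Carrier = ⊥ := by
  refine (LieSubmodule.eq_bot_iff _).2 fun a ha => ?_
  refine hL.incl_injective ((h.eq_zero_of_law_emb_eq_zero fun b => ?_).trans (map_zero _).symm)
  rw [← h.incl_embHom hμ hL, ← hL.incl_lie, ← lie_skew,
    (LieModule.mem_maxTrivSubmodule K hL.Carrier hL.Carrier a).1 ha, neg_zero, map_zero]

/-- Every derivation of `s ⊕ N ⊕ m` is the sum of an inner derivation and a derivation which is
zero on `s` and preserves `N` and `m`. -/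
theorem exists_add_ad [CharZero K] (h : IsGammaTriple Γ s k m)
    {N : LieSubalgebra K (Module.End K m)} (hμ : h.mu.range ≤ N) (hN : N ≤ algB Γ m)
    (hL : IsLieOn h.law (gammaSum s N)) {j : ℕ}
    (hnil : N.toSubmodule ≤ ((LieAlgebra.ad K (Module.End K m)).comp h.mu).nilSeries j)
    (D : LieDerivation K hL.Carrier hL.Carrier) :
    ∃ (l : hL.Carrier) (D' : LieDerivation K hL.Carrier hL.Carrier),
      D = D' + LieDerivation.ad K hL.Carrier l ∧ (∀ x ∈ s, D' (h.embHom hμ hL x) = 0) ∧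
      (∀ a y, hL.incl a = (0, y, 0) → ∃ y' ∈ N, hL.incl (D' a) = (0, y', 0)) ∧
      ∀ z ∈ m, ∃ z' ∈ m, D' (h.embHom hμ hL z) = h.embHom hμ hL z' := by
  have := h.isKilling
  have := h.nilpotent
  have := h.isSolvable_spanIdeal hμ hN hL
  let ι := h.embHom hμ hL
  let q : hL.Carrier →ₗ⁅K⁆ s :=
    { LinearMap.fst K s (Module.End K m × m) ∘ₗ hL.incl with
      map_lie' := rfl }
  let N' : Submodule K hL.Carrier := (Submodule.prod ⊥ (Submodule.prod ⊤ ⊥)).comap hL.incl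
  have hN' : ∀ a, a ∈ N' ↔ (hL.incl a).1 = 0 ∧ (hL.incl a).2.2 = 0 := by
    intro a; simp [N', Submodule.mem_prod]
  have hN'2 : ∀ a ∈ N', ∃ y ∈ N, hL.incl a = (0, y, 0) := fun a ha =>
    ⟨(hL.incl a).2.1, (hL.incl_mem a).2.1, Prod.ext ((hN' a).1 ha).1
      (Prod.ext rfl ((hN' a).1 ha).2)⟩
  have hmk : ∀ a y, hL.incl a = (0, y, 0) → a ∈ N' := fun a y e => by rw [hN', e]; simp
  let p : hL.Carrier →ₗ[K] hL.Carrier :=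
    { toFun := fun a => hL.mkCarrier (0, (hL.incl a).2.1, 0)
        ⟨trivial, (hL.incl_mem a).2.1, trivial⟩
      map_add' := fun a b => hL.incl_injective (Prod.ext (add_zero _).symm
        (Prod.ext (congrArg (fun v => v.2.1) (map_add hL.incl a b)) (add_zero _).symm))
      map_smul' := fun c a => hL.incl_injective (Prod.ext (smul_zero _).symm
        (Prod.ext (congrArg (fun v => v.2.1) (map_smul hL.incl c a)) (smul_zero _).symm)) }
  have hp : ∀ a, hL.incl (p a) = (0, (hL.incl a).2.1, 0) := fun a => rfl
  have hι : ∀ x, hL.incl (ι x) = h.emb x := fun x => rfl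
  have hnil' : ∀ i, ∀ y ∈ ((LieAlgebra.ad K (Module.End K m)).comp h.mu).nilSeries i, ∀ a,
      hL.incl a = (0, y, 0) →
      a ∈ ((LieAlgebra.ad K hL.Carrier).comp (ι.comp k.incl)).nilSeries i := by
    intro i
    induction i with
    | zero =>
      intro y hy a ha
      rw [show y = 0 from hy] at ha
      exact hL.incl_injective (ha.trans (map_zero _).symm)
    | succ i ih =>
      intro y hy a ha
      rw [LieHom.mem_nilSeries_succ] at hy ⊢
      intro c
      refine ih _ (hy c) _ ?_
      show h.law (h.emb c) (hL.incl a) = _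
      rw [ha, h.emb_k, law_apply]
      simp
  have key : ∃ (l : hL.Carrier) (D' : LieDerivation K hL.Carrier hL.Carrier),
      D = D' + LieDerivation.ad K hL.Carrier l ∧ (∀ x, D' ((ι.comp s.incl) x) = 0) ∧
      (∀ a ∈ N', D' a ∈ N') ∧ ∀ z ∈ m.map (ι : g →ₗ[K] hL.Carrier),
        D' z ∈ m.map (ι : g →ₗ[K] hL.Carrier) := by
    refine D.exists_add_ad_of_decomp (h.center_carrier_eq_bot hμ hL)
      (ι.comp s.incl) (ι.comp k.incl) q N' (m.map (ι : g →ₗ[K] hL.Carrier)) p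
      ?_ ?_ ?_ ?_ ?_ ?_ ?_ ?_ ?_ ?_ ?_ ?_ (j := j) ?_ (h.spanIdeal hμ hN hL) ?_ ?_
    · intro l
      refine ⟨(hL.incl l).1, p l, (hN' _).2 ⟨rfl, rfl⟩, _, ⟨(hL.incl l).2.2, Subtype.prop _, rfl⟩,
        hL.incl_injective ?_⟩
      rw [map_add, map_add, hp]
      show _ = h.emb ((hL.incl l).1 : g) + _ + h.emb ((hL.incl l).2.2 : g)
      rw [h.emb_s, h.emb_m]
      simp
    · intro x
      show (h.emb x).1 = x
      rw [h.emb_s]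
    · exact fun a ha => ((hN' a).1 ha).1
    · rintro _ ⟨z, hz, rfl⟩
      show (h.emb z).1 = 0
      rw [h.emb_m ⟨z, hz⟩]
    · intro a ha
      obtain ⟨y, -, e⟩ := hN'2 a ha
      exact hL.incl_injective (by rw [hp, e])
    · rintro _ ⟨z, hz, rfl⟩
      refine hL.incl_injective ?_
      rw [hp]
      show (0, (h.emb z).2.1, 0) = _
      rw [h.emb_m ⟨z, hz⟩, map_zero]
      rfl
    · exact fun y => hmk _ (h.mu y) (h.emb_k y)
    · intro a ha b hb
      obtain ⟨y, -, e⟩ := hN'2 a ha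
      obtain ⟨y', -, e'⟩ := hN'2 b hb
      refine hmk _ ⁅y, y'⁆ ?_
      rw [hL.incl_lie, e, e', law_apply]
      simp
    · intro x a ha
      obtain ⟨y, -, e⟩ := hN'2 a ha
      refine hL.incl_injective ?_
      rw [hL.incl_lie, e, map_zero]
      show h.law (h.emb x) _ = 0
      rw [h.emb_s, law_apply]
      simp
    · rintro x _ ⟨z, hz, rfl⟩
      exact ⟨⁅(x : g), z⁆, h.s_lie_mem x.2 hz, ι.map_lie _ _⟩
    · rintro a ha _ ⟨z, hz, rfl⟩
      obtain ⟨y, -, e⟩ := hN'2 a ha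
      refine ⟨y ⟨z, hz⟩, Subtype.prop _, hL.incl_injective ?_⟩
      rw [hL.incl_lie, e]
      show h.emb _ = h.law _ (h.emb z)
      rw [h.emb_m, h.emb_m ⟨z, hz⟩, law_apply]
      simp
    · refine (Submodule.map_mono h.le_sup_actSpan).trans ?_
      rw [Submodule.map_sup]
      refine sup_le_sup (Submodule.map_le_iff_le_comap.2 (LieHom.actSpan_le _ fun x w hw => ?_))
        (Submodule.map_le_iff_le_comap.2 (LieHom.actSpan_le _ fun x w hw => ?_))
      · rw [Submodule.mem_comap]
        refine Eq.mp (congrArg (· ∈ LieHom.actSpan _ _) (ι.map_lie (x : g) w).symm) ?_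
        exact LieHom.act_mem_actSpan ((LieAlgebra.ad K hL.Carrier).comp (ι.comp s.incl)) x
          ⟨w, hw, rfl⟩
      · rw [Submodule.mem_comap]
        refine Eq.mp (congrArg (· ∈ LieHom.actSpan _ _) (ι.map_lie (x : g) w).symm) ?_
        exact LieHom.act_mem_actSpan ((LieAlgebra.ad K hL.Carrier).comp (ι.comp k.incl)) x
          ⟨w, hw, rfl⟩
    · intro a ha
      obtain ⟨y, hy, e⟩ := hN'2 a ha
      exact hnil' j y (hnil hy) a e
    · rintro _ ⟨z, hz, rfl⟩
      exact h.embHom_mem_spanIdeal hμ hN hL hz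
    · rintro _ ⟨v, hv, rfl⟩
      obtain ⟨x, hx⟩ : ∃ y : k, ∃ z : m, v = y + z :=
        ⟨_, _, (h.projK_add_projM (h.lieSpan_le_radical hv)).symm⟩
      obtain ⟨z, rfl⟩ := hx
      show (h.emb _).1 = 0
      rw [map_add, h.emb_k, h.emb_m]
      simp
  obtain ⟨l, D', e, h1, h2, h3⟩ := key
  refine ⟨l, D', e, fun x hx => h1 ⟨x, hx⟩, fun a y ha => hN'2 _ (h2 a (hmk a y ha)),
    fun z hz => ?_⟩
  obtain ⟨z', hz', e'⟩ := h3 _ ⟨z, hz, rfl⟩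
  exact ⟨z', hz', e'.symm⟩

end IsGammaTriple

namespace IsGammaTriple

variable {K : Type u} [Field K] [CharZero K] {g : Type v} [LieRing g] [LieAlgebra K g]
    [FiniteDimensional K g] {Γ : LieSubalgebra K (Module.End K g)}
    {s k : LieSubalgebra K g} {m : Submodule K g}

/-- Let `D` be a derivation of `s ⊕ N ⊕ m` which kills `s`, preserves `N` and restricts to a
linear map `δ` of the ideal generated by `m`. Then `δ` commutes with the semisimple elements `t` of
`Γ` which kill `s`. -/
theorem lie_restrictSpan_eq_zero (h : IsGammaTriple Γ s k m) (hc : LieAlgebra.center K g = ⊥)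
    {N : LieSubalgebra K (Module.End K m)} (hμ : h.mu.range ≤ N) (hN : N ≤ algB Γ m)
    (hL : IsLieOn h.law (gammaSum s N)) (D : LieDerivation K hL.Carrier hL.Carrier)
    (δ : Module.End K (LieSubalgebra.lieSpan K g (m : Set g)))
    (hδ : ∀ v : LieSubalgebra.lieSpan K g (m : Set g), D (h.embHom hμ hL v) = h.embHom hμ hL (δ v))
    (hs : ∀ x ∈ s, D (h.embHom hμ hL x) = 0)
    (hk : ∀ a y, hL.incl a = (0, y, 0) → ∃ y' ∈ N, hL.incl (D a) = (0, y', 0))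
    {t : Module.End K g} (ht : t ∈ Γ) (ht0 : ∀ x ∈ s, t x = 0) (hts : t.IsSemisimple) :
    ⁅h.restrictSpan ht, δ⁆ = 0 := by
  let ι := h.embHom hμ hL
  have hι : Function.Injective ι := h.embHom_injective hc hμ hL
  let T := h.restrictSpan ht
  -- `[t, δ]` is the restriction of an inner derivation, since this holds for `ad g` in place of `t`
  obtain ⟨Y, hY⟩ := LinearMap.exists_extend
    (p := (LieSubalgebra.lieSpan K g (m : Set g)).toSubmodule)
    ((LieSubalgebra.lieSpan K g (m : Set g)).toSubmodule.subtype ∘ₗ δ)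
  replace hY : ∀ v : LieSubalgebra.lieSpan K g (m : Set g), Y v = δ v := fun v =>
    LinearMap.congr_fun hY v
  let U : Submodule K (Module.End K g) :=
    { carrier := {Y | ∃ D : LieDerivation K hL.Carrier hL.Carrier,
        ∀ v ∈ LieSubalgebra.lieSpan K g (m : Set g), ι (Y v) = D (ι v)}
      zero_mem' := ⟨0, fun v _ => by simp⟩
      add_mem' := by
        rintro Y Y' ⟨D, hD⟩ ⟨D', hD'⟩
        exact ⟨D + D', fun v hv => by simp [hD v hv, hD' v hv]⟩
      smul_mem' := by
        rintro c Y ⟨D, hD⟩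
        exact ⟨c • D, fun v hv => by simp [hD v hv]⟩ }
  let W : Submodule K (Module.End K g) :=
    { carrier := {Y | ∃ l : hL.Carrier,
        ∀ v ∈ LieSubalgebra.lieSpan K g (m : Set g), ι (Y v) = ⁅l, ι v⁆}
      zero_mem' := ⟨0, fun v _ => by simp⟩
      add_mem' := by
        rintro Y Y' ⟨l, hl⟩ ⟨l', hl'⟩
        exact ⟨l + l', fun v hv => by simp [hl v hv, hl' v hv]⟩
      smul_mem' := by
        rintro c Y ⟨l, hl⟩
        exact ⟨c • l, fun v hv => by simp [hl v hv]⟩ }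
  have hWU : W ≤ U := by
    rintro Y ⟨l, hl⟩
    exact ⟨LieDerivation.ad K hL.Carrier l, fun v hv => by
      rw [hl v hv, LieDerivation.ad_apply_apply]⟩
  have hUW : ∀ x : g, ∀ Y ∈ U, ⁅LieAlgebra.ad K g x, Y⁆ ∈ W := by
    rintro x Y ⟨D, hD⟩
    refine ⟨- D (ι x), fun v hv => ?_⟩
    have e : ⁅LieAlgebra.ad K g x, Y⁆ v = ⁅x, Y v⁆ - Y ⁅x, v⁆ := rfl
    rw [e, map_sub, LieHom.map_lie, hD v hv, hD _ (h.lie_mem_lieSpan x hv), LieHom.map_lie,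
      D.apply_lie_eq_add, neg_lie]
    abel
  obtain ⟨l, hl⟩ := lie_mem_of_mem_algHullAd hWU hUW (h.le_algHullAd ht)
    (show Y ∈ U from ⟨D, fun v hv => by rw [hY ⟨v, hv⟩]; exact (hδ ⟨v, hv⟩).symm⟩)
  obtain ⟨δ₀, h1, h2⟩ := hN (hL.incl_mem l).2.1
  let x₀ : g := ((hL.incl l).1 : g)
  let z₀ : g := ((hL.incl l).2.2 : g)
  -- `t` commutes with the derivations that represent elements of `B`
  have hT0 : ∀ δ' : LieDerivation K (LieSubalgebra.lieSpan K g (m : Set g))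
      (LieSubalgebra.lieSpan K g (m : Set g)),
      (∀ γ ∈ Γ, ∀ x y : LieSubalgebra.lieSpan K g (m : Set g),
        (y : g) = γ (x : g) → (δ' y : g) = γ (δ' x : g)) → ⁅T, δ'.toLinearMap⁆ = 0 := by
    intro δ' h'
    refine LinearMap.ext fun v => Subtype.ext ?_
    exact sub_eq_zero.2 (h' t ht v (T v) rfl).symm
  have e1 : ⁅T, δ⁆ = h.adSpan (x₀ + z₀) + δ₀.toLinearMap := by
    refine LinearMap.ext fun v => Subtype.ext (hι ?_)
    have e2 := hl v v.2
    have e3 : (⁅T, δ⁆ v : g) = ⁅t, Y⁆ v := by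
      show t (δ v : g) - (δ (T v) : g) = t (Y v) - Y (t v)
      rw [hY v, ← hY (T v)]
      rfl
    rw [e3, e2]
    exact hL.incl_injective (h.law_emb_eq h1 h2 v)
  have e2 : ⁅T, ⁅T, δ⁆⁆ = h.adSpan (t z₀) := by
    rw [e1, lie_add, hT0 δ₀ h1, add_zero, h.lie_restrictSpan_adSpan ht, map_add,
      ht0 x₀ (hL.incl l).1.2, zero_add]
  -- `[ad y, δ]` vanishes for `y ∈ s`, and represents an element of `N` for `y ∈ k`
  have hDδ : ∀ (w : g) (v), ι (δ (h.adSpan w v)) = ι ⁅w, (δ v : g)⁆ + ⁅D (ι w), ι v⁆ := by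
    intro w v
    rw [← hδ, h.adSpan_apply, LieHom.map_lie, D.apply_lie_eq_add, hδ, LieHom.map_lie]
  have hTs : ∀ x, t x = 0 → ⁅h.adSpan x, T⁆ = 0 := by
    intro x hx
    rw [← lie_skew, h.lie_restrictSpan_adSpan ht, hx, map_zero, neg_zero]
  have hTL : ∀ X Z : Module.End K (LieSubalgebra.lieSpan K g (m : Set g)),
      ⁅X, T⁆ = 0 → ⁅X, ⁅T, Z⁆⁆ = ⁅T, ⁅X, Z⁆⁆ := by
    intro X Z hX
    rw [leibniz_lie X T Z, hX, zero_lie, zero_add]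
  have hz : h.adSpan (t z₀) = 0 := by
    refine h.adSpan_eq_zero (h.apply_mem_m ht (h.m_le_radical (hL.incl l).2.2.2)) ?_ ?_
    · intro x hx
      have e3 : ⁅h.adSpan x, δ⁆ = 0 := by
        refine LinearMap.ext fun v => Subtype.ext (sub_eq_zero.2 (hι ?_))
        show ι ⁅x, (δ v : g)⁆ = ι (δ (h.adSpan x v))
        rw [hDδ, hs x hx, zero_lie, add_zero]
      have e4 := hTs x (ht0 x hx)
      rw [← e2, hTL _ _ e4, hTL _ _ e4, e3,
        lie_zero, lie_zero]
    · intro y hy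
      obtain ⟨y', hy', e⟩ := hk (ι y) (h.mu ⟨y, hy⟩) (h.emb_k ⟨y, hy⟩)
      obtain ⟨δ', h1', h2'⟩ := hN hy'
      have e3 : ⁅h.adSpan y, δ⁆ = - δ'.toLinearMap := by
        refine LinearMap.ext fun v => Subtype.ext ?_
        show ⁅y, (δ v : g)⁆ - (δ (h.adSpan y v) : g) = - (δ' v : g)
        rw [sub_eq_iff_eq_add, ← sub_eq_neg_add, eq_sub_iff_add_eq]
        refine hι ?_
        rw [map_add, hDδ]
        congr 1
        refine hL.incl_injective ?_
        rw [hL.incl_lie, e]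
        exact (h.law_emb_of_derivation h1' h2' v).symm
      have e4 := hTs y ((h.mem_k y).1 hy t ht)
      rw [← e2, hTL _ _ e4, hTL _ _ e4, e3,
        lie_neg, hT0 δ' h1', neg_zero, lie_zero]
  exact (h.restrictSpan_isSemisimple ht hts).commute_of_lie_lie_eq_zero (e2.trans hz)

/-- Every derivation of `s ⊕ N ⊕ m` is of the form `Φ(a, ·)` with `a ∈ s ⊕ N' ⊕ m`, where `N'` is
the normalizer of `N` in `B`. -/
theorem exists_law_eq_derivation (h : IsGammaTriple Γ s k m) (hc : LieAlgebra.center K g = ⊥)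
    {N : LieSubalgebra K (Module.End K m)} (hμ : h.mu.range ≤ N) (hN : N ≤ algB Γ m)
    (hL : IsLieOn h.law (gammaSum s N)) {j : ℕ}
    (hnil : N.toSubmodule ≤ ((LieAlgebra.ad K (Module.End K m)).comp h.mu).nilSeries j)
    (D : LieDerivation K hL.Carrier hL.Carrier) :
    ∃ a ∈ gammaSum s (algB Γ m ⊓ N.normalizer), ∀ b, hL.incl (D b) = h.law a (hL.incl b) := by
  obtain ⟨l, D', rfl, h1, h2, h3⟩ := h.exists_add_ad hμ hN hL hnil D
  let ι := h.embHom hμ hL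
  have hι : Function.Injective ι := h.embHom_injective hc hμ hL
  have hpres : ∀ v ∈ LieSubalgebra.lieSpan K g (m : Set g),
      ∃ w ∈ LieSubalgebra.lieSpan K g (m : Set g), D' (ι v) = ι w := by
    intro v hv
    induction hv using LieSubalgebra.lieSpan_induction with
    | mem z hz =>
      obtain ⟨z', hz', e⟩ := h3 z hz
      exact ⟨z', LieSubalgebra.subset_lieSpan hz', e⟩
    | zero => exact ⟨0, zero_mem _, by simp⟩
    | add x y _ _ hx hy =>
      obtain ⟨x', hx', ex⟩ := hx
      obtain ⟨y', hy', ey⟩ := hy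
      exact ⟨x' + y', add_mem hx' hy', by rw [map_add, map_add, map_add, ex, ey]⟩
    | smul c x _ hx =>
      obtain ⟨x', hx', ex⟩ := hx
      exact ⟨c • x', SMulMemClass.smul_mem _ hx', by rw [map_smul, map_smul, map_smul, ex]⟩
    | lie x y hx₀ hy₀ hx hy =>
      obtain ⟨x', hx', ex⟩ := hx
      obtain ⟨y', hy', ey⟩ := hy
      refine ⟨⁅x, y'⁆ + ⁅x', y⁆, add_mem (LieSubalgebra.lie_mem _ hx₀ hy')
        (LieSubalgebra.lie_mem _ hx' hy₀), ?_⟩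
      rw [LieHom.map_lie, D'.apply_lie_eq_add, ex, ey, map_add, LieHom.map_lie, LieHom.map_lie]
  obtain ⟨δ, hδ⟩ := D'.exists_pullback (ι.comp (LieSubalgebra.lieSpan K g (m : Set g)).incl)
    (hι.comp Subtype.val_injective) (fun v => by
      obtain ⟨w, hw, e⟩ := hpres v v.2
      exact ⟨⟨w, hw⟩, e⟩)
  replace hδ : ∀ v : LieSubalgebra.lieSpan K g (m : Set g), D' (ι v) = ι (δ v) :=
    fun v => (hδ v).symm
  -- the restriction of `D'` to `m`
  let d : Module.End K m := LinearMap.snd K _ _ ∘ₗ LinearMap.snd K s _ ∘ₗ hL.incl ∘ₗ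
    D'.toLinearMap ∘ₗ (ι : g →ₗ[K] hL.Carrier) ∘ₗ m.subtype
  have hd : ∀ z : m, D' (ι z) = ι (d z) := by
    intro z
    obtain ⟨z', hz', e⟩ := h3 z z.2
    have : d z = ⟨z', hz'⟩ := by
      show (hL.incl (D' (ι z))).2.2 = _
      rw [e]
      show (h.emb z').2.2 = _
      rw [h.emb_m ⟨z', hz'⟩]
    rw [this]
    exact e
  have hcomm : ∀ γ ∈ Γ, ∀ x y : LieSubalgebra.lieSpan K g (m : Set g),
      (y : g) = γ (x : g) → (δ y : g) = γ (δ x : g) := by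
    intro γ hγ x y hxy
    obtain ⟨a, ha, t, ht, rfl, ht0, hts⟩ := h.exists_ad_add hc hγ
    have e1 := h.lie_restrictSpan_eq_zero hc hμ hN hL D' δ.toLinearMap hδ h1 h2 ht ht0 hts
    have e2 : t (δ x : g) = δ (h.restrictSpan ht x) :=
      sub_eq_zero.1 (congrArg Subtype.val (LinearMap.congr_fun e1 x))
    have e3 : (δ (h.adSpan a x) : g) = ⁅a, (δ x : g)⁆ := by
      refine hι ?_
      rw [← hδ, h.adSpan_apply, LieHom.map_lie, D'.apply_lie_eq_add, h1 a ha, zero_lie, add_zero,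
        hδ, LieHom.map_lie]
    have e4 : y = h.adSpan a x + h.restrictSpan ht x := Subtype.ext hxy
    rw [e4, map_add, AddMemClass.coe_add, e3, ← e2]
    rfl
  -- on `N`, the derivation `D'` is the commutator with `d`
  have hdN : ∀ a y, hL.incl a = (0, y, 0) → hL.incl (D' a) = (0, ⁅d, y⁆, 0) := by
    intro a y ha
    obtain ⟨y', -, e⟩ := h2 a y ha
    rw [e]
    congr 2
    ext z
    have e1 : ∀ b y, hL.incl b = (0, y, 0) → ∀ z : m, ⁅b, ι z⁆ = ι (y z) := by
      intro b y hb z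
      refine hL.incl_injective ?_
      rw [hL.incl_lie, hb]
      show h.law _ (h.emb z) = h.emb (y z)
      rw [h.emb_m, h.emb_m, law_apply]
      simp
    have e2 := D'.apply_lie_eq_add a (ι z)
    rw [e1 a y ha, hd, hd, e1 a y ha, e1 _ y' e, ← map_add] at e2
    have e3 := hι e2
    show (y' z : g) = (d (y z) : g) - (y (d z) : g)
    rw [e3, add_sub_cancel_left]
  refine ⟨(0, d, 0) + hL.incl l, add_mem ⟨trivial, ⟨⟨δ, hcomm, fun z => hι ?_⟩, ?_⟩, trivial⟩
    ?_, ?_⟩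
  · rw [← hδ]
    exact hd z
  · refine (LieSubalgebra.mem_normalizer_iff _ _).2 fun y hy => ?_
    let a := hL.mkCarrier (0, y, 0) ⟨trivial, hy, trivial⟩
    obtain ⟨y', hy', e⟩ := h2 a y rfl
    have := (hdN a y rfl).symm.trans e
    rw [show ⁅d, y⁆ = y' from congrArg (fun a => a.2.1) this]
    exact hy'
  · exact ⟨trivial, ⟨hN (hL.incl_mem l).2.1, N.le_normalizer (hL.incl_mem l).2.1⟩, trivial⟩
  · intro b
    rw [map_add, LinearMap.add_apply, ← hL.incl_lie]
    rw [LieDerivation.add_apply, LieDerivation.ad_apply_apply, map_add]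
    congr 1
    let a := hL.mkCarrier (0, (hL.incl b).2.1, 0) ⟨trivial, (hL.incl_mem b).2.1, trivial⟩
    have e : b = ι (hL.incl b).1 + a + ι (hL.incl b).2.2 := by
      refine hL.incl_injective ?_
      rw [map_add, map_add]
      show _ = h.emb (hL.incl b).1 + (0, (hL.incl b).2.1, 0) + h.emb (hL.incl b).2.2
      rw [h.emb_s, h.emb_m]
      simp
    have e1 : hL.incl (D' b) = (0, ⁅d, (hL.incl b).2.1⁆, d (hL.incl b).2.2) := by
      have e2 := congrArg (fun b => hL.incl (D' b)) e
      simp only [map_add] at e2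
      rw [e2, h1 _ (Subtype.prop _), hd, hdN a _ rfl, map_zero, zero_add]
      show _ + h.emb _ = _
      rw [h.emb_m]
      simp
    rw [e1, law_apply]
    simp

end IsGammaTriple

/-! ### The derivation tower -/

namespace IsLieOn

variable {K : Type u} [Field K] {V : Type v} [AddCommGroup V] [Module K V]
    {Φ : V →ₗ[K] V →ₗ[K] V} {W W' : Submodule K V}

/-- If `W` is an ideal of `W'`, then the elements of `W'` act by derivations on every Lie algebra
isomorphic to `W`. -/
theorem exists_derivation (hW : IsLieOn Φ W) (hW' : IsLieOn Φ W') (hWW' : W ≤ W')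
    (hid : ∀ a ∈ W', ∀ b ∈ W, Φ a b ∈ W) {L : Type*} [LieRing L] [LieAlgebra K L]
    (e : L ≃ₗ⁅K⁆ hW.Carrier) {a : V} (ha : a ∈ W') :
    ∃ D : LieDerivation K L L, ∀ x, hW.incl (e (D x)) = Φ a (hW.incl (e x)) := by
  have hT : ∀ x, ∃ y, hW.incl (e y) = Φ a (hW.incl (e x)) := fun x =>
    ⟨e.symm (hW.mkCarrier _ (hid a ha _ (hW.incl_mem (e x)))),
      congrArg hW.incl (e.apply_symm_apply _)⟩
  choose T hT using hT
  have hlie : ∀ x y, hW.incl (e ⁅x, y⁆) = Φ (hW.incl (e x)) (hW.incl (e y)) := fun x y => by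
    rw [e.map_lie, hW.incl_lie]
  refine ⟨{ toFun := T
            map_add' := fun x y => e.injective (hW.incl_injective ?_)
            map_smul' := fun c x => e.injective (hW.incl_injective ?_)
            leibniz' := fun x y => e.injective (hW.incl_injective ?_) }, hT⟩
  · show hW.incl (e (T (x + y))) = hW.incl (e (T x + T y))
    rw [hT, map_add, map_add, map_add, map_add, map_add, hT, hT]
  · show hW.incl (e (T (c • x))) = hW.incl (e ((RingHom.id K) c • T x))
    rw [hT, map_smul, map_smul, map_smul, RingHom.id_apply, map_smul, map_smul, hT]
  · show hW.incl (e (T ⁅x, y⁆)) = hW.incl (e (⁅x, T y⁆ - ⁅y, T x⁆))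
    rw [← lie_skew y, sub_neg_eq_add, map_add, map_add, hlie, hlie, hT, hT, hT, hlie,
      hW'.leibniz _ ha _ (hWW' (hW.incl_mem _)) _ (hWW' (hW.incl_mem _)), add_comm]

/-- If `W` is an ideal of `W'` and has trivial centralizer in `W'`, and if all derivations of `W`
come from `W'`, then `W'` is isomorphic to the algebra of derivations of `W`. -/
theorem exists_derivation_equiv (hW : IsLieOn Φ W) (hW' : IsLieOn Φ W') (hWW' : W ≤ W')
    (hid : ∀ a ∈ W', ∀ b ∈ W, Φ a b ∈ W) (hcen : ∀ a ∈ W', (∀ b ∈ W, Φ a b = 0) → a = 0)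
    (hder : ∀ D : LieDerivation K hW.Carrier hW.Carrier,
      ∃ a ∈ W', ∀ b, hW.incl (D b) = Φ a (hW.incl b))
    {L : Type*} [LieRing L] [LieAlgebra K L] (e : L ≃ₗ⁅K⁆ hW.Carrier) :
    ∃ φ : LieDerivation K L L ≃ₗ⁅K⁆ hW'.Carrier,
      ∀ x, hW'.incl (φ (LieDerivation.ad K L x)) = hW.incl (e x) := by
  have hD := fun a : hW'.Carrier => hW.exists_derivation hW' hWW' hid e (hW'.incl_mem a)
  choose ψ hψ using hD
  have hlie : ∀ x y, hW.incl (e ⁅x, y⁆) = Φ (hW.incl (e x)) (hW.incl (e y)) := fun x y => by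
    rw [e.map_lie, hW.incl_lie]
  have huniq : ∀ a (D : LieDerivation K L L),
      (∀ x, hW.incl (e (D x)) = Φ (hW'.incl a) (hW.incl (e x))) → ψ a = D := fun a D h =>
    LieDerivation.ext fun x => e.injective (hW.incl_injective ((hψ a x).trans (h x).symm))
  let Ψ : hW'.Carrier →ₗ⁅K⁆ LieDerivation K L L :=
    { toFun := ψ
      map_add' := fun a b => huniq _ _ fun x => by
        rw [LieDerivation.add_apply, map_add, map_add, hψ, hψ, map_add, map_add,
          LinearMap.add_apply]
      map_smul' := fun c a => huniq _ _ fun x => by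
        rw [RingHom.id_apply, LieDerivation.smul_apply, map_smul, map_smul, hψ, map_smul, map_smul,
          LinearMap.smul_apply]
      map_lie' := fun {a b} => huniq _ _ fun x => by
        rw [LieDerivation.lie_apply, map_sub, map_sub, hψ, hψ, hψ, hψ, hW'.incl_lie,
          hW'.leibniz _ (hW'.incl_mem a) _ (hW'.incl_mem b) _ (hWW' (hW.incl_mem _)),
          add_sub_cancel_right] }
  have hinj : Function.Injective Ψ := by
    refine (injective_iff_map_eq_zero Ψ).2 fun a ha => hW'.incl_injective ?_
    rw [map_zero]
    refine hcen _ (hW'.incl_mem a) fun b hb => ?_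
    have h := hψ a (e.symm (hW.mkCarrier b hb))
    rw [show ψ a = 0 from ha, e.apply_symm_apply] at h
    refine h.symm.trans ?_
    simp
  have hsurj : Function.Surjective Ψ := by
    intro D
    -- the derivation of `W` corresponding to `D`
    let D' : LieDerivation K hW.Carrier hW.Carrier :=
      { (e : L →ₗ[K] hW.Carrier) ∘ₗ D.toLinearMap ∘ₗ (e.symm : hW.Carrier →ₗ[K] L) with
        leibniz' := fun a b => by
          show e (D (e.symm ⁅a, b⁆)) = ⁅a, e (D (e.symm b))⁆ - ⁅b, e (D (e.symm a))⁆
          rw [e.symm.map_lie, D.apply_lie_eq_sub, map_sub, e.map_lie, e.map_lie,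
            e.apply_symm_apply, e.apply_symm_apply] }
    obtain ⟨a, ha, h⟩ := hder D'
    refine ⟨hW'.mkCarrier a ha, huniq _ _ fun x => ?_⟩
    refine Eq.trans ?_ (h (e x))
    show _ = hW.incl (e (D (e.symm (e x))))
    rw [e.symm_apply_apply]
  let φ := LieEquiv.ofBijective Ψ ⟨hinj, hsurj⟩
  refine ⟨φ.symm, fun x => ?_⟩
  have h : Ψ (hW'.mkCarrier _ (hWW' (hW.incl_mem (e x)))) = LieDerivation.ad K L x :=
    huniq _ _ fun y => by
      rw [LieDerivation.ad_apply_apply, hlie]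
      rfl
  rw [← h]
  exact congrArg hW'.incl (φ.symm_apply_apply _)

end IsLieOn

theorem gammaSum_mono {K : Type u} [Field K] {g : Type v} [LieRing g] [LieAlgebra K g]
    (s : LieSubalgebra K g) {m : Submodule K g} {N N' : LieSubalgebra K (Module.End K m)}
    (hN : N ≤ N') : gammaSum s N ≤ gammaSum s N' :=
  fun _ ha => ⟨trivial, hN ha.2.1, trivial⟩

namespace IsGammaTriple

variable {K : Type u} [Field K] {g : Type v} [LieRing g] [LieAlgebra K g]
    [FiniteDimensional K g] {Γ : LieSubalgebra K (Module.End K g)}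
    {s k : LieSubalgebra K g} {m : Submodule K g}

theorem mu_range_le_iterNormalizer (h : IsGammaTriple Γ s k m) (n : ℕ) :
    h.mu.range ≤ iterNormalizer (algB Γ m) h.mu.range n :=
  iterNormalizer_mono h.mu_range_le_algB (Nat.zero_le n)

theorem isLieOn_iterNormalizer (h : IsGammaTriple Γ s k m) (n : ℕ) :
    IsLieOn h.law (gammaSum s (iterNormalizer (algB Γ m) h.mu.range n)) :=
  h.isLieOn_gammaSum (h.mu_range_le_iterNormalizer n) (iterNormalizer_le h.mu_range_le_algB n)

/-- The canonical map from `g` to `s ⊕ μ(k) ⊕ m` is an isomorphism. -/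
theorem exists_tower_zero (h : IsGammaTriple Γ s k m) (hc : LieAlgebra.center K g = ⊥) :
    ∃ φ : (derTower K g 0).carrier ≃ₗ⁅K⁆ (h.isLieOn_iterNormalizer 0).Carrier,
      ∀ (x : s) (y : k) (z : m),
        (h.isLieOn_iterNormalizer 0).incl (φ ((x : g) + (y : g) + (z : g) : g))
          = (x, h.mu y, z) := by
  let ι := h.embHom le_rfl (h.isLieOn_iterNormalizer 0)
  have hsurj : Function.Surjective ι := by
    intro a
    obtain ⟨-, ⟨y, hy⟩, -⟩ := (h.isLieOn_iterNormalizer 0).incl_mem a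
    refine ⟨_, (h.isLieOn_iterNormalizer 0).incl_injective
      ((h.emb_add_add ((h.isLieOn_iterNormalizer 0).incl a).1 y
        ((h.isLieOn_iterNormalizer 0).incl a).2.2).trans ?_)⟩
    exact Prod.ext rfl (Prod.ext hy rfl)
  let φ : g ≃ₗ⁅K⁆ (h.isLieOn_iterNormalizer 0).Carrier :=
    LieEquiv.ofBijective ι ⟨h.embHom_injective hc _ _, hsurj⟩
  exact ⟨φ, fun x y z => h.emb_add_add x y z⟩

variable [CharZero K]

theorem exists_law_eq_derivation_iterNormalizer (h : IsGammaTriple Γ s k m)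
    (hc : LieAlgebra.center K g = ⊥) (n : ℕ)
    (D : LieDerivation K (h.isLieOn_iterNormalizer n).Carrier
      (h.isLieOn_iterNormalizer n).Carrier) :
    ∃ a ∈ gammaSum s (iterNormalizer (algB Γ m) h.mu.range (n + 1)),
      ∀ b, (h.isLieOn_iterNormalizer n).incl (D b)
        = h.law a ((h.isLieOn_iterNormalizer n).incl b) :=
  have ⟨_, hj⟩ := h.iterNormalizer_nil n
  h.exists_law_eq_derivation hc (h.mu_range_le_iterNormalizer n)
    (iterNormalizer_le h.mu_range_le_algB n) (h.isLieOn_iterNormalizer n) hj D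

theorem exists_tower_succ (h : IsGammaTriple Γ s k m) (hc : LieAlgebra.center K g = ⊥) (n : ℕ)
    (φ : (derTower K g n).carrier ≃ₗ⁅K⁆ (h.isLieOn_iterNormalizer n).Carrier) :
    ∃ φ' : (derTower K g (n + 1)).carrier ≃ₗ⁅K⁆ (h.isLieOn_iterNormalizer (n + 1)).Carrier,
      ∀ a, (h.isLieOn_iterNormalizer (n + 1)).incl (φ' (derTowerAd K g n a))
        = (h.isLieOn_iterNormalizer n).incl (φ a) :=
  (h.isLieOn_iterNormalizer n).exists_derivation_equiv (h.isLieOn_iterNormalizer (n + 1))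
    (gammaSum_mono s (iterNormalizer_mono h.mu_range_le_algB n.le_succ))
    (fun _ ha _ hb => ⟨trivial, add_mem (lie_mem_iterNormalizer ha.2.1 hb.2.1)
      (h.mu_range_le_iterNormalizer n ⟨_, rfl⟩), trivial⟩)
    (fun _ _ h0 => h.eq_zero_of_law_emb_eq_zero fun b =>
      h0 _ (h.emb_mem (h.mu_range_le_iterNormalizer n) b))
    (h.exists_law_eq_derivation_iterNormalizer hc n) φ

/-- The isomorphisms of the terms of the derivation tower with the algebras `s ⊕ Nⁿ ⊕ m`. -/
noncomputable def towerEquiv (h : IsGammaTriple Γ s k m) (hc : LieAlgebra.center K g = ⊥) :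
    ∀ n, (derTower K g n).carrier ≃ₗ⁅K⁆ (h.isLieOn_iterNormalizer n).Carrier
  | 0 => (h.exists_tower_zero hc).choose
  | n + 1 => (h.exists_tower_succ hc n (towerEquiv h hc n)).choose

theorem towerEquiv_ad (h : IsGammaTriple Γ s k m) (hc : LieAlgebra.center K g = ⊥) (n : ℕ)
    (a : (derTower K g n).carrier) :
    (h.isLieOn_iterNormalizer (n + 1)).incl (h.towerEquiv hc (n + 1) (derTowerAd K g n a))
      = (h.isLieOn_iterNormalizer n).incl (h.towerEquiv hc n a) :=
  (h.exists_tower_succ hc n (h.towerEquiv hc n)).choose_spec a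

theorem bijective_derTowerAd (h : IsGammaTriple Γ s k m) (hc : LieAlgebra.center K g = ⊥) {n : ℕ}
    (hn : iterNormalizer (algB Γ m) h.mu.range (n + 1) = iterNormalizer (algB Γ m) h.mu.range n) :
    Function.Bijective (derTowerAd K g n) := by
  constructor
  · intro a b hab
    refine (h.towerEquiv hc n).injective ((h.isLieOn_iterNormalizer n).incl_injective ?_)
    show (h.isLieOn_iterNormalizer n).incl (h.towerEquiv hc n a)
      = (h.isLieOn_iterNormalizer n).incl (h.towerEquiv hc n b)
    rw [← h.towerEquiv_ad hc n a, hab, h.towerEquiv_ad]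
  · intro D
    have hD := gammaSum_mono s hn.le
      ((h.isLieOn_iterNormalizer (n + 1)).incl_mem (h.towerEquiv hc (n + 1) D))
    refine ⟨(h.towerEquiv hc n).symm ((h.isLieOn_iterNormalizer n).mkCarrier _ hD),
      (h.towerEquiv hc (n + 1)).injective
        ((h.isLieOn_iterNormalizer (n + 1)).incl_injective ?_)⟩
    show (h.isLieOn_iterNormalizer (n + 1)).incl (h.towerEquiv hc (n + 1) (derTowerAd K g n _))
      = (h.isLieOn_iterNormalizer (n + 1)).incl (h.towerEquiv hc (n + 1) D)
    rw [h.towerEquiv_ad, LieEquiv.apply_symm_apply]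
    rfl

/-- A stationary term of the tower has no outer derivations. -/
theorem isCompleteLie (h : IsGammaTriple Γ s k m) (hc : LieAlgebra.center K g = ⊥) {q : ℕ}
    (hq : iterNormalizer (algB Γ m) h.mu.range (q + 1) = iterNormalizer (algB Γ m) h.mu.range q) :
    IsCompleteLie K (h.isLieOn_iterNormalizer q).Carrier := by
  refine ⟨h.center_carrier_eq_bot (h.mu_range_le_iterNormalizer q) _, fun D => ?_⟩
  obtain ⟨a, ha, hD⟩ := h.exists_law_eq_derivation_iterNormalizer hc q D
  rw [hq] at ha
  refine ⟨(h.isLieOn_iterNormalizer q).mkCarrier a ha, LieDerivation.ext fun b => ?_⟩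
  refine (h.isLieOn_iterNormalizer q).incl_injective ?_
  rw [LieDerivation.ad_apply_apply, hD]
  rfl

end IsGammaTriple

theorem mainTheorem3 {K : Type u} [Field K] [CharZero K] {g : Type v} [LieRing g] [LieAlgebra K g]
    [FiniteDimensional K g] (hcenter : LieAlgebra.center K g = ⊥)
    (Γ : LieSubalgebra K (Module.End K g)) (s k : LieSubalgebra K g) (m : Submodule K g)
    (h : IsGammaTriple Γ s k m) (N : ℕ → LieSubalgebra K (Module.End K m))
    (hN : N = iterNormalizer (algB Γ m) h.mu.range) :
    -- the sequence of normalizers is an ascending chain in `B`, each term an ideal of the next,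
    -- and it becomes stationary
    (∀ n, N n ≤ algB Γ m) ∧
    (∀ n, N n ≤ N (n + 1) ∧ ∀ x ∈ N (n + 1), ∀ y ∈ N n, ⁅x, y⁆ ∈ N n) ∧
    (∃ q, N (q + 1) = N q) ∧
    -- `s ⊕ B ⊕ m` is a Lie algebra with the law `Φ`, and the `s ⊕ Nⁿ ⊕ m` are Lie subalgebras
    IsLieOn h.law (gammaSum s (algB Γ m)) ∧
    ∃ hL : ∀ n, IsLieOn h.law (gammaSum s (N n)),
      -- `gₙ` is `s ⊕ Nⁿ ⊕ m`, compatibly with `g = s ⊕ k ⊕ m` and with the maps `ad : gₙ → gₙ₊₁`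
      (∃ φ : ∀ n, (derTower K g n).carrier ≃ₗ⁅K⁆ (hL n).Carrier,
        (∀ (x : s) (y : k) (z : m),
          (hL 0).incl (φ 0 ((x : g) + (y : g) + (z : g) : g)) = (x, h.mu y, z)) ∧
        ∀ n (a : (derTower K g n).carrier),
          (hL (n + 1)).incl (φ (n + 1) (derTowerAd K g n a)) = (hL n).incl (φ n a)) ∧
      -- the tower terminates at the complete Lie algebra `s ⊕ N^q ⊕ m`
      ∀ q, N (q + 1) = N q →
        (∀ n, q ≤ n → N n = N q ∧ Function.Bijective (derTowerAd K g n)) ∧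
        IsCompleteLie K (hL q).Carrier := by
  subst hN
  refine ⟨iterNormalizer_le h.mu_range_le_algB,
    fun n => ⟨iterNormalizer_mono h.mu_range_le_algB n.le_succ,
      fun x hx y hy => lie_mem_iterNormalizer hx hy⟩,
    exists_iterNormalizer_succ_eq h.mu_range_le_algB,
    h.isLieOn_gammaSum h.mu_range_le_algB le_rfl, h.isLieOn_iterNormalizer,
    ⟨h.towerEquiv hcenter, (h.exists_tower_zero hcenter).choose_spec, h.towerEquiv_ad hcenter⟩,
    fun q hq => ⟨fun n hn => ⟨iterNormalizer_eq_of_le hq hn, h.bijective_derTowerAd hcenter ?_⟩,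
      h.isCompleteLie hcenter hq⟩⟩
  rw [iterNormalizer_eq_of_le hq hn, iterNormalizer_eq_of_le hq (hn.trans n.le_succ)]
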